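/- Let $\mathbb F$ be a commutative ring. A *dg-operad* $\mathcal P$ over $\mathbb F$ is given by dg-modules $\mathcal P(r)$, $r\ge 0$ (lower grading, differential of degree $-1$), with an action of $\Sigma_r$, a unit $1\in\mathcal P(1)_0$, and partial composition products $\circ_k:\mathcal P(r)\otimes\mathcal P(s)\to\mathcal P(r+s-1)$, $1\le k\le r$, that are morphisms of dg-modules, unital, associative (with the Koszul sign for insertions at two different entries) and equivariant. For permutations, $u\circ_k v\in\Sigma_{r+s-1}$ is obtained from the sequence $(u(1),\dots,u(r))$ by replacing the value $k$ by $(v(1)+k-1,\dots,v(s)+k-1)$ and by adding $s-1$ to the values $u(i)>k$. The associative operad $\mathcal A$ has $\mathcal A(r)=\mathbb F[\Sigma_r]$, in degree $0$, with this composition. *The Barratt-Eccles operad.* $\mathcal E(r)_d$ is the $\mathbb F$-module generated by the tuples $(w_0,\dots,w_d)$ in $\Sigma_r$, where $(w_0,\dots,w_d)=0$ if $w_i=w_{i+1}$ for some $i$. The differential is $\delta(w_0,\dots,w_d)=\sum_i(-1)^i(w_0,\dots,\widehat{w_i},\dots,w_d)$, the action is $\sigma\cdot(w_0,\dots,w_d)=(\sigma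 w_0,\dots,\sigma w_d)$, and for $u\in\mathcal E(r)_d$, $v\in\mathcal E(s)_e$, $$u\circ_k v=\sum\pm(u_{x_0}\circ_k v_{y_0},\dots,u_{x_{d+e}}\circ_k v_{y_{d+e}}),$$ summed over the lattice paths from $(0,0)$ to $(d,e)$ with unit steps; the sign is the signature of the shuffle that takes the horizontal segments of the path to the first places and the vertical segments to the last places. *The surjection complexes.* $\mathcal X(r)_d$ is the $\mathbb F$-module generated by the sequences $u=(u(1),\dots,u(r+d))$ with values in $\{1,\dots,r\}$, where $u=0$ if $u$ is not surjective or if $u(i)=u(i+1)$ for some $i$; $\Sigma_r$ acts by $\sigma\cdot u=(\sigma(u(1)),\dots,\sigma(u(r+d)))$. A *caesura* of $u$ is a term that is not the last occurrence of its value. The *table arrangement* splits $u$ into lines, by ending a line after each caesura. The differential is $\delta(u)=\sum_i\pm(u(1),\dots,\widehat{u(i)},\dots,u(r+d))$, where the signs of the caesuras are alternately $+,-,+,\dots$, where the last occurrence of a value has the sign opposite to that of the previous occurrence of this value, and where the terms that omit a value occurring only once are zero. If $u(i_1),\dots,u(i_n)$ are the occurrences of $k$ in $u$, then $u\circ_k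 v$ is the sum, over all $1=j_0\le j_1\le\dots\le j_n=s+e$, of the signed sequences obtained by replacing $u(i_m)$ by $V_m=(v(j_{m-1}),\dots,v(j_m))$, $m=1,\dots,n$, and then adding $k-1$ to the values of $v$ and $s-1$ to the values $u(i)>k$. (For $s=0$, the empty sequence $v$ has one splitting, into one empty component, if $n=1$, and none if $n\ge 2$.) The sign is the Koszul sign of the permutation $U_0U_1\cdots U_nV_1\cdots V_n\mapsto U_0V_1U_1\cdots V_nU_n$, where $U_m=(u(i_m),\dots,u(i_{m+1}))$, $i_0=1$, $i_{n+1}=r+d$, and where a component has degree $d'$ if it meets $d'+1$ lines of the table arrangement of $u$, respectively $v$ (the empty component has degree $0$). *Table reduction.* Let $w=(w_0,\dots,w_d)$ be a simplex in $\Sigma_r$, and let $r_0,\dots,r_d\ge1$ with $r_0+\dots+r_d=r+d$. Let row $i$ consist of the first $r_i$ terms of $(w_i(1),\dots,w_i(r))$ that do not occur among the terms, other than the last one, of the rows $0,\dots,i-1$. The concatenation of the rows is a sequence of length $r+d$, and $\mathrm{TR}(w)\in\mathcal X(r)_d$ is the sum of these sequences over all $(r_0,\dots,r_d)$. (In arity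 $0$, $\mathrm{TR}$ sends the generator of $\mathcal E(0)=\mathbb F$ to the generator of $\mathcal X(0)=\mathbb F$, the empty sequence.) *Filtrations.* For $n\ge1$, $F_n\mathcal E(r)$ is spanned by the simplices $w$ such that, for all $i<j$, the relative order of $i$ and $j$ changes at most $n-1$ times along $w_0,\dots,w_d$; $F_n\mathcal X(r)$ is spanned by the surjections $u$ such that, for all $i<j$, the subsequence of the occurrences of $i$ and $j$ has at most $n$ places where consecutive terms differ. **Theorem.** The differential and the composition products of $\mathcal X$ are well defined (the formulas above hold for all sequences, degenerate or not), and they provide $\mathcal X$ with the structure of a dg-operad. The map $\mathrm{TR}:\mathcal E\to\mathcal X$ is well defined (the formula above holds for all simplices, degenerate or not), and it is a morphism of dg-operads, surjective in every arity. The map $\sigma\mapsto(\sigma)$, which sends a permutation to the simplex of dimension $0$ that it defines, is an isomorphism of the associative operad $\mathcal A$ onto $F_1\mathcal E$; the map $\sigma\mapsto(\sigma(1),\dots,\sigma(r))$ is an isomorphism of $\mathcal A$ onto $F_1\mathcal X$; and $\mathrm{TR}$ restricts to the identity of $\mathcal A$ with respect to these identifications. -/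

import Mathlib

universe u

/-! ### Differential graded operads

A dg-operad over a commutative ring is presented by its partial composition products. All modules
are `ℤ`-graded with lower (homological) grading, so that differentials have degree `-1`. -/

/-- In the composite at the `k`-th entry of an operation with `r` entries and an operation with `s`
entries, an entry `x ≠ k` of the first one keeps its number if `x < k`, and is shifted by `s - 1`
if `x > k`. The composite has `n = r + s - 1` entries, which is written `n + 1 = r + s`. -/
def outerIndex {r s n : ℕ} (h : n + 1 = r + s) (k x : Fin r) (hx : x ≠ k) : Fin n :=
  if hlt : x < k then ⟨x.1, by rw [Fin.lt_def] at hlt; omega⟩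
  else ⟨x.1 + s - 1, by rw [Fin.lt_def] at hlt; have := Fin.val_ne_of_ne hx; omega⟩

/-- The entry `j` of the operation that is inserted at the entry `k` gets the number `k + j`
(counting from `0`). -/
def innerIndex {r s n : ℕ} (h : n + 1 = r + s) (k : Fin r) (j : Fin s) : Fin n :=
  ⟨k.1 + j.1, by omega⟩

/-- The entries of a composite at the `k`-th entry: the entries `x ≠ k` of the outer operation and
the entries of the inner operation, numbered by `outerIndex` and `innerIndex`. -/
def blockEquiv {r s n : ℕ} (h : n + 1 = r + s) (k : Fin r) :
    {x : Fin r // x ≠ k} ⊕ Fin s ≃ Fin n where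
  toFun := Sum.elim (fun x => outerIndex h k x.1 x.2) (innerIndex h k)
  invFun m :=
    if h₁ : m.1 < k.1 then Sum.inl ⟨⟨m.1, by omega⟩, Fin.ne_of_val_ne (by simp; omega)⟩
    else if h₂ : m.1 < k.1 + s then Sum.inr ⟨m.1 - k.1, by omega⟩
    else Sum.inl ⟨⟨m.1 + 1 - s, by omega⟩, Fin.ne_of_val_ne (by simp; omega)⟩
  left_inv := by
    rintro (⟨x, hx⟩ | j)
    · have hx' := Fin.val_ne_of_ne hx
      by_cases hlt : x < k
      · have hlt' : x.1 < k.1 := hlt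
        simp [outerIndex, hlt]
      · have hlt' : ¬ x.1 < k.1 := hlt
        have h1 : ¬ (x.1 + s - 1 < k.1) := by omega
        have h2 : ¬ (x.1 + s - 1 < k.1 + s) := by omega
        have h3 : x.1 + s - 1 + 1 - s = x.1 := by omega
        simp [outerIndex, hlt, h1, h2, h3]
    · simp [innerIndex]
  right_inv := by
    intro m
    by_cases h₁ : m.1 < k.1
    · have h1' : (⟨m.1, by omega⟩ : Fin r) < k := h₁
      simp [h₁, outerIndex, h1']
    · by_cases h₂ : m.1 < k.1 + s
      · have h3 : k.1 + (m.1 - k.1) = m.1 := by omega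
        simp [h₁, h₂, innerIndex, h3]
      · have h3 : ¬ (⟨m.1 + 1 - s, by omega⟩ : Fin r) < k := by
          simp only [Fin.lt_def]; omega
        have h4 : m.1 + 1 - s + s - 1 = m.1 := by omega
        simp [h₁, h₂, outerIndex, h3, h4]

/-- The partial composition product `u ∘ₖ v` of the permutation operad: in the sequence of values
of `u`, the value `k` (which stands at the place `u⁻¹ k`) is replaced by the sequence of values
of `v`, and the values are renumbered by `blockEquiv h k`. -/
def permComp {r s n : ℕ} (h : n + 1 = r + s) (k : Fin r)
    (u : Equiv.Perm (Fin r)) (v : Equiv.Perm (Fin s)) : Equiv.Perm (Fin n) :=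
  (blockEquiv h (u.symm k)).symm.trans
    ((Equiv.sumCongr
      (u.subtypeEquiv (p := fun x => x ≠ u.symm k) (q := fun x => x ≠ k)
        (fun x => by rw [ne_eq, ne_eq, Equiv.eq_symm_apply])) v).trans
      (blockEquiv h k))

/-- The data underlying a dg-operad; the laws are in `IsDGOperad`. -/
structure DGOperadData (F : Type u) [CommRing F] where
  /-- the total module `⨁ d, P(r)_d` of the operations with `r` entries -/
  carrier : ℕ → Type u
  [acg : ∀ r, AddCommGroup (carrier r)]
  [mod : ∀ r, Module F (carrier r)]
  /-- the component of (lower) degree `d` -/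
  deg : ∀ r, ℤ → Submodule F (carrier r)
  /-- the differential -/
  diff : ∀ r, carrier r →ₗ[F] carrier r
  /-- the action of the symmetric group -/
  act : ∀ r, Equiv.Perm (Fin r) → carrier r →ₗ[F] carrier r
  /-- the operad unit -/
  one : carrier 1
  /-- the partial composition product `p ∘ₖ q` -/
  comp : ∀ {r s n : ℕ}, n + 1 = r + s → Fin r → carrier r →ₗ[F] carrier s →ₗ[F] carrier n

attribute [instance] DGOperadData.acg DGOperadData.mod

/-- The laws of a dg-operad: each `P(r)` is a dg-module with a (left) action of the symmetric group
by automorphisms of dg-modules, and the partial composition products are morphisms of dg-modules,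
and are unital, associative (with the Koszul sign) and equivariant. -/
structure IsDGOperad {F : Type u} [CommRing F] (P : DGOperadData F) : Prop where
  isInternal : ∀ r, DirectSum.IsInternal (P.deg r)
  diff_mem : ∀ r d x, x ∈ P.deg r d → P.diff r x ∈ P.deg r (d - 1)
  diff_diff : ∀ r x, P.diff r (P.diff r x) = 0
  act_one : ∀ r x, P.act r 1 x = x
  act_mul : ∀ r σ τ x, P.act r (σ * τ) x = P.act r σ (P.act r τ x)
  act_mem : ∀ r σ d x, x ∈ P.deg r d → P.act r σ x ∈ P.deg r d
  diff_act : ∀ r σ x, P.diff r (P.act r σ x) = P.act r σ (P.diff r x)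
  one_mem : P.one ∈ P.deg 1 0
  diff_one : P.diff 1 P.one = 0
  comp_mem : ∀ {r s n : ℕ} (h : n + 1 = r + s) (k : Fin r) (d e : ℤ) (p : P.carrier r)
    (q : P.carrier s), p ∈ P.deg r d → q ∈ P.deg s e → P.comp h k p q ∈ P.deg n (d + e)
  /-- the derivation rule -/
  diff_comp : ∀ {r s n : ℕ} (h : n + 1 = r + s) (k : Fin r) (d : ℤ) (p : P.carrier r)
    (q : P.carrier s), p ∈ P.deg r d →
    P.diff n (P.comp h k p q) =
      P.comp h k (P.diff r p) q + d.negOnePow • P.comp h k p (P.diff s q)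
  one_comp : ∀ {s : ℕ} (h : s + 1 = 1 + s) (q : P.carrier s), P.comp h 0 P.one q = q
  comp_one : ∀ {r : ℕ} (h : r + 1 = r + 1) (k : Fin r) (p : P.carrier r), P.comp h k p P.one = p
  /-- `(p ∘ᵢ q) ∘ t = p ∘ᵢ (q ∘ⱼ t)`, where `t` is inserted at the entry `j` of `q` -/
  comp_assoc : ∀ {r s t m n l : ℕ} (hm : m + 1 = r + s) (hl : l + 1 = m + t) (hn : n + 1 = s + t)
    (hl' : l + 1 = r + n) (i : Fin r) (j : Fin s)
    (p : P.carrier r) (q : P.carrier s) (x : P.carrier t),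
    P.comp hl (innerIndex hm i j) (P.comp hm i p q) x = P.comp hl' i p (P.comp hn j q x)
  /-- insertions at two different entries of `p` commute up to the Koszul sign -/
  comp_comm : ∀ {r s t m n l : ℕ} (hm : m + 1 = r + s) (hl : l + 1 = m + t) (hn : n + 1 = r + t)
    (hl' : l + 1 = n + s) (i k : Fin r) (hik : i ≠ k) (d e : ℤ)
    (p : P.carrier r) (q : P.carrier s) (x : P.carrier t), q ∈ P.deg s d → x ∈ P.deg t e →
    P.comp hl (outerIndex hm i k hik.symm) (P.comp hm i p q) x =
      (d * e).negOnePow • P.comp hl' (outerIndex hn k i hik) (P.comp hn k p x) q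
  equivariant : ∀ {r s n : ℕ} (h : n + 1 = r + s) (k : Fin r) (σ : Equiv.Perm (Fin r))
    (τ : Equiv.Perm (Fin s)) (p : P.carrier r) (q : P.carrier s),
    P.comp h (σ k) (P.act r σ p) (P.act s τ q) =
      P.act n (permComp h (σ k) σ τ) (P.comp h k p q)

/-- The family of linear maps `f` is a morphism of dg-operads. -/
structure IsDGOperadHom {F : Type u} [CommRing F] (P Q : DGOperadData F)
    (f : ∀ r, P.carrier r →ₗ[F] Q.carrier r) : Prop where
  map_mem : ∀ r d x, x ∈ P.deg r d → f r x ∈ Q.deg r d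
  map_diff : ∀ r x, f r (P.diff r x) = Q.diff r (f r x)
  map_act : ∀ r σ x, f r (P.act r σ x) = Q.act r σ (f r x)
  map_one : f 1 P.one = Q.one
  map_comp : ∀ {r s n : ℕ} (h : n + 1 = r + s) (k : Fin r) (p : P.carrier r) (q : P.carrier s),
    f n (P.comp h k p q) = Q.comp h k (f r p) (f s q)

/-- The sequence `(σ 0, …, σ (r - 1))` of the values of a permutation. -/
def word {r : ℕ} (σ : Equiv.Perm (Fin r)) : List (Fin r) := List.ofFn σ

/-! ### The associative operad -/

/-- The associative operad: `A(r)` is the free module on the permutations, in degree `0`. -/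
noncomputable def assocOperad (F : Type u) [CommRing F] : DGOperadData F where
  carrier r := Equiv.Perm (Fin r) →₀ F
  deg _ d := if d = 0 then ⊤ else ⊥
  diff _ := 0
  act _ σ := Finsupp.linearCombination F fun w => Finsupp.single (σ * w) 1
  one := Finsupp.single 1 1
  comp h k := Finsupp.linearCombination F fun u => Finsupp.linearCombination F fun v =>
    Finsupp.single (permComp h k u v) 1

/-! ### The Barratt-Eccles operad -/

/-- The non-degenerate simplices `(w₀, …, w_d)` of the homogeneous bar construction of the
symmetric group: consecutive permutations are different. -/
abbrev BEGen (r : ℕ) : Type :=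
  {w : List (Equiv.Perm (Fin r)) // w ≠ [] ∧ w.IsChain (· ≠ ·)}

/-- The element of the normalized bar complex represented by any simplex: degenerate simplices
represent `0` (and so does the empty sequence, which is not a simplex). -/
noncomputable def beClass (F : Type u) [CommRing F] {r : ℕ} (w : List (Equiv.Perm (Fin r))) :
    BEGen r →₀ F :=
  if h : w ≠ [] ∧ w.IsChain (· ≠ ·) then Finsupp.single ⟨w, h⟩ 1 else 0

/-- `δ(w₀, …, w_d) = ∑ (-1)^i (w₀, …, ŵᵢ, …, w_d)`. -/
noncomputable def beDiff (F : Type u) [CommRing F] {r : ℕ} (w : List (Equiv.Perm (Fin r))) :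
    BEGen r →₀ F :=
  ∑ i ∈ Finset.range w.length, ((-1 : ℤ) ^ i) • beClass F (w.eraseIdx i)

/-- The paths from the first to the last vertex in the `d × e`-diagram whose columns are labelled
by a sequence `(a₀, …, a_d)` and whose rows by a sequence `(b₀, …, b_e)`. A path is
given by the labels of its vertices, together with the number of pairs that consist of a vertical
segment and a later horizontal segment: this is the number of inversions of the shuffle that takes
the horizontal segments to the first places. -/
def latticePaths {α β : Type} : List α → List β → List (ℕ × List (α × β))
  | [a], [b] => [(0, [(a, b)])]
  | a :: as, b :: bs =>
      ((latticePaths as (b :: bs)).map fun t => (t.1, (a, b) :: t.2)) ++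
      ((latticePaths (a :: as) bs).map fun t => (t.1 + as.length, (a, b) :: t.2))
  | _, _ => []
termination_by as bs => as.length + bs.length

/-- `u ∘ₖ v = ∑ ± (u_{x₀} ∘ₖ v_{y₀}, …)`, summed over the paths `(x_*, y_*)`. -/
noncomputable def beComp (F : Type u) [CommRing F] {r s n : ℕ} (h : n + 1 = r + s) (k : Fin r)
    (u : List (Equiv.Perm (Fin r))) (v : List (Equiv.Perm (Fin s))) : BEGen n →₀ F :=
  ((latticePaths u v).map fun t =>
    ((-1 : ℤ) ^ t.1) • beClass F (t.2.map fun p => permComp h k p.1 p.2)).sum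

/-- The Barratt-Eccles operad. -/
noncomputable def barrattEccles (F : Type u) [CommRing F] : DGOperadData F where
  carrier r := BEGen r →₀ F
  deg _ d := Finsupp.supported F F {w | (w.1.length : ℤ) - 1 = d}
  diff _ := Finsupp.linearCombination F fun w => beDiff F w.1
  act _ σ := Finsupp.linearCombination F fun w => beClass F (w.1.map (σ * ·))
  one := beClass F [1]
  comp h k := Finsupp.linearCombination F fun u => Finsupp.linearCombination F fun v =>
    beComp F h k u.1 v.1

/-! ### The surjection operad -/

/-- The non-degenerate surjections `(u(1), …, u(r + d))` onto `r` values, written as sequences: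
every value occurs, and consecutive terms are different. -/
abbrev SurjGen (r : ℕ) : Type :=
  {u : List (Fin r) // (∀ x, x ∈ u) ∧ u.IsChain (· ≠ ·)}

/-- The element of the module of surjections represented by any sequence: sequences that are not
surjective, and degenerate ones, represent `0`. -/
noncomputable def surjClass (F : Type u) [CommRing F] {r : ℕ} (u : List (Fin r)) :
    SurjGen r →₀ F :=
  if h : (∀ x, x ∈ u) ∧ u.IsChain (· ≠ ·) then Finsupp.single ⟨u, h⟩ 1 else 0

/-- The term of index `i` (counted from `0`) of the sequence is a caesura: it is not the last
occurrence of its value. -/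
def IsCaesura {r : ℕ} (u : List (Fin r)) (i : ℕ) : Prop :=
  ∃ h : i < u.length, u[i] ∈ u.drop (i + 1)

instance {r : ℕ} (u : List (Fin r)) : DecidablePred (IsCaesura u) := fun i => by
  unfold IsCaesura; infer_instance

/-- The line of the table arrangement (counted from `0`) that contains the term of index `i`. Every
line except for the last one ends at a caesura. -/
def lineOf {r : ℕ} (u : List (Fin r)) (i : ℕ) : ℕ :=
  ((Finset.range i).filter (IsCaesura u)).card

/-- The sign marked at the term of index `i`: caesuras have alternate signs, starting with `+`, and
the last occurrence of a value has the sign opposite to the sign of its previous occurrence.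
A value that occurs only once has no sign. -/
def diffSign {r : ℕ} (u : List (Fin r)) (i : ℕ) : ℤ :=
  if IsCaesura u i then (-1) ^ lineOf u i
  else if h : ((Finset.range i).filter fun j => u[j]? = u[i]?).Nonempty then
    -(-1) ^ lineOf u (((Finset.range i).filter fun j => u[j]? = u[i]?).max' h)
  else 0

/-- `δ(u(1), …, u(r + d)) = ∑ ± (u(1), …, û(i), …, u(r + d))`. -/
noncomputable def surjDiff (F : Type u) [CommRing F] {r : ℕ} (u : List (Fin r)) :
    SurjGen r →₀ F :=
  ∑ i ∈ Finset.range u.length, diffSign u i • surjClass F (u.eraseIdx i)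

/-- The terms of a sequence, each one with its line in the table arrangement. -/
def withLines {r : ℕ} (u : List (Fin r)) : List (Fin r × ℕ) :=
  u.zipIdx.map fun p => (p.1, lineOf u p.2)

/-- A component of a sequence has degree `d'` if it intersects `d' + 1` lines of the table
arrangement. -/
def componentDegree {r : ℕ} (c : List (Fin r × ℕ)) : ℕ :=
  (c.map Prod.snd).toFinset.card - 1

/-- The components `(u(i₀), …, u(i₁)) (u(i₁), …, u(i₂)) ⋯ (u(iₙ), …, u(iₙ₊₁))` of a sequence that
is cut at the occurrences `u(i₁), …, u(iₙ)` of `k`. -/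
def cutAt {r : ℕ} (k : Fin r) : List (Fin r × ℕ) → List (List (Fin r × ℕ))
  | [] => [[]]
  | x :: l =>
    match cutAt k l with
    | [] => []
    | c :: cs => if x.1 = k then [x] :: (x :: c) :: cs else (x :: c) :: cs

/-- All splittings `(v(j₀), …, v(j₁)) (v(j₁), …, v(j₂)) ⋯ (v(jₙ₋₁), …, v(jₙ))` of a sequence into `n`
components, where `j₀ ≤ j₁ ≤ ⋯ ≤ jₙ` and `j₀`, `jₙ` are the first and the last index. (The empty
sequence has one splitting, into a single empty component.) -/
def splittings {α : Type} : ℕ → List α → List (List (List α))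
  | 0, _ => []
  | 1, v => [[v]]
  | n + 2, v => (List.range v.length).flatMap fun j =>
      (splittings (n + 1) (v.drop j)).map fun cs => v.take (j + 1) :: cs

/-- Replaces the successive occurrences of `k` in a sequence by the given components, and
renumbers the values. -/
def substitute {r s n : ℕ} (h : n + 1 = r + s) (k : Fin r) :
    List (Fin r) → List (List (Fin s)) → List (Fin n)
  | [], _ => []
  | x :: u, cs =>
    if hx : x = k then (cs.headD []).map (innerIndex h k) ++ substitute h k u cs.tail
    else outerIndex h k x hx :: substitute h k u cs

/-- The exponent of the sign of the permutation
`U₀ U₁ ⋯ Uₙ V₁ ⋯ Vₙ ↦ U₀ V₁ U₁ V₂ U₂ ⋯ Vₙ Uₙ` by the sign rule, in terms of the degrees of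
`U₁, …, Uₙ` and of `V₁, …, Vₙ`: each `Vₘ` is permuted with `Uₘ, …, Uₙ`. -/
def insertionExponent : List ℕ → List ℕ → ℕ
  | d :: ds, e :: es => e * (d :: ds).sum + insertionExponent ds es
  | _, _ => 0

/-- The composition product `u ∘ₖ v` of surjections: the sum of the composite surjections, with
their signs. -/
noncomputable def surjComp (F : Type u) [CommRing F] {r s n : ℕ} (h : n + 1 = r + s) (k : Fin r)
    (u : List (Fin r)) (v : List (Fin s)) : SurjGen n →₀ F :=
  ((splittings (u.count k) (withLines v)).map fun cs =>
    ((-1 : ℤ) ^ insertionExponent ((cutAt k (withLines u)).tail.map componentDegree)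
        (cs.map componentDegree)) •
      surjClass F (substitute h k u (cs.map (List.map Prod.fst)))).sum

/-- The surjection operad. -/
noncomputable def surjOperad (F : Type u) [CommRing F] : DGOperadData F where
  carrier r := SurjGen r →₀ F
  deg r d := Finsupp.supported F F {u | (u.1.length : ℤ) - r = d}
  diff _ := Finsupp.linearCombination F fun u => surjDiff F u.1
  act _ σ := Finsupp.linearCombination F fun u => surjClass F (u.1.map σ)
  one := surjClass F [0]
  comp h k := Finsupp.linearCombination F fun u => Finsupp.linearCombination F fun v =>
    surjComp F h k u.1 v.1

/-! ### The table reduction morphism -/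

/-- The tables (lists of rows) that arise from `(w₀, …, w_d)` by table reduction, where the values
in `seen` are already used as last occurrences. The first row consists of the first `m + 1` terms
of `w₀` that are not in `seen`; the first `m` of them are not used below. Here `m` is arbitrary,
except that the last row takes all the terms that are left; thus the row lengths `r₀, …, r_d` run
over all choices with `rᵢ ≥ 1` and `r₀ + ⋯ + r_d = r + d` (if `r ≥ 1`). -/
def tables {r : ℕ} (seen : List (Fin r)) : List (Equiv.Perm (Fin r)) → List (List (List (Fin r)))
  | [] => []
  | [w] => [[(word w).filter (· ∉ seen)]]
  | w :: w' :: ws =>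
    (List.range ((word w).filter (· ∉ seen)).length).flatMap fun m =>
      (tables (seen ++ ((word w).filter (· ∉ seen)).take m) (w' :: ws)).map fun t =>
        ((word w).filter (· ∉ seen)).take (m + 1) :: t

/-- The sum of the surjections that arise from a simplex by table reduction. -/
noncomputable def tableSum (F : Type u) [CommRing F] {r : ℕ} (w : List (Equiv.Perm (Fin r))) :
    SurjGen r →₀ F :=
  ((tables [] w).map fun t => surjClass F t.flatten).sum

/-- The table reduction morphism. -/
noncomputable def tableReduction (F : Type u) [CommRing F] (r : ℕ) :
    (barrattEccles F).carrier r →ₗ[F] (surjOperad F).carrier r :=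
  Finsupp.linearCombination F fun w : BEGen r => tableSum F w.1

/-! ### The little cubes filtrations and the associative operad -/

/-- The number of variations of a sequence: the number of consecutive terms that differ. -/
def variations {α : Type} [DecidableEq α] (l : List α) : ℕ :=
  (l.zip l.tail).countP fun p => p.1 ≠ p.2

/-- `Fₙ E(r)`, `n ≥ 1`: the simplices such that, for all `i < j`, the order in which `i` and `j`
occur in the permutations `w₀, …, w_d` has no more than `n - 1` variations. -/
def beFiltration (F : Type u) [CommRing F] (n r : ℕ) :
    Submodule F ((barrattEccles F).carrier r) :=
  Finsupp.supported F F {w : BEGen r | ∀ i j : Fin r, i < j →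
    variations (w.1.map fun σ => decide (σ.symm i < σ.symm j)) < n}

/-- `Fₙ X(r)`, `n ≥ 1`: the surjections such that, for all `i < j`, the subsequence formed by the
occurrences of `i` and `j` has no more than `n` variations. -/
def surjFiltration (F : Type u) [CommRing F] (n r : ℕ) :
    Submodule F ((surjOperad F).carrier r) :=
  Finsupp.supported F F {u : SurjGen r | ∀ i j : Fin r, i < j →
    variations (u.1.filter fun x => x = i ∨ x = j) ≤ n}

/-- A permutation as a simplex of dimension `0`. -/
noncomputable def assocToBE (F : Type u) [CommRing F] (r : ℕ) :
    (assocOperad F).carrier r →ₗ[F] (barrattEccles F).carrier r :=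
  Finsupp.linearCombination F fun σ : Equiv.Perm (Fin r) => beClass F [σ]

/-- A permutation as a surjection of degree `0`. -/
noncomputable def assocToSurj (F : Type u) [CommRing F] (r : ℕ) :
    (assocOperad F).carrier r →ₗ[F] (surjOperad F).carrier r :=
  Finsupp.linearCombination F fun σ : Equiv.Perm (Fin r) => surjClass F (word σ)

/-! All formulas are lifted to free modules on arbitrary sequences, where each of them has a
recursion on the first term. Degenerate and non-surjective sequences are divided out only at the
end.

Write T_S(w) for the sum of the tables of a simplex w when the values in S are already used up. Let
x be the first value of w_0 that is not in S. Either the first row goes on after x, and then x is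
used up, or it ends at x, and then x must occur again: T_S(w_0, w_1, …) = x T_{S+x}(w_0, w_1, …) + x
T_S(w_1, …) (`rawTables_of_filter_eq_cons`). Thus the ends of the rows, except for the last row, are
the caesuras.

Differential: δ(xu) = x δ(u) if x does not occur in u. Otherwise δ(xu) = u − x δ(u) − x u', where u'
is u without x if x occurs once in u, and zero if it occurs more often (`rawDiff_cons`). The
operation u ↦ u' turns T_S into T_{S+x} (`eraseOnce_rawTables`), and the recursion becomes that of
the faces of a simplex, (w_0, ws) ↦ ws − w_0 ∂(ws). Compatibility with the differentials therefore
holds before degenerate sequences are divided out (`rawDiffMap_rawTables`).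

Composition: consider a table of a lattice path for u ∘ₖ v and a row that ends at a term y of v. If
the next segment is horizontal, then k is a caesura of u, and y opens the next component as well. If
it is vertical, then y is a caesura of v. The sign of this vertical segment counts the horizontal
segments still to come, which are the caesuras of u still to come; this is the Koszul sign in
`rawComp_cons_cons`. After a row that ends at a term of u, a vertical segment repeats this term, so
these paths yield only degenerate sequences. This gives compatibility modulo degenerate sequences
(`rawTablesMap_shuffle_smodEq`).

Surjectivity: a surjection is the value of the simplex whose vertices order the values by their next
occurrences; all the other tables of this simplex are degenerate (`rawTables_sectionSimplex`).

The laws of the Barratt-Eccles operad come from those of shuffle products (`facesMap_shuffle`,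
`shuffle_assoc`, `shuffle_comm`) and of permutations. No law is verified by hand for surjections:
the laws pass along the surjective map `tableReduction` (`isDGOperad_of_surjective`). Those of the
associative operad are inherited along an injection (`isDGOperad_of_injective`). -/

namespace TableReduction

/-! ### Free modules on sequences -/

section FreeModules

variable {F : Type u} [CommRing F] {α β γ : Type}

/-- A proof principle for the elements of a free module with prescribed support. -/
theorem supported_induction {ι : Type*} {s : Set ι} {P : (ι →₀ F) → Prop}
    (zero : P 0) (add : ∀ p q, P p → P q → P (p + q)) (smul : ∀ (c : F) p, P p → P (c • p))
    (single : ∀ i ∈ s, P (Finsupp.single i 1)) {p : ι →₀ F} (hp : p ∈ Finsupp.supported F F s) :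
    P p := by
  rw [Finsupp.supported_eq_span_single] at hp
  induction hp using Submodule.span_induction with
  | mem x hx => obtain ⟨i, hi, rfl⟩ := hx; exact single i hi
  | zero => exact zero
  | add x y _ _ hx hy => exact add x y hx hy
  | smul c x _ hx => exact smul c x hx

/-- Two linear maps agree on the elements of given support if they agree on the generators. -/
theorem eqOn_supported {ι M : Type*} [AddCommGroup M] [Module F M] {s : Set ι}
    {f g : (ι →₀ F) →ₗ[F] M} (h : ∀ i ∈ s, f (Finsupp.single i 1) = g (Finsupp.single i 1))
    {p : ι →₀ F} (hp : p ∈ Finsupp.supported F F s) : f p = g p :=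
  supported_induction (P := fun p => f p = g p) (by simp) (fun p q hp hq => by simp [hp, hq])
    (fun c p hp => by simp [hp]) h hp

/-- A linear map sends the elements of given support to a submodule if it does so for the
generators. -/
theorem map_mem_of_supported {ι M : Type*} [AddCommGroup M] [Module F M] {s : Set ι}
    {f : (ι →₀ F) →ₗ[F] M} {N : Submodule F M} (h : ∀ i ∈ s, f (Finsupp.single i 1) ∈ N)
    {p : ι →₀ F} (hp : p ∈ Finsupp.supported F F s) : f p ∈ N :=
  supported_induction (P := fun p => f p ∈ N) (by simp)
    (fun p q hp hq => by rw [map_add]; exact N.add_mem hp hq)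
    (fun c p hp => by rw [map_smul]; exact N.smul_mem c hp) h hp

theorem linearCombination_one {ι M : Type*} [AddCommGroup M] [Module F M] (f : ι → M) (i : ι) :
    Finsupp.linearCombination F f (Finsupp.single i 1) = f i := by
  simp

theorem mem_supported_univ {ι : Type*} (p : ι →₀ F) :
    p ∈ Finsupp.supported F F (Set.univ : Set ι) := by
  simp

theorem sign_smul_mem {M : Type*} [AddCommGroup M] [Module F M] {N : Submodule F M} {x : M}
    (c : ℤ) (h : x ∈ N) : c • x ∈ N :=
  zsmul_mem h c

/-- Adds a term at the front of a sequence. -/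
noncomputable def consMap (a : α) : (List α →₀ F) →ₗ[F] (List α →₀ F) :=
  Finsupp.lmapDomain F F (List.cons a)

@[simp] theorem consMap_single (a : α) (l : List α) (c : F) :
    consMap a (Finsupp.single l c) = Finsupp.single (a :: l) c := by
  simp [consMap]

/-- The submodule of the degenerate sequences. -/
noncomputable def degenerate (F : Type u) [CommRing F] (α : Type) : Submodule F (List α →₀ F) :=
  Finsupp.supported F F {l | ¬ l.IsChain (· ≠ ·)}

theorem single_mem_degenerate {l : List α} (h : ¬ l.IsChain (· ≠ ·)) :
    (Finsupp.single l 1 : List α →₀ F) ∈ degenerate F α :=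
  Finsupp.single_mem_supported F 1 h

theorem consMap_mem_degenerate (a : α) {z : List α →₀ F} (hz : z ∈ degenerate F α) :
    consMap a z ∈ degenerate F α := by
  refine map_mem_of_supported (fun l hl => ?_) hz
  rw [consMap_single]
  exact single_mem_degenerate fun h => hl h.tail

/-- Most degeneracy arguments end here: a recursion is unfolded twice and produces the same first
term both times. -/
theorem consMap_consMap_mem_degenerate (a : α) (z : List α →₀ F) :
    consMap a (consMap a z) ∈ degenerate F α := by
  have h := map_mem_of_supported (f := consMap a ∘ₗ consMap a) (N := degenerate F α)
    (fun l _ => ?_) (mem_supported_univ z)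
  · simpa using h
  · simp only [LinearMap.comp_apply, consMap_single]
    exact single_mem_degenerate fun h => by simp at h

/-- The coefficient of the empty sequence. -/
noncomputable def augment : (List α →₀ F) →ₗ[F] F := Finsupp.lapply []

@[simp] theorem augment_consMap (a : α) (z : List α →₀ F) : augment (consMap a z) = 0 := by
  have := eqOn_supported (F := F) (f := augment ∘ₗ consMap a) (g := 0) (fun l _ => ?_)
    (mem_supported_univ z)
  · simpa using this
  · simp [augment]

@[simp] theorem augment_single (l : List α) (c : F) :
    augment (Finsupp.single l c) = if l = [] then c else 0 := by
  simp [augment, Finsupp.single_apply]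

/-- The elements of given length. -/
noncomputable def ofLength (F : Type u) [CommRing F] (α : Type) (d : ℕ) :
    Submodule F (List α →₀ F) :=
  Finsupp.supported F F {l | l.length = d}

theorem single_mem_ofLength {l : List α} {d : ℕ} (h : l.length = d) :
    (Finsupp.single l 1 : List α →₀ F) ∈ ofLength F α d :=
  Finsupp.single_mem_supported F 1 h

theorem consMap_mem_ofLength (a : α) {d : ℕ} {z : List α →₀ F} (hz : z ∈ ofLength F α d) :
    consMap a z ∈ ofLength F α (d + 1) := by
  refine map_mem_of_supported (fun l hl => ?_) hz
  rw [consMap_single]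
  exact single_mem_ofLength (congrArg (· + 1) hl)

/-! ### The augmented complex of simplices -/

/-- The alternating sum of the faces of a simplex. -/
noncomputable def faces : List α → (List α →₀ F)
  | [] => 0
  | a :: l => Finsupp.single l 1 - consMap a (faces l)

theorem faces_eq_sum (l : List α) :
    (faces l : List α →₀ F) =
      ∑ i ∈ Finset.range l.length, ((-1 : ℤ) ^ i) • Finsupp.single (l.eraseIdx i) 1 := by
  induction l with
  | nil => simp [faces]
  | cons a l ih =>
    rw [List.length_cons, Finset.sum_range_succ', faces, ih, map_sum]
    simp [pow_succ, sub_eq_neg_add]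

/-- The linear extension of `faces`. -/
noncomputable def facesMap : (List α →₀ F) →ₗ[F] (List α →₀ F) := Finsupp.linearCombination F faces

@[simp] theorem facesMap_single (l : List α) :
    facesMap (Finsupp.single l (1 : F)) = faces l := by
  simp [facesMap]

theorem facesMap_consMap (a : α) (z : List α →₀ F) :
    facesMap (consMap a z) = z - consMap a (facesMap z) := by
  have := eqOn_supported (F := F) (f := facesMap ∘ₗ consMap a)
    (g := LinearMap.id - consMap a ∘ₗ facesMap) (fun l _ => ?_) (mem_supported_univ z)
  · simpa using this
  · simp [faces]

theorem faces_cons (a : α) (l : List α) :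
    (faces (a :: l) : List α →₀ F) = Finsupp.single l 1 - consMap a (faces l) := rfl

/-- The operator `consMap a` is a cone: ∂C = 1 − C∂, hence ∂∂C = C∂∂. The empty sequence is kept as
the face of a vertex, so this is the augmented complex. -/
theorem facesMap_faces (l : List α) : facesMap (faces l : List α →₀ F) = 0 := by
  induction l with
  | nil => simp [faces]
  | cons a l ih => simp [faces, facesMap_consMap, ih]

theorem faces_mem_ofLength (l : List α) : (faces l : List α →₀ F) ∈ ofLength F α (l.length - 1) := by
  induction l with
  | nil => simp [faces]
  | cons a l ih =>
    refine Submodule.sub_mem _ (single_mem_ofLength rfl) ?_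
    cases l with
    | nil => simp [faces]
    | cons b l => exact consMap_mem_ofLength a ih

/-- For a simplex (a, a, …) the first two faces cancel, and all other faces still start with a, a.
-/
theorem faces_mem_degenerate {l : List α} (h : ¬ l.IsChain (· ≠ ·)) :
    (faces l : List α →₀ F) ∈ degenerate F α := by
  induction l with
  | nil => simp at h
  | cons a l ih =>
    by_cases hl : l.IsChain (· ≠ ·)
    · cases l with
      | nil => simp at h
      | cons b l =>
        have hab : a = b := by
          by_contra hab
          exact h (List.isChain_cons_cons.2 ⟨hab, hl⟩)
        subst hab
        rw [faces_cons, faces_cons, map_sub, consMap_single, sub_sub_cancel]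
        exact consMap_consMap_mem_degenerate a _
    · exact Submodule.sub_mem _ (single_mem_degenerate hl) (consMap_mem_degenerate a (ih hl))

/-! ### Shuffle products -/

/-- The shuffle product of two simplices, with the pairs of vertices combined by `f`. -/
noncomputable def shuffle (F : Type u) [CommRing F] (f : α → β → γ) (A : List α) (B : List β) :
    List γ →₀ F :=
  ((latticePaths A B).map fun t =>
    ((-1 : ℤ) ^ t.1) • Finsupp.single (t.2.map fun p => f p.1 p.2) 1).sum

@[simp] theorem shuffle_nil_left (f : α → β → γ) (B : List β) : shuffle F f [] B = 0 := by
  simp [shuffle, latticePaths]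

@[simp] theorem shuffle_nil_right (f : α → β → γ) (A : List α) : shuffle F f A [] = 0 := by
  cases A <;> simp [shuffle, latticePaths]

theorem zsmul_list_sum {M : Type*} [AddCommGroup M] (l : List M) (c : ℤ) :
    c • l.sum = (l.map (c • ·)).sum := by
  induction l with
  | nil => simp
  | cons a l ih => simp [ih]

/-- The first segment of a path is horizontal or vertical. A vertical one precedes all the
`A.length` horizontal segments, whence the sign. The last summand is the path that consists of a
single vertex. -/
theorem shuffle_cons (f : α → β → γ) (a : α) (A : List α) (b : β) (B : List β) :
    shuffle F f (a :: A) (b :: B) = consMap (f a b)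
      (shuffle F f A (b :: B) + (-1 : ℤ) ^ A.length • shuffle F f (a :: A) B +
        Finsupp.single [] (if A = [] ∧ B = [] then 1 else 0)) := by
  by_cases h : A = [] ∧ B = []
  · obtain ⟨rfl, rfl⟩ := h
    simp [shuffle, latticePaths]
  · have hp : latticePaths (a :: A) (b :: B) =
        ((latticePaths A (b :: B)).map fun t => (t.1, (a, b) :: t.2)) ++
        ((latticePaths (a :: A) B).map fun t => (t.1 + A.length, (a, b) :: t.2)) := by
      rw [latticePaths]
      rintro rfl rfl
      exact h ⟨rfl, rfl⟩
    simp only [shuffle, hp, h, if_false, Finsupp.single_zero, add_zero, List.map_append,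
      List.sum_append, List.map_map, map_add, map_list_sum, zsmul_list_sum]
    congr 2
    · refine List.map_congr_left fun t _ => ?_
      simp
    · refine List.map_congr_left fun t _ => ?_
      simp only [Function.comp_apply, map_zsmul, consMap_single, smul_smul, pow_add,
        mul_comm ((-1 : ℤ) ^ A.length), List.map_cons]

/-- The bilinear extension of the shuffle product. -/
noncomputable def shuffleMap (f : α → β → γ) :
    (List α →₀ F) →ₗ[F] (List β →₀ F) →ₗ[F] (List γ →₀ F) :=
  Finsupp.linearCombination F fun A => Finsupp.linearCombination F fun B => shuffle F f A B

@[simp] theorem shuffleMap_single (f : α → β → γ) (A : List α) (B : List β) :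
    shuffleMap f (Finsupp.single A (1 : F)) (Finsupp.single B 1) = shuffle F f A B := by
  simp [shuffleMap]

theorem shuffleMap_nil_left (f : α → β → γ) (z : List β →₀ F) (c : F) :
    shuffleMap f (Finsupp.single [] c) z = 0 := by
  have := eqOn_supported (F := F) (f := shuffleMap f (Finsupp.single [] c))
    (g := 0) (fun l _ => ?_) (mem_supported_univ z)
  · simpa using this
  · simp [shuffleMap]

theorem shuffleMap_nil_right (f : α → β → γ) (z : List α →₀ F) (c : F) :
    shuffleMap f z (Finsupp.single [] c) = 0 := by
  have := eqOn_supported (F := F) (f := (shuffleMap f).flip (Finsupp.single [] c))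
    (g := 0) (fun l _ => ?_) (mem_supported_univ z)
  · simpa using this
  · simp [shuffleMap]

/-- Bilinear form of `shuffle_cons`. The left factor has to be homogeneous because the sign depends
on its length; the augmentations detect the paths with a single vertex. -/
theorem shuffleMap_consMap (f : α → β → γ) (a : α) (b : β) {d : ℕ} {z : List α →₀ F}
    (hz : z ∈ ofLength F α d) (w : List β →₀ F) :
    shuffleMap f (consMap a z) (consMap b w) = consMap (f a b)
      (shuffleMap f z (consMap b w) + (-1 : ℤ) ^ d • shuffleMap f (consMap a z) w +
        Finsupp.single [] (augment z * augment w)) := by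
  refine supported_induction (P := fun z => shuffleMap f (consMap a z) (consMap b w) =
    consMap (f a b) (shuffleMap f z (consMap b w) + (-1 : ℤ) ^ d • shuffleMap f (consMap a z) w +
        Finsupp.single [] (augment z * augment w))) (by simp) ?_ ?_ ?_ hz
  · intro p q hp hq
    simp only [map_add, LinearMap.add_apply, hp, hq, smul_add, add_mul, Finsupp.single_add]
    abel
  · intro c p hp
    simp only [map_smul, LinearMap.smul_apply, hp, smul_add, smul_eq_mul, mul_assoc,
      ← Finsupp.smul_single', map_add, map_zsmul, smul_comm c]
  · rintro A rfl
    refine supported_induction (P := fun w =>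
      shuffleMap f (consMap a (Finsupp.single A 1)) (consMap b w) =
      consMap (f a b) (shuffleMap f (Finsupp.single A 1) (consMap b w) +
        (-1 : ℤ) ^ A.length • shuffleMap f (consMap a (Finsupp.single A 1)) w +
        Finsupp.single [] (augment (Finsupp.single A 1) * augment w))) (by simp) ?_ ?_ ?_
        (mem_supported_univ w)
    · intro p q hp hq
      simp only [map_add, hp, hq, smul_add, mul_add, Finsupp.single_add]
      abel
    · intro c p hp
      simp only [map_smul, hp, smul_add, smul_eq_mul, mul_left_comm _ c,
        ← Finsupp.smul_single', map_add, map_zsmul, smul_comm c]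
    · intro B _
      simp only [consMap_single, shuffleMap_single, shuffle_cons, augment_single]
      congr 3
      by_cases h1 : A = [] <;> by_cases h2 : B = [] <;> simp [h1, h2]

theorem shuffle_mem_ofLength (f : α → β → γ) (A : List α) (B : List β) :
    shuffle F f A B ∈ ofLength F γ (A.length + B.length - 1) := by
  induction A generalizing B with
  | nil => simp
  | cons a A ihA =>
    induction B with
    | nil => simp
    | cons b B ihB =>
      rw [shuffle_cons]
      have h := consMap_mem_ofLength (F := F) (f a b) (d := A.length + B.length)
        (z := shuffle F f A (b :: B) + (-1 : ℤ) ^ A.length • shuffle F f (a :: A) B +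
        Finsupp.single [] (if A = [] ∧ B = [] then 1 else 0)) ?_
      · convert h using 2
        simp only [List.length_cons]; omega
      · refine Submodule.add_mem _ (Submodule.add_mem _ (ihA _) (sign_smul_mem _ ?_)) ?_
        · convert ihB using 2
          simp only [List.length_cons]; omega
        · split_ifs with h
          · exact single_mem_ofLength (by simp [h.1, h.2])
          · simp

theorem augment_shuffle (f : α → β → γ) (A : List α) (B : List β) :
    augment (shuffle F f A B) = 0 := by
  cases A <;> cases B <;> simp [shuffle_cons]

/-- Both sides run over the paths in a three-dimensional diagram, whose first segment has one of
three directions; the recursion matches the three parts. Four different pairings are allowed, so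
that the statement also serves to interchange two insertions. -/
theorem shuffle_assoc {δ κ μ : Type} (f : α → β → γ) (g : γ → δ → μ) (f' : α → κ → μ)
    (g' : β → δ → κ) (hfg : ∀ a b c, g (f a b) c = f' a (g' b c)) :
    ∀ (A : List α) (B : List β) (C : List δ),
    shuffleMap g (shuffle F f A B) (Finsupp.single C 1) =
      shuffleMap f' (Finsupp.single A 1) (shuffle F g' B C) := by
  intro A
  induction A with
  | nil => intro B C; simp [shuffleMap_nil_left]
  | cons a A ihA =>
    intro B
    induction B with
    | nil => intro C; simp
    | cons b B ihB =>
      intro C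
      induction C with
      | nil => simp [shuffleMap_nil_right]
      | cons c C ihC =>
        have h1 := ihA (b :: B) (c :: C)
        have h2 := ihB (c :: C)
        -- This length is the number of segments in the first two directions, which a segment in the
        -- third direction has to pass.
        have hl : shuffle F f A (b :: B) + (-1 : ℤ) ^ A.length • shuffle F f (a :: A) B +
            Finsupp.single [] (if A = [] ∧ B = [] then 1 else 0) ∈
            ofLength F γ (A.length + B.length) := by
          refine Submodule.add_mem _ (Submodule.add_mem _ (shuffle_mem_ofLength _ _ _)
            (sign_smul_mem _ ?_)) ?_
          · convert shuffle_mem_ofLength _ _ _ using 2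
            simp only [List.length_cons]; omega
          · split_ifs with h
            · exact single_mem_ofLength (by simp [h.1, h.2])
            · simp
        have e1 := shuffleMap_consMap (F := F) g (f a b) c hl (Finsupp.single C 1)
        rw [← shuffle_cons, consMap_single] at e1
        rw [e1]
        have hA : (Finsupp.single A 1 : List α →₀ F) ∈ ofLength F α A.length :=
          single_mem_ofLength rfl
        have e2 := shuffleMap_consMap (F := F) f' a (g' b c) hA
          (shuffle F g' B (c :: C) + (-1 : ℤ) ^ B.length • shuffle F g' (b :: B) C +
            Finsupp.single [] (if B = [] ∧ C = [] then 1 else 0))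
        rw [← shuffle_cons, consMap_single] at e2
        rw [e2, hfg]
        simp only [map_add, LinearMap.add_apply, map_zsmul, LinearMap.smul_apply,
          shuffleMap_nil_left, shuffleMap_nil_right, h1, h2, ihC, augment_shuffle, smul_add,
          add_zero, smul_zero, zero_add, augment_single, if_true, pow_add, smul_smul]
        have : ((if A = [] ∧ B = [] then (1 : F) else 0) * if C = [] then 1 else 0) =
            (if A = [] then 1 else 0) * if B = [] ∧ C = [] then 1 else 0 := by
          by_cases h1 : A = [] <;> by_cases h2 : B = [] <;> by_cases h3 : C = [] <;>
            simp [h1, h2, h3]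
        simp only [add_assoc, this]

/-- Reflection in the diagonal exchanges horizontal and vertical segments. The pairs counted for a
path and for its reflection add up to all pairs, and their number is the product of the dimensions.
-/
theorem shuffle_comm (f : α → β → γ) (A : List α) (B : List β) :
    shuffle F f A B =
      (-1 : ℤ) ^ ((A.length - 1) * (B.length - 1)) • shuffle F (fun b a => f a b) B A := by
  induction A generalizing B with
  | nil => simp
  | cons a A ihA =>
    induction B with
    | nil => simp
    | cons b B ihB =>
      rw [shuffle_cons, shuffle_cons, ihA, ihB, ← map_zsmul]
      congr 1
      have h0 : (if A = [] ∧ B = [] then (1 : F) else 0) = if B = [] ∧ A = [] then 1 else 0 := by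
        simp only [and_comm]
      rw [h0]
      simp only [smul_add, smul_smul, List.length_cons, Nat.add_sub_cancel]
      have h1 : (-1 : ℤ) ^ (A.length * B.length) •
          (Finsupp.single [] (if B = [] ∧ A = [] then 1 else 0) : List γ →₀ F) =
          Finsupp.single [] (if B = [] ∧ A = [] then 1 else 0) := by
        split_ifs with h
        · simp [h.1]
        · simp
      rw [h1, add_comm (_ • _) (_ • _)]
      congr 2
      · cases B with
        | nil => simp
        | cons b' B =>
          congr 1
          simp only [List.length_cons, Nat.add_sub_cancel]
          ring
      · cases A with
        | nil => simp
        | cons a' A =>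
          congr 1
          simp only [List.length_cons, Nat.add_sub_cancel]
          rw [← pow_add, show (A.length + 1) * B.length + B.length =
            A.length * B.length + 2 * B.length by ring, pow_add, pow_mul _ 2]
          simp

theorem neg_one_pow_mul_self (n : ℕ) : (-1 : ℤ) ^ n * (-1) ^ n = 1 := by
  rw [← mul_pow]; simp

theorem consMap_faces_mem_ofLength (a : α) (A : List α) :
    consMap a (faces A : List α →₀ F) ∈ ofLength F α A.length := by
  cases A with
  | nil => simp [faces]
  | cons a' A => exact consMap_mem_ofLength a (faces_mem_ofLength (a' :: A))

theorem augment_faces (A : List α) :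
    augment (faces A : List α →₀ F) = if A.length = 1 then 1 else 0 := by
  cases A with
  | nil => simp [faces]
  | cons a A => simp [faces]

/-- The derivation rule of the shuffle product. The last term is due to the empty simplex. -/
theorem facesMap_shuffle (f : α → β → γ) (A : List α) (B : List β) :
    facesMap (shuffle F f A B) = shuffleMap f (faces A) (Finsupp.single B 1) +
      (-1 : ℤ) ^ (A.length - 1) • shuffleMap f (Finsupp.single A 1) (faces B) +
      Finsupp.single [] (if A.length = 1 ∧ B.length = 1 then 1 else 0) := by
  induction A generalizing B with
  | nil => simp [faces, shuffleMap_nil_left]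
  | cons a A ihA =>
    induction B with
    | nil => simp [faces, shuffleMap_nil_right]
    | cons b B ihB =>
      have hl : consMap a (faces A : List α →₀ F) ∈ ofLength F α A.length :=
        consMap_faces_mem_ofLength a A
      have hs : (Finsupp.single A 1 : List α →₀ F) ∈ ofLength F α A.length :=
        single_mem_ofLength rfl
      have e1 : shuffleMap f (consMap a (faces A)) (Finsupp.single (b :: B) (1 : F)) =
          consMap (f a b) (shuffleMap f (faces A) (Finsupp.single (b :: B) 1) -
            (-1 : ℤ) ^ A.length • shuffleMap f (consMap a (faces A)) (Finsupp.single B 1) +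
            Finsupp.single [] (augment (faces A) * augment (Finsupp.single B 1))) := by
        have h := shuffleMap_consMap (F := F) f a b (faces_mem_ofLength A) (Finsupp.single B 1)
        rw [consMap_single] at h
        rw [h]
        cases A with
        | nil => simp [faces]
        | cons a' A => simp [pow_succ, sub_eq_add_neg]
      have e2 : shuffleMap f (Finsupp.single (a :: A) (1 : F)) (consMap b (faces B)) =
          consMap (f a b) (shuffleMap f (Finsupp.single A 1) (consMap b (faces B)) +
            (-1 : ℤ) ^ A.length • shuffleMap f (Finsupp.single (a :: A) 1) (faces B) +
            Finsupp.single [] (augment (Finsupp.single A 1) * augment (faces B))) := by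
        have h := shuffleMap_consMap (F := F) f a b hs (faces B)
        rwa [consMap_single] at h
      have hA := ihA (b :: B)
      -- The truncated subtraction is harmless: if `A` is empty, then the product vanishes.
      have hA' : (-1 : ℤ) ^ (A.length - 1) •
          shuffleMap f (Finsupp.single A (1 : F)) (faces (b :: B)) =
          -(-1 : ℤ) ^ A.length • shuffleMap f (Finsupp.single A (1 : F)) (faces (b :: B)) := by
        cases A with
        | nil => simp [shuffleMap_nil_left]
        | cons a' A => simp [pow_succ]
      rw [hA'] at hA
      rw [shuffle_cons, facesMap_consMap]
      simp only [map_add, map_zsmul, map_neg, hA, ihB, faces_cons, map_sub, LinearMap.sub_apply, e1, e2,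
        shuffleMap_single, smul_add, smul_sub, neg_smul, smul_smul, neg_one_pow_mul_self, one_smul,
        List.length_cons, Nat.add_sub_cancel, augment_faces, augment_single]
      -- The identities that follow only compare the multiples of the empty simplex.
      have s1 : (-1 : ℤ) ^ A.length • consMap (f a b)
          (Finsupp.single [] (if A.length + 1 = 1 ∧ B.length = 1 then 1 else 0) : List γ →₀ F) =
          consMap (f a b) (Finsupp.single [] (if A = [] ∧ B.length = 1 then 1 else 0)) := by
        by_cases h : A = []
        · simp [h]
        · simp [h]
      have s2 : (if A.length = 1 ∧ B.length + 1 = 1 then (1 : F) else 0) =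
          (if A.length = 1 then 1 else 0) * if B = [] then 1 else 0 := by
        by_cases h1 : A.length = 1 <;> by_cases h2 : B = [] <;> simp [h1, h2]
      have s3 : (-1 : ℤ) ^ A.length • consMap (f a b) (Finsupp.single []
          ((if A = [] then 1 else 0) * if B.length = 1 then 1 else 0) : List γ →₀ F) =
          consMap (f a b) (Finsupp.single [] (if A = [] ∧ B.length = 1 then 1 else 0)) := by
        by_cases h1 : A = [] <;> by_cases h2 : B.length = 1 <;> simp [h1, h2]
      have s4 : (if A.length + 1 = 1 ∧ B.length + 1 = 1 then (1 : F) else 0) =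
          if A = [] ∧ B = [] then 1 else 0 := by
        simp
      have s5 : (Finsupp.single [] (if A = [] ∧ B = [] then 1 else 0) : List γ →₀ F) =
          (if A = [] ∧ B = [] then (1 : F) else 0) • Finsupp.single [] 1 := by
        rw [Finsupp.smul_single', mul_one]
      have s6 : facesMap (Finsupp.single [] (if A = [] ∧ B = [] then 1 else 0) : List γ →₀ F) =
          0 := by
        rw [s5, map_smul]; simp [faces]
      rw [s1, s2, s3, s4, s6]
      simp only [map_zero]
      abel

/-- If `A` starts with a, a, then a path with a horizontal first segment can be unfolded once more
and repeats its first vertex label or reduces to shorter `B`. To be precise, the horizontal part is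
`consMap` of a product that again starts with `f a b`, and the vertical part is covered by induction
on `B`. -/
theorem shuffle_mem_degenerate_left (f : α → β → γ) {A : List α} (hA : ¬ A.IsChain (· ≠ ·))
    (B : List β) : shuffle F f A B ∈ degenerate F γ := by
  induction A generalizing B with
  | nil => simp
  | cons a A ihA =>
    induction B with
    | nil => simp
    | cons b B ihB =>
      rw [shuffle_cons]
      have h0 : ¬ (A = [] ∧ B = []) := by rintro ⟨rfl, -⟩; simp at hA
      rw [if_neg h0, Finsupp.single_zero, add_zero, map_add, map_zsmul]
      refine Submodule.add_mem _ ?_ (sign_smul_mem _ (consMap_mem_degenerate _ ihB))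
      by_cases h : A.IsChain (· ≠ ·)
      · cases A with
        | nil => simp at hA
        | cons a' A =>
          have haa : a = a' := by
            by_contra hab
            exact hA (List.isChain_cons_cons.2 ⟨hab, h⟩)
          subst haa
          rw [shuffle_cons]
          exact consMap_consMap_mem_degenerate _ _
      · exact consMap_mem_degenerate _ (ihA h _)

theorem shuffle_mem_degenerate_right (f : α → β → γ) (A : List α) {B : List β}
    (hB : ¬ B.IsChain (· ≠ ·)) : shuffle F f A B ∈ degenerate F γ := by
  rw [shuffle_comm]
  exact sign_smul_mem _ (shuffle_mem_degenerate_left _ hB A)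

theorem shuffle_map {α' β' : Type} (f : α → β → γ) (a : α' → α) (b : β' → β) (A : List α')
    (B : List β') : shuffle F f (A.map a) (B.map b) = shuffle F (fun x y => f (a x) (b y)) A B := by
  induction A generalizing B with
  | nil => simp
  | cons x A ihA =>
    induction B with
    | nil => simp
    | cons y B ihB =>
      have h1 := ihA (y :: B)
      simp only [List.map_cons] at h1 ihB
      simp only [List.map_cons, shuffle_cons, h1, ihB, List.length_map, List.map_eq_nil_iff]

theorem lmapDomain_shuffle {μ : Type} (f : α → β → γ) (g : γ → μ) (A : List α)
    (B : List β) : Finsupp.lmapDomain F F (List.map g) (shuffle F f A B) =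
      shuffle F (fun x y => g (f x y)) A B := by
  simp only [shuffle, map_list_sum, List.map_map]
  congr 1
  refine List.map_congr_left fun t _ => ?_
  simp [Function.comp_def]

theorem shuffle_singleton_left (f : α → β → γ) (a : α) {B : List β} (hB : B ≠ []) :
    shuffle F f [a] B = Finsupp.single (B.map (f a)) 1 := by
  induction B with
  | nil => simp at hB
  | cons b B ih =>
    rw [shuffle_cons]
    by_cases h : B = []
    · simp [h]
    · simp [h, ih h]

theorem shuffle_singleton_right (f : α → β → γ) (b : β) {A : List α} (hA : A ≠ []) :
    shuffle F f A [b] = Finsupp.single (A.map (f · b)) 1 := by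
  rw [shuffle_comm, shuffle_singleton_left _ _ hA]
  simp

end FreeModules

/-! ### Composition of permutations -/

section Permutations

theorem outerIndex_val {r s n : ℕ} (h : n + 1 = r + s) (k x : Fin r) (hx : x ≠ k) :
    (outerIndex h k x hx).1 = if x.1 < k.1 then x.1 else x.1 + s - 1 := by
  unfold outerIndex
  by_cases hlt : x < k
  · rw [dif_pos hlt, if_pos (Fin.lt_def.1 hlt)]
  · rw [dif_neg hlt, if_neg (fun h => hlt (Fin.lt_def.2 h))]

theorem innerIndex_val {r s n : ℕ} (h : n + 1 = r + s) (k : Fin r) (j : Fin s) :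
    (innerIndex h k j).1 = k.1 + j.1 := rfl

theorem outerIndex_injective {r s n : ℕ} (h : n + 1 = r + s) {k x y : Fin r} (hx : x ≠ k)
    (hy : y ≠ k) (hxy : outerIndex h k x hx = outerIndex h k y hy) : x = y := by
  have := (blockEquiv h k).injective (a₁ := Sum.inl ⟨x, hx⟩) (a₂ := Sum.inl ⟨y, hy⟩) hxy
  simpa using this

theorem innerIndex_injective {r s n : ℕ} (h : n + 1 = r + s) (k : Fin r) :
    Function.Injective (innerIndex h k : Fin s → Fin n) := by
  intro x y hxy
  have := (blockEquiv h k).injective (a₁ := Sum.inr x) (a₂ := Sum.inr y) hxy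
  simpa using this

theorem outerIndex_ne_innerIndex {r s n : ℕ} (h : n + 1 = r + s) {k x : Fin r} (hx : x ≠ k)
    (j : Fin s) : outerIndex h k x hx ≠ innerIndex h k j := by
  intro hxy
  have := (blockEquiv h k).injective (a₁ := Sum.inl ⟨x, hx⟩) (a₂ := Sum.inr j) hxy
  simp at this

theorem index_cases {r s n : ℕ} (h : n + 1 = r + s) (k : Fin r) (m : Fin n) :
    (∃ x hx, m = outerIndex h k x hx) ∨ ∃ j, m = innerIndex h k j := by
  obtain ⟨y, rfl⟩ := (blockEquiv h k).surjective m
  rcases y with ⟨x, hx⟩ | j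
  · exact Or.inl ⟨x, hx, rfl⟩
  · exact Or.inr ⟨j, rfl⟩

/-- Places are numbered by blocks at k' = u⁻¹ k, values by blocks at k. Together with
`permComp_innerIndex` this determines `permComp` and replaces its definition in what follows. -/
theorem permComp_outerIndex {r s n : ℕ} (h : n + 1 = r + s) {k k' : Fin r}
    {u : Equiv.Perm (Fin r)} (v : Equiv.Perm (Fin s)) (hk : u k' = k) (x : Fin r) (hx : x ≠ k') :
    permComp h k u v (outerIndex h k' x hx) =
      outerIndex h k (u x) (fun e => hx (u.injective (e.trans hk.symm))) := by
  subst hk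
  have hx' : x ≠ u.symm (u k') := by simpa using hx
  have e : outerIndex h k' x hx = blockEquiv h (u.symm (u k')) (Sum.inl ⟨x, hx'⟩) := by
    -- The place `u.symm (u k')` occurs in the types, so it is generalized before it is identified
    -- with `k'`.
    have : ∀ k'' (e : k' = k'') (hx'' : x ≠ k''),
        outerIndex h k' x hx = blockEquiv h k'' (Sum.inl ⟨x, hx''⟩) := by
      rintro _ rfl _; rfl
    exact this _ (by simp) _
  rw [e]
  simp only [permComp, Equiv.trans_apply, Equiv.symm_apply_apply]
  rfl

theorem permComp_innerIndex {r s n : ℕ} (h : n + 1 = r + s) {k k' : Fin r}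
    {u : Equiv.Perm (Fin r)} (v : Equiv.Perm (Fin s)) (hk : u k' = k) (j : Fin s) :
    permComp h k u v (innerIndex h k' j) = innerIndex h k (v j) := by
  subst hk
  have e : innerIndex h k' j = blockEquiv h (u.symm (u k')) (Sum.inr j) := by
    rw [Equiv.symm_apply_apply]; rfl
  rw [e]
  simp only [permComp, Equiv.trans_apply, Equiv.symm_apply_apply]
  rfl

/-- The permutations are compared place by place. What remains are three identities for iterated
block numbering, each used once for the places and once for the values. -/
theorem permComp_assoc {r s t m n l : ℕ} (hm : m + 1 = r + s) (hl : l + 1 = m + t)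
    (hn : n + 1 = s + t) (hl' : l + 1 = r + n) (i : Fin r) (j : Fin s)
    (p : Equiv.Perm (Fin r)) (q : Equiv.Perm (Fin s)) (x : Equiv.Perm (Fin t)) :
    permComp hl (innerIndex hm i j) (permComp hm i p q) x =
      permComp hl' i p (permComp hn j q x) := by
  obtain ⟨i, rfl⟩ := p.surjective i
  obtain ⟨j, rfl⟩ := q.surjective j
  have hk : permComp hm (p i) p q (innerIndex hm i j) = innerIndex hm (p i) (q j) :=
    permComp_innerIndex hm q rfl j
  have outer_outer : ∀ (i : Fin r) (j : Fin s) (y : Fin r) (hy : y ≠ i) (hy'),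
      outerIndex hl (innerIndex hm i j) (outerIndex hm i y hy) hy' = outerIndex hl' i y hy := by
    intro i j y hy hy'
    have := Fin.val_ne_of_ne hy
    ext
    simp only [outerIndex_val, innerIndex_val]
    split_ifs <;> omega
  have outer_inner : ∀ (i : Fin r) (j : Fin s) (y : Fin s) (hy : y ≠ j) (hy'),
      outerIndex hl (innerIndex hm i j) (innerIndex hm i y) hy' =
        innerIndex hl' i (outerIndex hn j y hy) := by
    intro i j y hy hy'
    have := Fin.val_ne_of_ne hy
    ext
    simp only [outerIndex_val, innerIndex_val, Nat.add_lt_add_iff_left]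
    split_ifs <;> omega
  have inner_inner : ∀ (i : Fin r) (j : Fin s) (z : Fin t),
      innerIndex hl (innerIndex hm i j) z = innerIndex hl' i (innerIndex hn j z) := by
    intro i j z
    ext
    simp only [innerIndex_val]
    omega
  ext1 y
  rcases index_cases hl' i y with ⟨y, hy, rfl⟩ | ⟨y, rfl⟩
  · rw [permComp_outerIndex hl' _ rfl,
      ← outer_outer i j y hy (outerIndex_ne_innerIndex hm hy j), permComp_outerIndex hl _ hk]
    simp only [permComp_outerIndex hm _ rfl]
    rw [outer_outer]
  · rw [permComp_innerIndex hl' _ rfl]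
    rcases index_cases hn j y with ⟨y, hy, rfl⟩ | ⟨y, rfl⟩
    · rw [← outer_inner i j y hy (fun e => hy (innerIndex_injective hm i e)),
        permComp_outerIndex hl _ hk, permComp_outerIndex hn _ rfl]
      simp only [permComp_innerIndex hm _ rfl]
      rw [outer_inner]
    · rw [← inner_inner, permComp_innerIndex hl _ hk, permComp_innerIndex hn _ rfl, inner_inner]

theorem permComp_comm {r s t m n l : ℕ} (hm : m + 1 = r + s) (hl : l + 1 = m + t)
    (hn : n + 1 = r + t) (hl' : l + 1 = n + s) (i k : Fin r) (hik : i ≠ k)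
    (p : Equiv.Perm (Fin r)) (q : Equiv.Perm (Fin s)) (x : Equiv.Perm (Fin t)) :
    permComp hl (outerIndex hm i k hik.symm) (permComp hm i p q) x =
      permComp hl' (outerIndex hn k i hik) (permComp hn k p x) q := by
  obtain ⟨i, rfl⟩ := p.surjective i
  obtain ⟨k, rfl⟩ := p.surjective k
  have hik' : i ≠ k := fun e => hik (congrArg p e)
  have hk : permComp hm (p i) p q (outerIndex hm i k hik'.symm) =
      outerIndex hm (p i) (p k) hik.symm := permComp_outerIndex hm q rfl k hik'.symm
  have hi : permComp hn (p k) p x (outerIndex hn k i hik') = outerIndex hn (p k) (p i) hik :=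
    permComp_outerIndex hn x rfl i hik'
  have outer_outer : ∀ (i k : Fin r) (hik : i ≠ k) (y : Fin r) (hy : y ≠ i) (hy2 : y ≠ k)
      (hy' hy''), outerIndex hl (outerIndex hm i k hik.symm) (outerIndex hm i y hy) hy' =
        outerIndex hl' (outerIndex hn k i hik) (outerIndex hn k y hy2) hy'' := by
    intro i k hik y hy hy2 _ _
    have h1 := Fin.val_ne_of_ne hy
    have h2 := Fin.val_ne_of_ne hy2
    have h3 := Fin.val_ne_of_ne hik
    ext
    simp only [outerIndex_val]
    split_ifs <;> omega
  have outer_inner : ∀ (i k : Fin r) (hik : i ≠ k) (y : Fin s) (hy'),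
      outerIndex hl (outerIndex hm i k hik.symm) (innerIndex hm i y) hy' =
        innerIndex hl' (outerIndex hn k i hik) y := by
    intro i k hik y _
    have h3 := Fin.val_ne_of_ne hik
    ext
    simp only [outerIndex_val, innerIndex_val]
    split_ifs <;> omega
  have inner_outer : ∀ (i k : Fin r) (hik : i ≠ k) (y : Fin t) (hy'),
      innerIndex hl (outerIndex hm i k hik.symm) y =
        outerIndex hl' (outerIndex hn k i hik) (innerIndex hn k y) hy' := by
    intro i k hik y _
    have h3 := Fin.val_ne_of_ne hik
    ext
    simp only [outerIndex_val, innerIndex_val]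
    split_ifs <;> omega
  ext1 y
  rcases index_cases hl (outerIndex hm i k hik'.symm) y with ⟨y, hy, rfl⟩ | ⟨y, rfl⟩
  · rw [permComp_outerIndex hl _ hk]
    rcases index_cases hm i y with ⟨y, hy2, rfl⟩ | ⟨y, rfl⟩
    · have hy3 : y ≠ k := by rintro rfl; exact hy rfl
      rw [outer_outer i k hik' y hy2 hy3 hy (fun e => hy2 (outerIndex_injective hn _ _ e)),
        permComp_outerIndex hl' _ hi]
      simp only [permComp_outerIndex hm _ rfl, permComp_outerIndex hn _ rfl]
      rw [outer_outer _ _ hik]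
    · rw [outer_inner _ _ hik', permComp_innerIndex hl' _ hi]
      simp only [permComp_innerIndex hm _ rfl]
      rw [outer_inner _ _ hik]
  · rw [permComp_innerIndex hl _ hk,
      inner_outer i k hik' y (outerIndex_ne_innerIndex hn hik' y).symm,
      permComp_outerIndex hl' _ hi]
    simp only [permComp_innerIndex hn _ rfl]
    rw [inner_outer _ _ hik]

theorem permComp_mul {r s n : ℕ} (h : n + 1 = r + s) (k : Fin r)
    (σ u : Equiv.Perm (Fin r)) (τ v : Equiv.Perm (Fin s)) :
    permComp h (σ k) (σ * u) (τ * v) = permComp h (σ k) σ τ * permComp h k u v := by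
  obtain ⟨k, rfl⟩ := u.surjective k
  ext1 y
  rw [Equiv.Perm.mul_apply]
  rcases index_cases h k y with ⟨y, hy, rfl⟩ | ⟨y, rfl⟩
  · rw [permComp_outerIndex h (u := u) _ rfl, permComp_outerIndex h (u := σ) _ rfl]
    exact permComp_outerIndex h (u := σ * u) (τ * v) rfl y hy
  · rw [permComp_innerIndex h (u := u) _ rfl, permComp_innerIndex h (u := σ) _ rfl]
    exact permComp_innerIndex h (u := σ * u) (τ * v) rfl y

theorem permComp_one_left {s : ℕ} (h : s + 1 = 1 + s) (q : Equiv.Perm (Fin s)) :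
    permComp h 0 1 q = q := by
  have inner : ∀ j : Fin s, innerIndex h 0 j = j := by
    intro j; ext; simp [innerIndex_val]
  ext1 y
  have := permComp_innerIndex h (k := 0) (k' := 0) (u := 1) q rfl y
  rwa [inner, inner] at this

theorem permComp_one_right {r : ℕ} (h : r + 1 = r + 1) (k : Fin r) (p : Equiv.Perm (Fin r)) :
    permComp h k p 1 = p := by
  obtain ⟨k, rfl⟩ := p.surjective k
  have outer : ∀ (k x : Fin r) (hx : x ≠ k), outerIndex h k x hx = x := by
    intro k x hx; ext; simp [outerIndex_val]
  have inner : ∀ (k : Fin r) (j : Fin 1), innerIndex h k j = k := by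
    intro k j; ext; simp [innerIndex_val]
  ext1 y
  rcases index_cases h k y with ⟨y, hy, rfl⟩ | ⟨y, rfl⟩
  · rw [permComp_outerIndex h _ rfl, outer, outer]
  · rw [permComp_innerIndex h _ rfl, inner, inner]

/-! ### Words of permutations -/

theorem word_eq_map {r : ℕ} (σ : Equiv.Perm (Fin r)) : word σ = (List.finRange r).map σ := by
  simp [word, List.ofFn_eq_map]

theorem mem_word {r : ℕ} (σ : Equiv.Perm (Fin r)) (x : Fin r) : x ∈ word σ := by
  simp [word_eq_map, σ.surjective x]

theorem nodup_word {r : ℕ} (σ : Equiv.Perm (Fin r)) : (word σ).Nodup := by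
  rw [word_eq_map]
  exact (List.nodup_finRange r).map σ.injective

@[simp] theorem length_word {r : ℕ} (σ : Equiv.Perm (Fin r)) : (word σ).length = r := by
  simp [word]

theorem word_injective {r : ℕ} :
    Function.Injective (word : Equiv.Perm (Fin r) → List (Fin r)) := by
  intro σ τ h
  exact Equiv.ext fun x => congrFun (List.ofFn_injective h) x

theorem word_mul {r : ℕ} (σ τ : Equiv.Perm (Fin r)) : word (σ * τ) = (word τ).map σ := by
  simp [word_eq_map, Function.comp_def]

theorem exists_word_eq {r : ℕ} {l : List (Fin r)} (hl : l.Nodup) (h : ∀ x, x ∈ l) :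
    ∃ σ : Equiv.Perm (Fin r), word σ = l := by
  have hr : l.length = r := by
    have := List.toFinset_card_of_nodup hl
    rw [← this, show l.toFinset = Finset.univ by ext; simp [h]]
    simp
  have hinj : Function.Injective fun i : Fin r => l[i.1]'(by omega) := by
    intro i j hij
    exact Fin.ext ((List.Nodup.getElem_inj_iff hl).1 hij)
  refine ⟨Equiv.ofBijective _ (Finite.injective_iff_bijective.1 hinj), ?_⟩
  apply List.ext_getElem
  · simp [hr]
  · intro i h1 h2
    simp [word]

/-- The sequence that replaces the term `x` if the sequence `l` is substituted for `k`. -/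
def expandTerm {r s n : ℕ} (h : n + 1 = r + s) (k : Fin r) (l : List (Fin s)) (x : Fin r) :
    List (Fin n) :=
  if hx : x = k then l.map (innerIndex h k) else [outerIndex h k x hx]

theorem expandTerm_self {r s n : ℕ} (h : n + 1 = r + s) (k : Fin r) (l : List (Fin s)) :
    expandTerm h k l k = l.map (innerIndex h k) := by
  simp [expandTerm]

theorem expandTerm_ne {r s n : ℕ} (h : n + 1 = r + s) {k x : Fin r} (hx : x ≠ k)
    (l : List (Fin s)) : expandTerm h k l x = [outerIndex h k x hx] := by
  simp [expandTerm, hx]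

/-- Both lists are strictly increasing and contain every index, since block numbering preserves the
order. -/
theorem finRange_eq_flatMap {r s n : ℕ} (h : n + 1 = r + s) (k : Fin r) :
    List.finRange n = (List.finRange r).flatMap (expandTerm h k (List.finRange s)) := by
  have hp : ((List.finRange r).flatMap (expandTerm h k (List.finRange s))).Pairwise (· < ·) := by
    rw [List.pairwise_flatMap]
    constructor
    · intro x _
      by_cases hx : x = k
      · subst hx
        rw [expandTerm_self, List.pairwise_map]
        refine (List.pairwise_lt_finRange s).imp fun {a b} hab => ?_
        rw [Fin.lt_def] at hab ⊢
        simpa [innerIndex_val] using hab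
      · rw [expandTerm_ne h hx]
        simp
    · refine (List.pairwise_lt_finRange r).imp fun {a b} hab => ?_
      rw [Fin.lt_def] at hab
      intro x hx y hy
      by_cases ha : a = k
      · subst ha
        have hb : b ≠ a := Fin.ne_of_val_ne (by omega)
        rw [expandTerm_self, List.mem_map] at hx
        obtain ⟨j, -, rfl⟩ := hx
        rw [expandTerm_ne h hb, List.mem_singleton] at hy
        subst hy
        rw [Fin.lt_def, innerIndex_val, outerIndex_val]
        split_ifs <;> omega
      · rw [expandTerm_ne h ha, List.mem_singleton] at hx
        subst hx
        by_cases hb : b = k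
        · subst hb
          rw [expandTerm_self, List.mem_map] at hy
          obtain ⟨j, -, rfl⟩ := hy
          rw [Fin.lt_def, innerIndex_val, outerIndex_val]
          split_ifs; omega
        · rw [expandTerm_ne h hb, List.mem_singleton] at hy
          subst hy
          have h1 := Fin.val_ne_of_ne ha
          have h2 := Fin.val_ne_of_ne hb
          rw [Fin.lt_def, outerIndex_val, outerIndex_val]
          split_ifs <;> omega
  refine List.Perm.eq_of_pairwise (le := (· < ·)) ?_ (List.pairwise_lt_finRange n) hp ?_
  · intro a b _ _ h1 h2
    exact absurd h2 (lt_asymm h1)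
  · rw [List.perm_ext_iff_of_nodup (List.nodup_finRange n) (hp.imp fun h => ne_of_lt h)]
    intro m
    simp only [List.mem_finRange, true_iff, List.mem_flatMap, true_and]
    rcases index_cases h k m with ⟨x, hx, rfl⟩ | ⟨j, rfl⟩
    · exact ⟨x, by simp [expandTerm_ne h hx]⟩
    · exact ⟨k, by simp [expandTerm_self]⟩

/-- The places of the composite are listed block by block with `finRange_eq_flatMap`. In this form
composition is substitution into sequences of values, which is what table reduction sees. -/
theorem word_permComp {r s n : ℕ} (h : n + 1 = r + s) (k : Fin r)
    (u : Equiv.Perm (Fin r)) (v : Equiv.Perm (Fin s)) :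
    word (permComp h k u v) = (word u).flatMap (expandTerm h k (word v)) := by
  obtain ⟨k, rfl⟩ := u.surjective k
  rw [word_eq_map, word_eq_map u, word_eq_map v, finRange_eq_flatMap h k, List.map_flatMap,
    List.flatMap_map]
  refine List.flatMap_congr fun x _ => ?_
  by_cases hx : x = k
  · subst hx
    rw [expandTerm_self, expandTerm_self, List.map_map, List.map_map]
    refine List.map_congr_left fun j _ => ?_
    exact permComp_innerIndex h v rfl j
  · rw [expandTerm_ne h hx, expandTerm_ne h (fun e => hx (u.injective e)), List.map_singleton,
      permComp_outerIndex h v rfl]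

theorem flatMap_filter {α β : Type*} (p : α → Bool) (f : α → List β) (l : List α) :
    (l.filter p).flatMap f = l.flatMap fun a => if p a then f a else [] := by
  induction l with
  | nil => rfl
  | cons a l ih => by_cases h : p a <;> simp [h, ih]

/-- The terms of the word of a composite that remain when a set of values is omitted. -/
theorem filter_word_permComp {r s n : ℕ} (h : n + 1 = r + s) (k : Fin r)
    (u : Equiv.Perm (Fin r)) (v : Equiv.Perm (Fin s)) {S : List (Fin r)} {S' : List (Fin s)}
    {Z : List (Fin n)} (hk : k ∉ S) (hS : ∀ x hx, outerIndex h k x hx ∈ Z ↔ x ∈ S)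
    (hS' : ∀ j, innerIndex h k j ∈ Z ↔ j ∈ S') :
    (word (permComp h k u v)).filter (· ∉ Z) =
      ((word u).filter (· ∉ S)).flatMap (expandTerm h k ((word v).filter (· ∉ S'))) := by
  rw [word_permComp, List.filter_flatMap, flatMap_filter]
  refine List.flatMap_congr fun x _ => ?_
  by_cases hx : x = k
  · subst hx
    simp only [expandTerm_self, hk, not_false_eq_true, decide_true, if_true, List.filter_map]
    congr 1
    refine List.filter_congr fun j _ => ?_
    simp [hS' j]
  · simp only [expandTerm_ne h hx]
    by_cases hxS : x ∈ S
    · simp [hxS, (hS x hx).2 hxS]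
    · simp [hxS, mt (hS x hx).1 hxS]

end Permutations

/-! ### Table reduction of arbitrary simplices -/

section Tables

variable {F : Type u} [CommRing F]

theorem filter_notMem_append {α : Type*} [DecidableEq α] (l S S' : List α) :
    l.filter (· ∉ S ++ S') = (l.filter (· ∉ S)).filter (· ∉ S') := by
  rw [List.filter_filter]
  refine List.filter_congr fun a _ => ?_
  simp [Bool.and_comm]

theorem filter_append_of_filter_eq_cons {r : ℕ} {w : Equiv.Perm (Fin r)} {S l : List (Fin r)}
    {x : Fin r} (hw : (word w).filter (· ∉ S) = x :: l) :
    (word w).filter (· ∉ S ++ [x]) = l := by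
  have hn : (x :: l).Nodup := hw ▸ (nodup_word w).filter _
  rw [filter_notMem_append, hw, List.filter_cons]
  simp only [List.mem_singleton, not_true_eq_false, decide_false, Bool.false_eq_true, if_false]
  rw [List.filter_eq_self]
  intro a ha
  have : a ≠ x := fun e => (List.nodup_cons.1 hn).1 (e ▸ ha)
  simpa using this

theorem notMem_of_filter_eq_cons {r : ℕ} {w : Equiv.Perm (Fin r)} {S l : List (Fin r)}
    {x : Fin r} (hw : (word w).filter (· ∉ S) = x :: l) : x ∉ S := by
  have : x ∈ (word w).filter (· ∉ S) := by rw [hw]; simp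
  simpa using (List.mem_filter.1 this).2

theorem mem_of_filter_eq_nil {r : ℕ} {w : Equiv.Perm (Fin r)} {S : List (Fin r)}
    (hw : (word w).filter (· ∉ S) = []) (x : Fin r) : x ∈ S := by
  have := List.filter_eq_nil_iff.1 hw x (mem_word w x)
  simpa using this

/-- The sum, in the free module on all sequences, of the concatenations of the tables. -/
noncomputable def rawTables (F : Type u) [CommRing F] {r : ℕ} (S : List (Fin r))
    (w : List (Equiv.Perm (Fin r))) : List (Fin r) →₀ F :=
  ((tables S w).map fun t => Finsupp.single t.flatten 1).sum

@[simp] theorem rawTables_nil {r : ℕ} (S : List (Fin r)) : rawTables F S [] = 0 := by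
  simp [rawTables, tables]

/-- A row that is not the last one needs a term, and none is left. The last row may be empty. -/
theorem rawTables_of_filter_eq_nil {r : ℕ} {S : List (Fin r)} {w : Equiv.Perm (Fin r)}
    (hw : (word w).filter (· ∉ S) = []) (ws : List (Equiv.Perm (Fin r))) :
    rawTables F S (w :: ws) = Finsupp.single [] (if ws = [] then 1 else 0) := by
  cases ws with
  | nil => simp only [rawTables, tables, hw]; simp
  | cons w' ws => simp only [rawTables, tables, hw]; simp

/-- The recursion that drives everything: either `x` is not the end of its row, and then it is used
up, or the row is finished by `x`, and then `x` remains available. -/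
theorem rawTables_of_filter_eq_cons {r : ℕ} {S : List (Fin r)} {w : Equiv.Perm (Fin r)}
    {x : Fin r} {l : List (Fin r)} (hw : (word w).filter (· ∉ S) = x :: l)
    (ws : List (Equiv.Perm (Fin r))) :
    rawTables F S (w :: ws) =
      consMap x (rawTables F (S ++ [x]) (w :: ws)) + consMap x (rawTables F S ws) := by
  have hw' := filter_append_of_filter_eq_cons hw
  cases ws with
  | nil => simp only [rawTables, tables, hw, hw']; simp
  | cons w' ws =>
    simp only [rawTables, tables, hw, hw', List.length_cons, List.range_succ_eq_map,
      List.flatMap_cons, List.flatMap_map, List.map_append, List.sum_append, List.map_flatMap,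
      List.map_map, map_list_sum, List.take_zero, List.append_nil, List.append_assoc]
    rw [add_comm]
    congr 2
    · congr 1
      refine funext fun m => ?_
      refine List.map_congr_left fun t _ => ?_
      simp [Function.comp_def]
    · refine List.map_congr_left fun t _ => ?_
      simp

/-- An induction principle for statements on table reduction. -/
theorem rawTables_induction {r : ℕ} {P : List (Fin r) → List (Equiv.Perm (Fin r)) → Prop}
    (nil : ∀ S, P S [])
    (filter_nil : ∀ S w ws, (word w).filter (· ∉ S) = [] → P S ws → P S (w :: ws))
    (filter_cons : ∀ S w ws x l, (word w).filter (· ∉ S) = x :: l → (∀ S, P S ws) →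
      P (S ++ [x]) (w :: ws) → P S (w :: ws)) (S : List (Fin r))
    (w : List (Equiv.Perm (Fin r))) : P S w := by
  induction w generalizing S with
  | nil => exact nil S
  | cons w ws ih =>
    generalize hl : (word w).filter (· ∉ S) = l
    induction l generalizing S with
    | nil => exact filter_nil S w ws hl (ih S)
    | cons x l ihl =>
      exact filter_cons S w ws x l hl ih (ihl _ (filter_append_of_filter_eq_cons hl))

theorem filter_flatMap_singleton {α β : Type*} [DecidableEq α] [DecidableEq β] {g : α → List β}
    {L : List α} (hg : ∀ a ∈ L, ∃ b, g a = [b]) {x : α} {y : β} (hxy : ∀ a ∈ L, g a = [y] ↔ a = x) :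
    (L.flatMap g).filter (· ∉ [y]) = (L.filter (· ∉ [x])).flatMap g := by
  rw [List.filter_flatMap, flatMap_filter]
  refine List.flatMap_congr fun a ha => ?_
  obtain ⟨b, hb⟩ := hg a ha
  have := hxy a ha
  rw [hb] at this ⊢
  by_cases h : a = x
  · have hby : b = y := by simpa using this.2 h
    simp [h, hby]
  · have hby : b ≠ y := by simpa [h] using this
    simp [h, hby]

/-- Table reduction depends only on the terms that are not omitted. -/
theorem rawTables_flatMap {r n : ℕ} (g : Fin r → List (Fin n)) {S : List (Fin r)}
    {Z : List (Fin n)} {w : List (Equiv.Perm (Fin r))} {w' : List (Equiv.Perm (Fin n))}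
    (hg : ∀ x ∉ S, ∃ y, g x = [y]) (hinj : ∀ x ∉ S, ∀ x' ∉ S, g x = g x' → x = x')
    (H : List.Forall₂ (fun σ τ => (word τ).filter (· ∉ Z) =
      ((word σ).filter (· ∉ S)).flatMap g) w w') :
    rawTables F Z w' = Finsupp.lmapDomain F F (List.flatMap g) (rawTables F S w) := by
  induction S, w using rawTables_induction generalizing Z w' with
  | nil S =>
    rw [List.forall₂_nil_left_iff.1 H]
    simp
  | filter_nil S w ws hw ih =>
    obtain ⟨τ, ws', hτ, H', rfl⟩ := List.forall₂_cons_left_iff.1 H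
    rw [hw, List.flatMap_nil] at hτ
    rw [rawTables_of_filter_eq_nil hw, rawTables_of_filter_eq_nil hτ]
    have : ws = [] ↔ ws' = [] := by
      rw [← List.length_eq_zero_iff, H'.length_eq, List.length_eq_zero_iff]
    simp [this]
  | filter_cons S w ws x l hw ih ihw =>
    obtain ⟨τ, ws', hτ, H', rfl⟩ := List.forall₂_cons_left_iff.1 H
    have hx : x ∉ S := notMem_of_filter_eq_cons hw
    obtain ⟨y, hy⟩ := hg x hx
    have hτ' : (word τ).filter (· ∉ Z) = y :: l.flatMap g := by
      rw [hτ, hw, List.flatMap_cons, hy, List.singleton_append]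
    have hS : ∀ {a}, a ∉ S ++ [x] → a ∉ S := by
      intro a ha h; exact ha (by simp [h])
    -- Omitting `x` on one side and its image `y` on the other preserves the relation between the
    -- words; injectivity of `g` ensures that nothing else disappears.
    have key : ∀ σ τ : _, (word τ).filter (· ∉ Z) = ((word σ).filter (· ∉ S)).flatMap g →
        (word τ).filter (· ∉ Z ++ [y]) = ((word σ).filter (· ∉ S ++ [x])).flatMap g := by
      intro σ τ h
      rw [filter_notMem_append, h, filter_notMem_append]
      refine filter_flatMap_singleton (fun a ha => ?_) (fun a ha => ?_)
      · exact hg a (by simpa using (List.mem_filter.1 ha).2)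
      · rw [← hy]
        exact ⟨fun h => hinj _ (by simpa using (List.mem_filter.1 ha).2) _ hx h,
          fun h => by rw [h]⟩
    rw [rawTables_of_filter_eq_cons hw, rawTables_of_filter_eq_cons hτ',
      ihw (Z := Z ++ [y]) (fun a ha => hg a (hS ha))
        (fun a ha a' ha' => hinj a (hS ha) a' (hS ha')) (H.imp key), ih S hg hinj H', map_add]
    have hc : ∀ z : List (Fin r) →₀ F, consMap y (Finsupp.lmapDomain F F (List.flatMap g) z) =
        Finsupp.lmapDomain F F (List.flatMap g) (consMap x z) := by
      intro z
      refine eqOn_supported (f := consMap y ∘ₗ Finsupp.lmapDomain F F (List.flatMap g))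
        (g := Finsupp.lmapDomain F F (List.flatMap g) ∘ₗ consMap x) (fun u _ => ?_)
        (mem_supported_univ z)
      simp [hy]
    rw [hc, hc]

theorem rawTables_congr {r : ℕ} {S Z : List (Fin r)} (h : ∀ x, x ∈ S ↔ x ∈ Z)
    (w : List (Equiv.Perm (Fin r))) : rawTables F S w = rawTables F Z w := by
  rw [rawTables_flatMap (F := F) (S := Z) (Z := S) (w := w) (fun x => [x]) (by simp) (by simp)]
  · rw [show List.flatMap (fun x : Fin r => [x]) = id from funext List.flatMap_singleton']
    exact Finsupp.mapDomain_id
  · rw [List.forall₂_same]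
    simp [h]

/-- The equivariance of table reduction. -/
theorem rawTables_map_mul {r : ℕ} (σ : Equiv.Perm (Fin r)) (w : List (Equiv.Perm (Fin r))) :
    rawTables F [] (w.map (σ * ·)) = Finsupp.lmapDomain F F (List.map σ) (rawTables F [] w) := by
  rw [rawTables_flatMap (F := F) (S := []) (Z := []) (w := w) (fun x => [σ x]) (by simp) (by simp)]
  · rw [show List.flatMap (fun x : Fin r => [σ x]) = List.map σ from
      funext fun l => List.map_eq_flatMap.symm]
  · rw [List.forall₂_map_right_iff, List.forall₂_same]
    intro τ _
    rw [word_mul, ← List.map_eq_flatMap]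
    simp

/-- By the recursion, all the tables start with the first value that is left; here it is put in
front once more. -/
theorem consMap_rawTables_mem_degenerate {r : ℕ} {S : List (Fin r)} {w : Equiv.Perm (Fin r)}
    {x : Fin r} {l : List (Fin r)} (hw : (word w).filter (· ∉ S) = x :: l)
    (ws : List (Equiv.Perm (Fin r))) :
    consMap x (rawTables F S (w :: ws)) ∈ degenerate F (Fin r) := by
  rw [rawTables_of_filter_eq_cons hw, map_add]
  exact Submodule.add_mem _ (consMap_consMap_mem_degenerate _ _)
    (consMap_consMap_mem_degenerate _ _)

/-- If the first row ends at its first term `x`, then the second row starts with `x` too. If it goes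
on, then `x` is used up in both words, and induction applies. -/
theorem rawTables_mem_degenerate_of_filter_eq {r : ℕ} {S : List (Fin r)}
    {w w' : Equiv.Perm (Fin r)} (hw : (word w).filter (· ∉ S) = (word w').filter (· ∉ S))
    (ws : List (Equiv.Perm (Fin r))) :
    rawTables F S (w :: w' :: ws) ∈ degenerate F (Fin r) := by
  generalize hl : (word w).filter (· ∉ S) = l
  induction l generalizing S with
  | nil => rw [rawTables_of_filter_eq_nil hl]; simp
  | cons x l ih =>
    rw [rawTables_of_filter_eq_cons hl]
    refine Submodule.add_mem _ (consMap_mem_degenerate _ (ih ?_ ?_))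
      (consMap_rawTables_mem_degenerate (hw ▸ hl) ws)
    · rw [filter_notMem_append, hw, filter_notMem_append]
    · exact filter_append_of_filter_eq_cons hl

/-- Table reduction sends degenerate simplices to degenerate sequences. -/
theorem rawTables_mem_degenerate {r : ℕ} (S : List (Fin r)) (w : List (Equiv.Perm (Fin r)))
    (h : ¬ w.IsChain (· ≠ ·)) : rawTables F S w ∈ degenerate F (Fin r) := by
  induction S, w using rawTables_induction with
  | nil S => simp
  | filter_nil S w ws hw ih =>
    rw [rawTables_of_filter_eq_nil hw, if_neg (by rintro rfl; simp at h)]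
    simp
  | filter_cons S w ws x l hw ih ihw =>
    by_cases hc : ws.IsChain (· ≠ ·)
    · cases ws with
      | nil => simp at h
      | cons w' ws =>
        have : w = w' := by
          by_contra hne
          exact h (List.isChain_cons_cons.2 ⟨hne, hc⟩)
        subst this
        exact rawTables_mem_degenerate_of_filter_eq rfl ws
    · rw [rawTables_of_filter_eq_cons hw]
      exact Submodule.add_mem _ (consMap_mem_degenerate _ (ihw h))
        (consMap_mem_degenerate _ (ih S hc))

/-- The number of caesuras of a sequence. -/
def caesuraCount {α : Type} [DecidableEq α] : List α → ℕ
  | [] => 0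
  | x :: u => caesuraCount u + if x ∈ u then 1 else 0

/-- The end of a row that is not the last one stays available and must occur again; every other term
is the last occurrence of its value. So there is one caesura for each row but the last. -/
theorem rawTables_mem_supported {r : ℕ} (S : List (Fin r)) (w : List (Equiv.Perm (Fin r))) :
    rawTables F S w ∈ Finsupp.supported F F
      {u : List (Fin r) | (∀ x, x ∈ u ↔ x ∉ S) ∧ caesuraCount u + 1 = w.length} := by
  induction S, w using rawTables_induction with
  | nil S => simp
  | filter_nil S w ws hw ih =>
    rw [rawTables_of_filter_eq_nil hw]
    split_ifs with h
    · refine Finsupp.single_mem_supported F 1 ⟨fun x => ?_, ?_⟩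
      · simp [mem_of_filter_eq_nil hw x]
      · simp [h, caesuraCount]
    · simp
  | filter_cons S w ws x l hw ih ihw =>
    have hx : x ∉ S := notMem_of_filter_eq_cons hw
    rw [rawTables_of_filter_eq_cons hw]
    refine Submodule.add_mem _ (map_mem_of_supported ?_ ihw) (map_mem_of_supported ?_ (ih S))
    · rintro u ⟨h1, h2⟩
      rw [consMap_single]
      refine Finsupp.single_mem_supported F 1 ⟨fun y => ?_, ?_⟩
      · rw [List.mem_cons, h1]
        by_cases hy : y = x
        · simp [hy, hx]
        · simp [hy]
      · have : x ∉ u := by rw [h1]; simp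
        simp [caesuraCount, this, ← h2]
    · rintro u ⟨h1, h2⟩
      rw [consMap_single]
      have hxu : x ∈ u := (h1 x).2 hx
      refine Finsupp.single_mem_supported F 1 ⟨fun y => ?_, ?_⟩
      · rw [List.mem_cons, h1]
        by_cases hy : y = x
        · simp [hy, hx]
        · simp [hy]
      · simp [caesuraCount, hxu, ← h2]

/-! ### Deletion of a value that occurs once -/

/-- Deletes a value that occurs exactly once; the other sequences are sent to zero. -/
noncomputable def eraseOnce {α : Type} [DecidableEq α] (x : α) :
    (List α →₀ F) →ₗ[F] (List α →₀ F) :=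
  Finsupp.linearCombination F fun u =>
    if u.count x = 1 then Finsupp.single (u.erase x) 1 else 0

theorem eraseOnce_consMap_of_ne {α : Type} [DecidableEq α] {x y : α} (h : y ≠ x)
    (z : List α →₀ F) : eraseOnce x (consMap y z) = consMap y (eraseOnce x z) := by
  refine eqOn_supported (f := eraseOnce x ∘ₗ consMap y)
        (g := consMap y ∘ₗ eraseOnce x) (fun u _ => ?_) (mem_supported_univ z)
  simp only [LinearMap.comp_apply, consMap_single, eraseOnce, linearCombination_one,
    List.count_cons_of_ne h]
  split_ifs
  · rw [List.erase_cons_tail (by simpa using h), consMap_single]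
  · simp

theorem eraseOnce_consMap_of_notMem {α : Type} [DecidableEq α] {x : α} {z : List α →₀ F}
    (hz : z ∈ Finsupp.supported F F {u : List α | x ∉ u}) : eraseOnce x (consMap x z) = z := by
  refine eqOn_supported (f := eraseOnce x ∘ₗ consMap x) (g := LinearMap.id) (fun u hu => ?_) hz
  have hu' : u.count x = 0 := List.count_eq_zero.2 hu
  simp [eraseOnce, hu']

theorem eraseOnce_consMap_of_mem {α : Type} [DecidableEq α] {x : α} {z : List α →₀ F}
    (hz : z ∈ Finsupp.supported F F {u : List α | x ∈ u}) : eraseOnce x (consMap x z) = 0 := by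
  refine eqOn_supported (f := eraseOnce x ∘ₗ consMap x) (g := 0) (fun u hu => ?_) hz
  have hu' : u.count x ≠ 0 := fun h => List.count_eq_zero.1 h hu
  simp [eraseOnce, hu']

/-- To omit one more value amounts to deleting this value where it occurs once. -/
theorem eraseOnce_rawTables {r : ℕ} {x : Fin r} (S : List (Fin r)) (hx : x ∉ S)
    (w : List (Equiv.Perm (Fin r))) :
    eraseOnce x (rawTables F S w) = rawTables F (S ++ [x]) w := by
  induction S, w using rawTables_induction with
  | nil S => simp
  | filter_nil S w ws hw ih => exact absurd (mem_of_filter_eq_nil hw x) hx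
  | filter_cons S w ws y l hw ih ihw =>
    have hm : ∀ {S : List (Fin r)} {w}, x ∉ S → (rawTables F S w : List (Fin r) →₀ F) ∈
        Finsupp.supported F F {u : List (Fin r) | x ∈ u} := fun {S w} h =>
      Finsupp.supported_mono (fun u hu => (hu.1 x).2 h) (rawTables_mem_supported S w)
    rw [rawTables_of_filter_eq_cons hw, map_add]
    by_cases hy : y = x
    -- Where the row goes on, the leading value is its only occurrence and is deleted; where the row
    -- ends, the value occurs again, and the result is zero.
    · subst hy
      rw [eraseOnce_consMap_of_mem (hm hx), eraseOnce_consMap_of_notMem, add_zero]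
      exact Finsupp.supported_mono (fun u hu h => (hu.1 y).1 h (by simp))
        (rawTables_mem_supported (S ++ [y]) (w :: ws))
    · have hl : (word w).filter (· ∉ S ++ [x]) = y :: l.filter (· ∉ [x]) := by
        rw [filter_notMem_append, hw]
        simp [hy]
      rw [eraseOnce_consMap_of_ne hy, eraseOnce_consMap_of_ne hy, ih S hx,
        ihw (by simp [hx, Ne.symm hy]), rawTables_of_filter_eq_cons hl]
      congr 2
      -- The two sides omit `x` and `y` in different orders.
      refine rawTables_congr (fun a => ?_) _
      simp only [List.mem_append, List.mem_singleton]
      tauto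

/-- The linear extension of `rawTables`. -/
noncomputable def rawTablesMap {r : ℕ} (S : List (Fin r)) :
    (List (Equiv.Perm (Fin r)) →₀ F) →ₗ[F] (List (Fin r) →₀ F) :=
  Finsupp.linearCombination F (rawTables F S)

@[simp] theorem rawTablesMap_single {r : ℕ} (S : List (Fin r)) (w : List (Equiv.Perm (Fin r))) :
    rawTablesMap S (Finsupp.single w (1 : F)) = rawTables F S w := by
  simp [rawTablesMap]

theorem rawTablesMap_single_nil {r : ℕ} (S : List (Fin r)) (c : F) :
    rawTablesMap S (Finsupp.single [] c) = 0 := by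
  simp [rawTablesMap]

theorem rawTablesMap_consMap_of_filter_eq_cons {r : ℕ} {S : List (Fin r)} {w : Equiv.Perm (Fin r)}
    {x : Fin r} {l : List (Fin r)} (hw : (word w).filter (· ∉ S) = x :: l)
    (z : List (Equiv.Perm (Fin r)) →₀ F) :
    rawTablesMap S (consMap w z) =
      consMap x (rawTablesMap (S ++ [x]) (consMap w z)) + consMap x (rawTablesMap S z) := by
  refine eqOn_supported (f := rawTablesMap S ∘ₗ consMap w) (g := consMap x ∘ₗ
    rawTablesMap (S ++ [x]) ∘ₗ consMap w + consMap x ∘ₗ rawTablesMap S) (fun u _ => ?_)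
    (mem_supported_univ z)
  simp [rawTables_of_filter_eq_cons hw]

theorem rawTablesMap_consMap_of_filter_eq_nil {r : ℕ} {S : List (Fin r)} {w : Equiv.Perm (Fin r)}
    (hw : (word w).filter (· ∉ S) = []) (z : List (Equiv.Perm (Fin r)) →₀ F) :
    rawTablesMap S (consMap w z) = Finsupp.single [] (augment z) := by
  refine eqOn_supported (f := rawTablesMap S ∘ₗ consMap w) (g := Finsupp.lsingle [] ∘ₗ augment)
    (fun u _ => ?_) (mem_supported_univ z)
  simp [rawTables_of_filter_eq_nil hw]

theorem consMap_rawTablesMap_mem_degenerate {r : ℕ} {S : List (Fin r)} {w : Equiv.Perm (Fin r)}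
    {x : Fin r} {l : List (Fin r)} (hw : (word w).filter (· ∉ S) = x :: l)
    (z : List (Equiv.Perm (Fin r)) →₀ F) :
    consMap x (rawTablesMap S (consMap w z)) ∈ degenerate F (Fin r) := by
  rw [rawTablesMap_consMap_of_filter_eq_cons hw, map_add]
  exact Submodule.add_mem _ (consMap_consMap_mem_degenerate _ _)
    (consMap_consMap_mem_degenerate _ _)

end Tables

/-! ### The differential of the surjection complexes -/

section Differential

variable {F : Type u} [CommRing F] {r : ℕ}

theorem isCaesura_cons_zero (x : Fin r) (u : List (Fin r)) : IsCaesura (x :: u) 0 ↔ x ∈ u := by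
  simp [IsCaesura]

theorem isCaesura_cons_succ (x : Fin r) (u : List (Fin r)) (i : ℕ) :
    IsCaesura (x :: u) (i + 1) ↔ IsCaesura u i := by
  simp [IsCaesura]

@[simp] theorem lineOf_zero (u : List (Fin r)) : lineOf u 0 = 0 := by
  simp [lineOf]

theorem lineOf_cons_succ (x : Fin r) (u : List (Fin r)) (i : ℕ) :
    lineOf (x :: u) (i + 1) = lineOf u i + if x ∈ u then 1 else 0 := by
  simp only [lineOf, Finset.card_filter, Finset.sum_range_succ', isCaesura_cons_succ,
    isCaesura_cons_zero]

theorem diffSign_of_isCaesura {u : List (Fin r)} {i : ℕ} (h : IsCaesura u i) :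
    diffSign u i = (-1) ^ lineOf u i := by
  simp [diffSign, h]

theorem diffSign_of_previous {u : List (Fin r)} {i m : ℕ} (h : ¬ IsCaesura u i) (hm : m < i)
    (hmi : u[m]? = u[i]?) (hj : ∀ j, m < j → j < i → u[j]? ≠ u[i]?) :
    diffSign u i = -(-1) ^ lineOf u m := by
  have hne : ((Finset.range i).filter fun j => u[j]? = u[i]?).Nonempty :=
    ⟨m, by simp [hm, hmi]⟩
  have hmax : ((Finset.range i).filter fun j => u[j]? = u[i]?).max' hne = m := by
    refine le_antisymm (Finset.max'_le _ _ _ fun j h => ?_) (Finset.le_max' _ _ (by simp [hm, hmi]))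
    rw [Finset.mem_filter, Finset.mem_range] at h
    by_contra hlt
    exact hj j (by omega) h.1 h.2
  rw [diffSign, if_neg h, dif_pos hne, hmax]

theorem diffSign_of_forall_ne {u : List (Fin r)} {i : ℕ} (h : ¬ IsCaesura u i)
    (hj : ∀ j < i, u[j]? ≠ u[i]?) : diffSign u i = 0 := by
  rw [diffSign, if_neg h, dif_neg]
  rintro ⟨j, hj'⟩
  rw [Finset.mem_filter, Finset.mem_range] at hj'
  exact hj j hj'.1 hj'.2

theorem exists_previous_or {u : List (Fin r)} {i : ℕ} :
    (∃ m < i, u[m]? = u[i]? ∧ ∀ j, m < j → j < i → u[j]? ≠ u[i]?) ∨ ∀ j < i, u[j]? ≠ u[i]? := by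
  by_cases hne : ((Finset.range i).filter fun j => u[j]? = u[i]?).Nonempty
  · refine Or.inl ⟨Finset.max' _ hne, ?_⟩
    have hmem := Finset.max'_mem _ hne
    rw [Finset.mem_filter, Finset.mem_range] at hmem
    refine ⟨hmem.1, hmem.2, fun j h1 h2 h3 => ?_⟩
    have := Finset.le_max' ((Finset.range i).filter fun j => u[j]? = u[i]?) j (by simp [h2, h3])
    omega
  · refine Or.inr fun j h1 h2 => hne ⟨j, by simp [h1, h2]⟩

theorem count_eq_of_getElem {α : Type*} [DecidableEq α] {u : List α} {i : ℕ} (h : i < u.length) :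
    u.count u[i] = (u.take i).count u[i] + 1 + (u.drop (i + 1)).count u[i] := by
  have key : ∀ x, u.count x = (u.take i).count x + (u[i] :: u.drop (i + 1)).count x := by
    intro x
    rw [← List.count_append, ← List.drop_eq_getElem_cons h, List.take_append_drop]
  rw [key, List.count_cons_self]
  omega

theorem diffSign_cons_zero (x : Fin r) (u : List (Fin r)) :
    diffSign (x :: u) 0 = if x ∈ u then 1 else 0 := by
  split_ifs with h
  · rw [diffSign_of_isCaesura ((isCaesura_cons_zero x u).2 h), lineOf_zero, pow_zero]
  · exact diffSign_of_forall_ne (mt (isCaesura_cons_zero x u).1 h) (by simp)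

/-- If the new first term is a caesura, then all the lines are shifted by one and all the signs
change. Moreover, if `x` occurs once in `u`, this occurrence had no sign; it now follows the leading
caesura, whose sign is +, and so gets −. -/
theorem diffSign_cons_succ (x : Fin r) (u : List (Fin r)) {i : ℕ} (hi : i < u.length) :
    diffSign (x :: u) (i + 1) = (if x ∈ u then -1 else 1) * diffSign u i -
      if u[i] = x ∧ u.count x = 1 then 1 else 0 := by
  have hs : (if x ∈ u then (-1 : ℤ) else 1) = (-1) ^ (if x ∈ u then 1 else 0) := by
    split_ifs <;> simp
  have hget : ∀ j, j < i → u[j]? = u[i]? → u[i] ∈ u.take i := by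
    intro j hj h
    rw [List.getElem?_eq_getElem (by omega), List.getElem?_eq_getElem hi, Option.some_inj] at h
    rw [← h]
    exact List.mem_take_iff_getElem.2 ⟨j, by omega, rfl⟩
  by_cases hc : IsCaesura u i
  · have hcount : ¬ (u[i] = x ∧ u.count x = 1) := by
      rintro ⟨rfl, h⟩
      obtain ⟨_, h'⟩ := hc
      rw [count_eq_of_getElem hi] at h
      have h0 : (u.drop (i + 1)).count u[i] = 0 := by omega
      exact List.count_eq_zero.1 h0 h'
    rw [diffSign_of_isCaesura ((isCaesura_cons_succ x u i).2 hc), diffSign_of_isCaesura hc,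
      lineOf_cons_succ, if_neg hcount, hs, sub_zero, pow_add, mul_comm]
  · have hc' : ¬ IsCaesura (x :: u) (i + 1) := mt (isCaesura_cons_succ x u i).1 hc
    rcases exists_previous_or (u := u) (i := i) with ⟨m, hm, hmi, hj⟩ | hj
    · have hcount : ¬ (u[i] = x ∧ u.count x = 1) := by
        rintro ⟨rfl, h⟩
        rw [count_eq_of_getElem hi] at h
        have h0 : (u.take i).count u[i] = 0 := by omega
        exact List.count_eq_zero.1 h0 (hget m hm hmi)
      rw [diffSign_of_previous hc hm hmi hj, diffSign_of_previous (m := m + 1) hc' (by omega)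
        (by simpa using hmi), lineOf_cons_succ, if_neg hcount, hs, sub_zero, pow_add]
      · ring
      · intro j h1 h2
        obtain ⟨j, rfl⟩ : ∃ j', j = j' + 1 := ⟨j - 1, by omega⟩
        simpa using hj j (by omega) (by omega)
    · rw [diffSign_of_forall_ne hc hj, mul_zero, zero_sub]
      by_cases hx : u[i] = x
      · have hcount : u.count x = 1 := by
          subst hx
          have h1 : (u.take i).count u[i] = 0 := by
            rw [List.count_eq_zero]
            intro h
            obtain ⟨j, hj', h'⟩ := List.mem_take_iff_getElem.1 h
            refine hj j (by omega) ?_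
            rw [List.getElem?_eq_getElem (by omega), List.getElem?_eq_getElem hi, h']
          have h2 : (u.drop (i + 1)).count u[i] = 0 :=
            List.count_eq_zero.2 fun h => hc ⟨hi, h⟩
          rw [count_eq_of_getElem hi, h1, h2]
        rw [if_pos ⟨hx, hcount⟩, diffSign_of_previous (m := 0) hc' (by omega), lineOf_zero, pow_zero]
        · simp [hx, List.getElem?_eq_getElem hi]
        · intro j h1 h2
          obtain ⟨j, rfl⟩ : ∃ j', j = j' + 1 := ⟨j - 1, by omega⟩
          simpa using hj j (by omega)
      · rw [if_neg (fun h => hx h.1), neg_zero, diffSign_of_forall_ne hc']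
        intro j h1
        cases j with
        | zero => simpa [List.getElem?_eq_getElem hi] using fun h => hx h.symm
        | succ j => simpa using hj j (by omega)

/-- The differential of a sequence in the free module on all sequences. -/
noncomputable def rawDiff (F : Type u) [CommRing F] (u : List (Fin r)) : List (Fin r) →₀ F :=
  ∑ i ∈ Finset.range u.length, diffSign u i • Finsupp.single (u.eraseIdx i) 1

/-- The linear extension of `rawDiff`. -/
noncomputable def rawDiffMap : (List (Fin r) →₀ F) →ₗ[F] (List (Fin r) →₀ F) :=
  Finsupp.linearCombination F (rawDiff F)

@[simp] theorem rawDiffMap_single (u : List (Fin r)) :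
    rawDiffMap (Finsupp.single u (1 : F)) = rawDiff F u := by
  simp [rawDiffMap]

@[simp] theorem rawDiff_nil : rawDiff F ([] : List (Fin r)) = 0 := by
  simp [rawDiff]

/-- As a sum over places, the deletion can be compared term by term with the differential. -/
theorem eraseOnce_single_eq_sum {α : Type} [DecidableEq α] (x : α) (u : List α) :
    eraseOnce x (Finsupp.single u (1 : F)) = ∑ i ∈ Finset.range u.length,
      (if u[i]? = some x ∧ u.count x = 1 then (1 : ℤ) else 0) •
        Finsupp.single (u.eraseIdx i) 1 := by
  simp only [eraseOnce, linearCombination_one]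
  split_ifs with h
  · have hx : x ∈ u := List.count_pos_iff.1 (by omega)
    have hi : u.idxOf x < u.length := List.idxOf_lt_length_of_mem hx
    rw [Finset.sum_eq_single (u.idxOf x)]
    · rw [if_pos, one_smul, List.erase_eq_eraseIdx_of_idxOf rfl]
      simp [List.getElem?_eq_getElem hi, h]
    · intro i hi' hne
      rw [if_neg, zero_smul]
      rintro ⟨h1, -⟩
      rw [Finset.mem_range] at hi'
      rw [List.getElem?_eq_getElem hi', Option.some_inj] at h1
      have hc := count_eq_of_getElem hi'
      rw [h1, h] at hc
      have h0 : (u.take i).count x = 0 := by omega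
      have h2 : (u.drop (i + 1)).count x = 0 := by omega
      rcases lt_or_gt_of_ne hne with h3 | h3
      · refine List.count_eq_zero.1 h2 (List.mem_drop_iff_getElem.2
          ⟨u.idxOf x - (i + 1), by omega, ?_⟩)
        simp only [show i + 1 + (u.idxOf x - (i + 1)) = u.idxOf x by omega]
        exact List.getElem_idxOf hi
      · refine List.count_eq_zero.1 h0 (List.mem_take_iff_getElem.2
          ⟨u.idxOf x, by omega, List.getElem_idxOf hi⟩)
    · intro h'
      exact absurd (Finset.mem_range.2 hi) h'
  · simp [h]

/-- The three summands delete the first term, delete a later term with the sign it had in `u` up to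
the shift of lines, and correct the sign of an `x` that was alone in `u`. -/
theorem rawDiff_cons (x : Fin r) (u : List (Fin r)) :
    rawDiff F (x :: u) =
      (if x ∈ u then (1 : ℤ) else 0) • Finsupp.single u 1 +
        (if x ∈ u then (-1 : ℤ) else 1) • consMap x (rawDiff F u) -
        consMap x (eraseOnce x (Finsupp.single u 1)) := by
  rw [rawDiff, List.length_cons, Finset.sum_range_succ', rawDiff, eraseOnce_single_eq_sum,
    map_sum, map_sum, Finset.smul_sum, add_sub_assoc, ← Finset.sum_sub_distrib, add_comm,
    diffSign_cons_zero]
  refine congrArg₂ _ (by simp) (Finset.sum_congr rfl fun i hi => ?_)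
  rw [Finset.mem_range] at hi
  rw [diffSign_cons_succ x u hi, List.getElem?_eq_getElem hi]
  simp only [Option.some_inj, map_zsmul, consMap_single, List.eraseIdx_cons_succ, sub_smul,
    smul_smul]

theorem eraseOnce_single_of_notMem {α : Type} [DecidableEq α] {x : α} {u : List α} (h : x ∉ u) :
    eraseOnce x (Finsupp.single u (1 : F)) = 0 := by
  simp [eraseOnce, List.count_eq_zero.2 h]

theorem rawDiff_cons_of_notMem {x : Fin r} {u : List (Fin r)} (h : x ∉ u) :
    rawDiff F (x :: u) = consMap x (rawDiff F u) := by
  rw [rawDiff_cons, eraseOnce_single_of_notMem h]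
  simp [h]

theorem rawDiff_cons_of_mem {x : Fin r} {u : List (Fin r)} (h : x ∈ u) :
    rawDiff F (x :: u) = Finsupp.single u 1 - consMap x (rawDiff F u) -
      consMap x (eraseOnce x (Finsupp.single u 1)) := by
  rw [rawDiff_cons]
  simp only [h, if_true, one_smul, neg_smul]
  abel

theorem rawDiffMap_consMap_of_notMem {x : Fin r} {z : List (Fin r) →₀ F}
    (hz : z ∈ Finsupp.supported F F {u : List (Fin r) | x ∉ u}) :
    rawDiffMap (consMap x z) = consMap x (rawDiffMap z) := by
  refine eqOn_supported (f := rawDiffMap ∘ₗ consMap x) (g := consMap x ∘ₗ rawDiffMap)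
    (fun u hu => ?_) hz
  simp [rawDiff_cons_of_notMem hu]

theorem rawDiffMap_consMap_of_mem {x : Fin r} {z : List (Fin r) →₀ F}
    (hz : z ∈ Finsupp.supported F F {u : List (Fin r) | x ∈ u}) :
    rawDiffMap (consMap x z) = z - consMap x (rawDiffMap z) - consMap x (eraseOnce x z) := by
  refine eqOn_supported (f := rawDiffMap ∘ₗ consMap x)
    (g := LinearMap.id - consMap x ∘ₗ rawDiffMap - consMap x ∘ₗ eraseOnce x) (fun u hu => ?_) hz
  simp [rawDiff_cons_of_mem hu]

/-- A term that equals its neighbour occurs twice, so it is not the one that is deleted, and the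
repetition survives. -/
theorem eraseOnce_mem_degenerate {α : Type} [DecidableEq α] (x : α) {z : List α →₀ F}
    (hz : z ∈ degenerate F α) : eraseOnce x z ∈ degenerate F α := by
  refine map_mem_of_supported (fun u hu => ?_) hz
  rw [eraseOnce, linearCombination_one]
  split_ifs with h
  · refine single_mem_degenerate ?_
    induction u with
    | nil => simp at hu
    | cons y u ih =>
      by_cases hy : y = x
      · subst hy
        rw [List.erase_cons_head]
        intro hc
        refine hu ?_
        rw [List.isChain_cons]
        refine ⟨?_, hc⟩
        rintro z hz rfl
        have : y ∈ u := List.mem_of_mem_head? hz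
        rw [List.count_cons_self] at h
        exact List.count_eq_zero.1 (by omega) this
      · rw [List.count_cons_of_ne hy] at h
        rw [List.erase_cons_tail (by simpa using hy)]
        by_cases hc : u.IsChain (· ≠ ·)
        · cases u with
          | nil => simp at h
          | cons z u =>
            have hyz : y = z := by
              by_contra hne
              exact hu (List.isChain_cons_cons.2 ⟨hne, hc⟩)
            subst hyz
            rw [List.erase_cons_tail (by simpa using hy)]
            simp
        · exact fun h' => ih hc h h'.tail
  · simp

/-- The differential of a degenerate sequence is degenerate. -/
theorem rawDiff_mem_degenerate {u : List (Fin r)} (h : ¬ u.IsChain (· ≠ ·)) :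
    rawDiff F u ∈ degenerate F (Fin r) := by
  induction u with
  | nil => simp at h
  | cons x u ih =>
    by_cases hc : u.IsChain (· ≠ ·)
    · cases u with
      | nil => simp at h
      | cons y u =>
        have hxy : x = y := by
          by_contra hne
          exact h (List.isChain_cons_cons.2 ⟨hne, hc⟩)
        subst hxy
        rw [rawDiff_cons_of_mem (by simp)]
        -- The two deletions in the pair x, x cancel: either both are caesuras, on consecutive
        -- lines, or the second is the last occurrence and takes the sign opposite to the first.
        by_cases hx : x ∈ u
        · have hcount : ¬ (x :: u).count x = 1 := by
            rw [List.count_cons_self]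
            have := List.count_pos_iff.2 hx
            omega
          rw [rawDiff_cons_of_mem hx]
          simp only [eraseOnce, linearCombination_one, hcount, if_false, map_sub, map_zero,
            consMap_single, sub_zero]
          rw [sub_sub, sub_sub_cancel]
          exact Submodule.add_mem _ (consMap_consMap_mem_degenerate _ _)
            (consMap_consMap_mem_degenerate _ _)
        · have hcount : (x :: u).count x = 1 := by
            rw [List.count_cons_self, List.count_eq_zero.2 hx]
          rw [rawDiff_cons_of_notMem hx]
          simp only [eraseOnce, linearCombination_one, hcount, if_true, List.erase_cons_head,
            consMap_single]
          rw [sub_right_comm, sub_self, zero_sub]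
          exact Submodule.neg_mem _ (consMap_consMap_mem_degenerate _ _)
    · have hs : (Finsupp.single u 1 : List (Fin r) →₀ F) ∈ degenerate F (Fin r) :=
        single_mem_degenerate hc
      rw [rawDiff_cons]
      exact Submodule.sub_mem _ (Submodule.add_mem _ (sign_smul_mem _ hs)
        (sign_smul_mem _ (consMap_mem_degenerate _ (ih hc))))
        (consMap_mem_degenerate _ (eraseOnce_mem_degenerate _ hs))

theorem rawDiff_mem_supported_of_notMem {u : List (Fin r)} {x : Fin r} (h : x ∉ u) :
    rawDiff F u ∈ Finsupp.supported F F {u : List (Fin r) | x ∉ u} :=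
  Submodule.sum_mem _ fun _ _ => sign_smul_mem _ (Finsupp.single_mem_supported F 1
    (fun h' => h (List.mem_of_mem_eraseIdx h')))

/-- Table reduction commutes with the differentials. -/
theorem rawDiffMap_rawTables (S : List (Fin r)) (w : List (Equiv.Perm (Fin r))) :
    rawDiffMap (rawTables F S w) = rawTablesMap S (faces w) := by
  induction S, w using rawTables_induction with
  | nil S => simp [faces]
  | filter_nil S w ws hw ih =>
    rw [faces_cons, map_sub, rawTablesMap_consMap_of_filter_eq_nil hw,
      rawTables_of_filter_eq_nil hw, augment_faces, rawTablesMap_single]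
    cases ws with
    | nil => simp
    | cons w' ws =>
      have hw' : (word w').filter (· ∉ S) = [] := by
        rw [List.filter_eq_nil_iff]
        intro x _
        simpa using mem_of_filter_eq_nil hw x
      rw [rawTables_of_filter_eq_nil hw']
      simp
  | filter_cons S w ws x l hw ih ihw =>
    have hx : x ∉ S := notMem_of_filter_eq_cons hw
    have h1 : rawTables F (S ++ [x]) (w :: ws) ∈
        Finsupp.supported F F {u : List (Fin r) | x ∉ u} :=
      Finsupp.supported_mono (fun u hu h => (hu.1 x).1 h (by simp)) (rawTables_mem_supported _ _)
    have h2 : rawTables F S ws ∈ Finsupp.supported F F {u : List (Fin r) | x ∈ u} :=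
      Finsupp.supported_mono (fun u hu => (hu.1 x).2 hx) (rawTables_mem_supported _ _)
    -- The term with `x` deleted, x T_{S+x}(ws), cancels the contribution of the first face to the
    -- summand where the row goes on.
    rw [rawTables_of_filter_eq_cons hw, map_add, rawDiffMap_consMap_of_notMem h1,
      rawDiffMap_consMap_of_mem h2, eraseOnce_rawTables S hx, ihw, ih, faces_cons]
    simp only [map_sub, rawTablesMap_single, rawTablesMap_consMap_of_filter_eq_cons hw]
    abel

end Differential

/-! ### The composition product of the surjection complexes -/

section Composition

variable {F : Type u} [CommRing F] {r s n : ℕ}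

/-! ### Degrees of components -/

/-- The terms of a sequence with their lines, where the numbering of the lines starts with `m`. -/
def linesFrom : ℕ → List (Fin r) → List (Fin r × ℕ)
  | _, [] => []
  | m, x :: u => (x, m) :: linesFrom (m + if x ∈ u then 1 else 0) u

theorem zipIdx_map_lineOf (m : ℕ) (u : List (Fin r)) :
    (u.zipIdx.map fun p => (p.1, m + lineOf u p.2)) = linesFrom m u := by
  induction u generalizing m with
  | nil => rfl
  | cons x u ih =>
    rw [linesFrom, ← ih, List.zipIdx_cons, List.map_cons, List.zipIdx_succ, List.map_map]
    refine congrArg₂ _ (by simp) (List.map_congr_left fun p _ => ?_)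
    simp only [Function.comp_apply, lineOf_cons_succ]
    congr 1
    omega

theorem withLines_eq (u : List (Fin r)) : withLines u = linesFrom 0 u := by
  rw [← zipIdx_map_lineOf]
  simp [withLines]

theorem linesFrom_add (m m' : ℕ) (u : List (Fin r)) :
    linesFrom (m + m') u = (linesFrom m u).map fun p => (p.1, p.2 + m') := by
  induction u generalizing m with
  | nil => rfl
  | cons x u ih =>
    rw [linesFrom, linesFrom, List.map_cons, ← ih, Nat.add_right_comm]

theorem componentDegree_map (m : ℕ) (c : List (Fin r × ℕ)) :
    componentDegree (c.map fun p => (p.1, p.2 + m)) = componentDegree c := by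
  have : ((c.map fun p => (p.1, p.2 + m)).map Prod.snd).toFinset =
      (c.map Prod.snd).toFinset.image (· + m) := by
    ext a
    simp only [List.mem_toFinset, List.mem_map, Finset.mem_image]
    constructor
    · rintro ⟨_, ⟨p, hp, rfl⟩, rfl⟩
      exact ⟨_, ⟨p, hp, rfl⟩, rfl⟩
    · rintro ⟨_, ⟨p, hp, rfl⟩, rfl⟩
      exact ⟨_, ⟨p, hp, rfl⟩, rfl⟩
  rw [componentDegree, this, Finset.card_image_of_injective _ (add_left_injective m),
    componentDegree]

theorem le_of_mem_linesFrom {m : ℕ} {u : List (Fin r)} {p : Fin r × ℕ}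
    (hp : p ∈ linesFrom m u) : m ≤ p.2 := by
  induction u generalizing m with
  | nil => simp [linesFrom] at hp
  | cons x u ih =>
    rw [linesFrom, List.mem_cons] at hp
    rcases hp with rfl | hp
    · exact le_rfl
    · exact le_trans (Nat.le_add_right _ _) (ih hp)

/-- The degree of a component that is extended by one term at the front. -/
theorem componentDegree_cons {m : ℕ} {x : Fin r} {u : List (Fin r)} {c : List (Fin r × ℕ)}
    (hc : c <+: linesFrom (m + if x ∈ u then 1 else 0) u) (hnil : c = [] → u = []) :
    componentDegree ((x, m) :: c) = componentDegree c + if x ∈ u then 1 else 0 := by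
  simp only [componentDegree, List.map_cons, List.toFinset_cons]
  by_cases hx : x ∈ u
  · rw [if_pos hx] at hc ⊢
    have hm : m ∉ (c.map Prod.snd).toFinset := by
      rw [List.mem_toFinset, List.mem_map]
      rintro ⟨p, hp, hpm⟩
      have := le_of_mem_linesFrom (hc.subset hp)
      omega
    have hpos : 0 < (c.map Prod.snd).toFinset.card := by
      cases c with
      | nil => rw [hnil rfl] at hx; simp at hx
      | cons p c => exact Finset.card_pos.2 ⟨p.2, by simp⟩
    rw [Finset.card_insert_of_notMem hm]
    omega
  · rw [if_neg hx, add_zero] at hc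
    rw [if_neg hx, add_zero]
    cases c with
    | nil => simp
    | cons p c =>
      cases u with
      | nil => simp [linesFrom] at hc
      | cons y u =>
        rw [linesFrom, List.cons_prefix_cons] at hc
        rw [Finset.insert_eq_of_mem]
        rw [hc.1]
        simp

/-- Adds a term at the front of the first sequence of a list of sequences. -/
def consHead {α : Type} (y : α) (cs : List (List α)) : List (List α) := (y :: cs.headD []) :: cs.tail

/-- The first component either stops at `y`, which then opens the next component as well, or goes on
and is obtained from a splitting of the tail. -/
theorem splittings_cons {α : Type} (n : ℕ) (y : α) (v : List α) :
    splittings (n + 1) (y :: v) = (splittings n (y :: v)).map ([y] :: ·) ++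
      (splittings (n + 1) v).map (consHead y) := by
  cases n with
  | zero => simp [splittings, consHead]
  | succ n =>
    simp only [splittings, List.length_cons, List.range_succ_eq_map, List.flatMap_cons,
      List.flatMap_map, List.drop_zero, List.map_flatMap, List.map_map]
    congr 1

theorem splittings_map {α β : Type} (f : α → β) (n : ℕ) (v : List α) :
    splittings n (v.map f) = (splittings n v).map (List.map (List.map f)) := by
  induction n generalizing v with
  | zero => rfl
  | succ n ih =>
    cases n with
    | zero => simp [splittings]
    | succ n =>
      simp only [splittings, List.length_map, List.map_flatMap, List.map_map]
      refine List.flatMap_congr fun j _ => ?_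
      rw [← List.map_drop, ih, List.map_map]
      refine List.map_congr_left fun t _ => ?_
      simp

theorem exists_of_mem_splittings {α : Type} {n : ℕ} {v : List α} {cs : List (List α)}
    (h : cs ∈ splittings (n + 1) v) :
    ∃ c cs', cs = c :: cs' ∧ c <+: v ∧ (c = [] → v = []) := by
  cases n with
  | zero =>
    simp only [splittings, List.mem_singleton] at h
    exact ⟨v, [], h, List.prefix_rfl, id⟩
  | succ n =>
    simp only [splittings, List.mem_flatMap, List.mem_range, List.mem_map] at h
    obtain ⟨j, hj, cs', -, rfl⟩ := h
    refine ⟨_, _, rfl, List.take_prefix _ _, fun h => ?_⟩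
    rw [List.take_eq_nil_iff] at h
    simpa using h

/-- The degrees of the components of a sequence that is cut at the occurrences of `k`. -/
def cutDegrees (k : Fin r) : List (Fin r) → List ℕ
  | [] => [0]
  | x :: u => (if x = k then [0] else []) ++
      ((cutDegrees k u).headD 0 + if x ∈ u then 1 else 0) :: (cutDegrees k u).tail

theorem exists_cutAt_eq (k : Fin r) (m : ℕ) (u : List (Fin r)) :
    ∃ c cs, cutAt k (linesFrom m u) = c :: cs ∧ c <+: linesFrom m u ∧ (c = [] → u = []) := by
  induction u generalizing m with
  | nil => exact ⟨[], [], rfl, List.prefix_rfl, fun _ => rfl⟩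
  | cons x u ih =>
    obtain ⟨c, cs, h1, h2, -⟩ := ih (m + if x ∈ u then 1 else 0)
    rw [linesFrom, cutAt, h1]
    by_cases hx : x = k
    · exact ⟨[(x, m)], (((x, m) :: c) :: cs), by simp [hx], by simp, by simp⟩
    · exact ⟨(x, m) :: c, cs, by simp [hx], by simpa using h2, by simp⟩

/-- The degree of a component counts the line breaks inside it, hence the caesuras among its terms
other than its last one. This turns a cardinality into a recursion and removes the dependence on the
numbering of the lines. -/
theorem map_componentDegree_cutAt (k : Fin r) (m : ℕ) (u : List (Fin r)) :
    (cutAt k (linesFrom m u)).map componentDegree = cutDegrees k u := by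
  induction u generalizing m with
  | nil => simp [linesFrom, cutAt, cutDegrees, componentDegree]
  | cons x u ih =>
    obtain ⟨c, cs, h1, h2, h3⟩ := exists_cutAt_eq k (m + if x ∈ u then 1 else 0) u
    have := ih (m + if x ∈ u then 1 else 0)
    rw [h1, List.map_cons] at this
    rw [linesFrom, cutAt, h1, cutDegrees, ← this]
    have hd := componentDegree_cons h2 h3
    by_cases hx : x = k
    · simp only [hx, if_true, List.map_cons, List.singleton_append, List.headD_cons,
        List.tail_cons]
      subst hx
      rw [hd]
      simp [componentDegree]
    · simp only [hx, if_false, List.map_cons, List.nil_append, List.headD_cons,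
        List.tail_cons, hd]

theorem cutDegrees_eq_cons (k : Fin r) (u : List (Fin r)) :
    cutDegrees k u = (cutDegrees k u).headD 0 :: (cutDegrees k u).tail := by
  cases u with
  | nil => rfl
  | cons x u => by_cases hx : x = k <;> simp [cutDegrees, hx]

/-- Consecutive components share only an endpoint, so each line break lies inside exactly one of
them. -/
theorem sum_cutDegrees (k : Fin r) (u : List (Fin r)) :
    (cutDegrees k u).sum = caesuraCount u := by
  induction u with
  | nil => rfl
  | cons x u ih =>
    rw [cutDegrees_eq_cons, List.sum_cons] at ih
    rw [cutDegrees, caesuraCount, ← ih, List.sum_append, List.sum_cons]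
    split_ifs <;> simp <;> omega

/-- The composite of two sequences in the free module on all sequences. -/
noncomputable def rawComp (F : Type u) [CommRing F] (h : n + 1 = r + s) (k : Fin r)
    (u : List (Fin r)) (v : List (Fin s)) : List (Fin n) →₀ F :=
  ((splittings (u.count k) (withLines v)).map fun cs =>
    ((-1 : ℤ) ^ insertionExponent ((cutAt k (withLines u)).tail.map componentDegree)
        (cs.map componentDegree)) •
      Finsupp.single (substitute h k u (cs.map (List.map Prod.fst))) 1).sum

/-- The numbering of the lines of `v` may start anywhere, because the tail of a sequence inherits
its lines from the whole. -/
theorem rawComp_eq (h : n + 1 = r + s) (k : Fin r) (u : List (Fin r)) (v : List (Fin s)) (m : ℕ) :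
    rawComp F h k u v = ((splittings (u.count k) (linesFrom m v)).map fun cs =>
      ((-1 : ℤ) ^ insertionExponent (cutDegrees k u).tail (cs.map componentDegree)) •
        Finsupp.single (substitute h k u (cs.map (List.map Prod.fst))) 1).sum := by
  have hd : (cutAt k (withLines u)).tail.map componentDegree = (cutDegrees k u).tail := by
    rw [withLines_eq, List.map_tail, map_componentDegree_cutAt]
  have hm := linesFrom_add 0 m v
  rw [zero_add] at hm
  rw [rawComp, hd, withLines_eq, hm, splittings_map, List.map_map]
  congr 1
  refine List.map_congr_left fun cs _ => ?_
  have h1 : (List.map (List.map fun p : Fin s × ℕ => (p.1, p.2 + m)) cs).map componentDegree =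
      cs.map componentDegree := by
    rw [List.map_map]
    exact List.map_congr_left fun c _ => componentDegree_map m c
  have h2 : (List.map (List.map fun p : Fin s × ℕ => (p.1, p.2 + m)) cs).map (List.map Prod.fst) =
      cs.map (List.map Prod.fst) := by
    rw [List.map_map]
    refine List.map_congr_left fun c _ => ?_
    simp [Function.comp_def]
  rw [Function.comp_apply, h1, h2]

@[simp] theorem rawComp_of_notMem (h : n + 1 = r + s) {k : Fin r} {u : List (Fin r)} (hk : k ∉ u)
    (v : List (Fin s)) : rawComp F h k u v = 0 := by
  simp [rawComp, List.count_eq_zero.2 hk, splittings]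

/-- The new term belongs to U₀, which is not permuted with anything; hence there is no sign. -/
theorem rawComp_cons_of_ne (h : n + 1 = r + s) {k x : Fin r} (hx : x ≠ k) (u : List (Fin r))
    (v : List (Fin s)) :
    rawComp F h k (x :: u) v = consMap (outerIndex h k x hx) (rawComp F h k u v) := by
  rw [rawComp_eq h k _ v 0, rawComp_eq h k _ v 0, map_list_sum, List.map_map,
    List.count_cons_of_ne hx]
  congr 1
  refine List.map_congr_left fun cs _ => ?_
  simp [substitute, hx, cutDegrees]

/-- Besides the case of arity zero, this is where the recursion on `v` stops: all its terms have
been inserted, and a further occurrence of `k` would need a component that does not exist. -/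
theorem rawComp_cons_nil (h : n + 1 = r + s) (k : Fin r) (u : List (Fin r)) :
    rawComp F h k (k :: u) ([] : List (Fin s)) =
      if k ∈ u then 0 else Finsupp.single (substitute h k u []) 1 := by
  rw [rawComp_eq h k _ _ 0, List.count_cons_self]
  split_ifs with hk
  · obtain ⟨c, hc⟩ : ∃ c, u.count k = c + 1 := ⟨u.count k - 1, by
      have := List.count_pos_iff.2 hk; omega⟩
    rw [hc]
    simp [splittings, linesFrom]
  · rw [List.count_eq_zero.2 hk]
    simp [splittings, linesFrom, substitute, cutDegrees, insertionExponent, componentDegree]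

/-- The two summands come from `splittings_cons`. A component (y) has degree 0 and gives no sign.
When V₁ is extended by a caesura `y`, its degree grows by one, and it has to pass U₁, …, Uₙ once
more. -/
theorem rawComp_cons_cons (h : n + 1 = r + s) (k : Fin r) (u : List (Fin r)) (y : Fin s)
    (v : List (Fin s)) :
    rawComp F h k (k :: u) (y :: v) = consMap (innerIndex h k y) (rawComp F h k u (y :: v)) +
      (-1 : ℤ) ^ (if y ∈ v then caesuraCount (k :: u) else 0) •
        consMap (innerIndex h k y) (rawComp F h k (k :: u) v) := by
  -- Since `k` comes first, U₀ = (k) has degree 0, and U₁, …, Uₙ account for all the caesuras.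
  have hsum := sum_cutDegrees k (k :: u)
  rw [cutDegrees, if_pos rfl, List.singleton_append, List.sum_cons, zero_add] at hsum
  rw [rawComp_eq h k (k :: u) (y :: v) 0, rawComp_eq h k u (y :: v) 0,
    rawComp_eq h k (k :: u) v (0 + if y ∈ v then 1 else 0), List.count_cons_self, linesFrom,
    splittings_cons, List.map_append, List.sum_append, map_list_sum, map_list_sum,
    zsmul_list_sum]
  simp only [List.map_map]
  refine congrArg₂ _ (congrArg _ (List.map_congr_left fun cs _ => ?_))
    (congrArg _ (List.map_congr_left fun cs hcs => ?_))
  · simp [cutDegrees, insertionExponent, substitute, componentDegree]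
  · obtain ⟨c, cs, rfl, hc1, hc2⟩ := exists_of_mem_splittings hcs
    have hc3 : c = [] → v = [] := by
      intro hc
      have := hc2 hc
      cases v with
      | nil => rfl
      | cons z v => simp [linesFrom] at this
    simp only [Function.comp_apply, consHead, List.headD_cons, List.tail_cons, List.map_cons,
      cutDegrees, if_true, List.nil_append, insertionExponent, componentDegree_cons hc1 hc3,
      hsum, substitute, dif_pos, List.cons_append, map_zsmul, consMap_single, smul_smul]
    congr 1
    rw [← pow_add]
    congr 1
    split_ifs <;> ring

theorem rawComp_induction {P : List (Fin r) → List (Fin s) → Prop} (k : Fin r)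
    (nil : ∀ v, P [] v) (cons_ne : ∀ x u v, x ≠ k → P u v → P (x :: u) v)
    (cons_nil : ∀ u, P (k :: u) [])
    (cons_cons : ∀ u y v, P u (y :: v) → P (k :: u) v → P (k :: u) (y :: v))
    (u : List (Fin r)) (v : List (Fin s)) : P u v := by
  induction u generalizing v with
  | nil => exact nil v
  | cons x u ih =>
    by_cases hx : x = k
    · subst hx
      induction v with
      | nil => exact cons_nil u
      | cons y v ihv => exact cons_cons u y v (ih _) ihv
    · exact cons_ne x u v hx (ih v)

theorem substitute_nil (h : n + 1 = r + s) (k : Fin r) (u : List (Fin r)) :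
    substitute h k u ([] : List (List (Fin s))) = u.flatMap (expandTerm h k []) := by
  induction u with
  | nil => simp [substitute]
  | cons x u ih =>
    by_cases hx : x = k
    · subst hx
      simp [substitute, ih, expandTerm_self]
    · simp [substitute, hx, ih, expandTerm_ne]

theorem not_isChain_substitute (h : n + 1 = r + s) {k : Fin r} {u : List (Fin r)} (hk : k ∉ u)
    (hu : ¬ u.IsChain (· ≠ ·)) :
    ¬ (substitute h k u ([] : List (List (Fin s)))).IsChain (· ≠ ·) := by
  induction u with
  | nil => simp at hu
  | cons x u ih =>
    rw [List.mem_cons, not_or] at hk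
    rw [substitute, dif_neg (Ne.symm hk.1)]
    by_cases hc : u.IsChain (· ≠ ·)
    · cases u with
      | nil => simp at hu
      | cons y u =>
        have hxy : x = y := by
          by_contra hne
          exact hu (List.isChain_cons_cons.2 ⟨hne, hc⟩)
        subst hxy
        rw [substitute, dif_neg (Ne.symm hk.1)]
        simp
    · exact fun h' => ih hk.2 hc h'.tail

/-- If `u` starts with k, k and the first component is (y), then the second component also starts
with `y`. If the first component is longer, induction on `v` applies. -/
theorem rawComp_mem_degenerate_left (h : n + 1 = r + s) (k : Fin r) {u : List (Fin r)}
    (hu : ¬ u.IsChain (· ≠ ·)) (v : List (Fin s)) : rawComp F h k u v ∈ degenerate F (Fin n) := by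
  induction u, v using rawComp_induction k with
  | nil v => simp at hu
  | cons_ne x u v hx ih =>
    rw [rawComp_cons_of_ne h hx]
    by_cases hc : u.IsChain (· ≠ ·)
    · cases u with
      | nil => simp at hu
      | cons y u =>
        have hxy : x = y := by
          by_contra hne
          exact hu (List.isChain_cons_cons.2 ⟨hne, hc⟩)
        subst hxy
        rw [rawComp_cons_of_ne h hx]
        exact consMap_consMap_mem_degenerate _ _
    · exact consMap_mem_degenerate _ (ih hc)
  | cons_nil u =>
    rw [rawComp_cons_nil]
    split_ifs with hk
    · simp
    · refine single_mem_degenerate (not_isChain_substitute h hk fun hc => hu ?_)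
      rw [List.isChain_cons]
      refine ⟨?_, hc⟩
      rintro z hz rfl
      exact hk (List.mem_of_mem_head? hz)
  | cons_cons u y v ih1 ih2 =>
    rw [rawComp_cons_cons]
    refine Submodule.add_mem _ ?_ (sign_smul_mem _ (consMap_mem_degenerate _ (ih2 hu)))
    by_cases hc : u.IsChain (· ≠ ·)
    · cases u with
      | nil => simp at hu
      | cons x u =>
        have hkx : k = x := by
          by_contra hne
          exact hu (List.isChain_cons_cons.2 ⟨hne, hc⟩)
        subst hkx
        rw [rawComp_cons_cons, map_add, map_zsmul]
        exact Submodule.add_mem _ (consMap_consMap_mem_degenerate _ _)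
          (sign_smul_mem _ (consMap_consMap_mem_degenerate _ _))
    · exact consMap_mem_degenerate _ (ih1 hc)

/-- If `v` starts with y, y, then extending the first component beyond `y` writes `y` twice;
stopping at `y` leaves all of `v` for a shorter `u`. -/
theorem rawComp_mem_degenerate_right (h : n + 1 = r + s) (k : Fin r) (u : List (Fin r))
    {v : List (Fin s)} (hv : ¬ v.IsChain (· ≠ ·)) :
    rawComp F h k u v ∈ degenerate F (Fin n) := by
  induction u, v using rawComp_induction k with
  | nil v => simp
  | cons_ne x u v hx ih =>
    rw [rawComp_cons_of_ne h hx]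
    exact consMap_mem_degenerate _ (ih hv)
  | cons_nil u => simp at hv
  | cons_cons u y v ih1 ih2 =>
    rw [rawComp_cons_cons]
    refine Submodule.add_mem _ (consMap_mem_degenerate _ (ih1 hv)) (sign_smul_mem _ ?_)
    by_cases hc : v.IsChain (· ≠ ·)
    · cases v with
      | nil => simp at hv
      | cons z v =>
        have hyz : y = z := by
          by_contra hne
          exact hv (List.isChain_cons_cons.2 ⟨hne, hc⟩)
        subst hyz
        rw [rawComp_cons_cons, map_add, map_zsmul]
        exact Submodule.add_mem _ (consMap_consMap_mem_degenerate _ _)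
          (sign_smul_mem _ (consMap_consMap_mem_degenerate _ _))
    · exact consMap_mem_degenerate _ (ih2 hc)

/-- The values of a composite come from the values of the factors. -/
theorem rawComp_mem_supported (h : n + 1 = r + s) (k : Fin r) (u : List (Fin r))
    (v : List (Fin s)) : rawComp F h k u v ∈ Finsupp.supported F F {z : List (Fin n) |
      (∀ x hx, outerIndex h k x hx ∈ z → x ∈ u) ∧ ∀ y, innerIndex h k y ∈ z → y ∈ v} := by
  induction u, v using rawComp_induction k with
  | nil v => simp
  | cons_ne x u v hx ih =>
    rw [rawComp_cons_of_ne h hx]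
    refine map_mem_of_supported ?_ ih
    rintro z ⟨h1, h2⟩
    rw [consMap_single]
    refine Finsupp.single_mem_supported F 1 ⟨fun x' hx' hz => ?_, fun y hz => ?_⟩
    · rcases List.mem_cons.1 hz with hz | hz
      · rw [outerIndex_injective h hx' hx hz]; simp
      · exact List.mem_cons_of_mem _ (h1 x' hx' hz)
    · rcases List.mem_cons.1 hz with hz | hz
      · exact absurd hz.symm (outerIndex_ne_innerIndex h hx y)
      · exact h2 y hz
  | cons_nil u =>
    rw [rawComp_cons_nil]
    split_ifs with hk
    · simp
    · refine Finsupp.single_mem_supported F 1 ⟨fun x hx hz => ?_, fun y hz => ?_⟩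
      · rw [substitute_nil, List.mem_flatMap] at hz
        obtain ⟨x', hx', hz⟩ := hz
        have hne : x' ≠ k := by rintro rfl; exact hk hx'
        rw [expandTerm_ne h hne, List.mem_singleton] at hz
        rw [outerIndex_injective h hx hne hz]
        exact List.mem_cons_of_mem _ hx'
      · rw [substitute_nil, List.mem_flatMap] at hz
        obtain ⟨x', hx', hz⟩ := hz
        have hne : x' ≠ k := by rintro rfl; exact hk hx'
        rw [expandTerm_ne h hne, List.mem_singleton] at hz
        exact absurd hz.symm (outerIndex_ne_innerIndex h hne y)
  | cons_cons u y v ih1 ih2 =>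
    rw [rawComp_cons_cons]
    have hcons : ∀ {z : List (Fin n)} {x : Fin r} {hx : x ≠ k},
        outerIndex h k x hx ∈ innerIndex h k y :: z → outerIndex h k x hx ∈ z := by
      intro z x hx hz
      rcases List.mem_cons.1 hz with hz | hz
      · exact absurd hz (outerIndex_ne_innerIndex h hx y)
      · exact hz
    refine Submodule.add_mem _ (map_mem_of_supported ?_ ih1)
      (sign_smul_mem _ (map_mem_of_supported ?_ ih2))
    · rintro z ⟨h1, h2⟩
      rw [consMap_single]
      refine Finsupp.single_mem_supported F 1 ⟨fun x' hx' hz => ?_, fun y' hz => ?_⟩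
      · exact List.mem_cons_of_mem _ (h1 x' hx' (hcons hz))
      · rcases List.mem_cons.1 hz with hz | hz
        · rw [innerIndex_injective h k hz]; simp
        · exact h2 y' hz
    · rintro z ⟨h1, h2⟩
      rw [consMap_single]
      refine Finsupp.single_mem_supported F 1 ⟨fun x' hx' hz => ?_, fun y' hz => ?_⟩
      · exact h1 x' hx' (hcons hz)
      · rcases List.mem_cons.1 hz with hz | hz
        · rw [innerIndex_injective h k hz]; simp
        · exact List.mem_cons_of_mem _ (h2 y' hz)

/-! ### Bilinear extension of the recursions for composites -/

/-- The bilinear extension of `rawComp`. -/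
noncomputable def rawCompMap (h : n + 1 = r + s) (k : Fin r) :
    (List (Fin r) →₀ F) →ₗ[F] (List (Fin s) →₀ F) →ₗ[F] (List (Fin n) →₀ F) :=
  Finsupp.linearCombination F fun u => Finsupp.linearCombination F fun v => rawComp F h k u v

@[simp] theorem rawCompMap_single (h : n + 1 = r + s) (k : Fin r) (u : List (Fin r))
    (v : List (Fin s)) :
    rawCompMap h k (Finsupp.single u (1 : F)) (Finsupp.single v 1) = rawComp F h k u v := by
  simp [rawCompMap]

/-- Two bilinear maps agree on the elements of given supports if they agree on the generators. -/
theorem eqOn_supported₂ {ι κ M : Type*} [AddCommGroup M] [Module F M] {s : Set ι} {t : Set κ}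
    {f g : (ι →₀ F) →ₗ[F] (κ →₀ F) →ₗ[F] M}
    (h : ∀ i ∈ s, ∀ j ∈ t, f (Finsupp.single i 1) (Finsupp.single j 1) =
      g (Finsupp.single i 1) (Finsupp.single j 1))
    {p : ι →₀ F} {q : κ →₀ F} (hp : p ∈ Finsupp.supported F F s)
    (hq : q ∈ Finsupp.supported F F t) : f p q = g p q := by
  refine eqOn_supported (f := f.flip q) (g := g.flip q) (fun i hi => ?_) hp
  exact eqOn_supported (f := f _) (g := g _) (fun j hj => h i hi j hj) hq

theorem rawCompMap_consMap_of_ne (h : n + 1 = r + s) {k x : Fin r} (hx : x ≠ k)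
    (U : List (Fin r) →₀ F) (V : List (Fin s) →₀ F) :
    rawCompMap h k (consMap x U) V = consMap (outerIndex h k x hx) (rawCompMap h k U V) := by
  refine eqOn_supported₂ (f := rawCompMap h k ∘ₗ consMap x)
    (g := (rawCompMap h k).compr₂ (consMap (outerIndex h k x hx))) (fun u _ v _ => ?_)
    (mem_supported_univ U) (mem_supported_univ V)
  simp [rawComp_cons_of_ne h hx]

theorem rawCompMap_consMap_consMap_of_notMem (h : n + 1 = r + s) {k : Fin r} {y : Fin s}
    (U : List (Fin r) →₀ F) {V : List (Fin s) →₀ F}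
    (hV : V ∈ Finsupp.supported F F {v : List (Fin s) | y ∉ v}) :
    rawCompMap h k (consMap k U) (consMap y V) =
      consMap (innerIndex h k y) (rawCompMap h k U (consMap y V)) +
        consMap (innerIndex h k y) (rawCompMap h k (consMap k U) V) := by
  refine eqOn_supported₂ (f := (rawCompMap h k).compl₁₂ (consMap k) (consMap y))
    (g := ((rawCompMap h k).compl₁₂ LinearMap.id (consMap y)).compr₂ (consMap (innerIndex h k y)) +
      ((rawCompMap h k).compl₁₂ (consMap k) LinearMap.id).compr₂ (consMap (innerIndex h k y)))
    (fun u _ v hv => ?_) (mem_supported_univ U) hV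
  have hv' : y ∉ v := hv
  simp [rawComp_cons_cons, hv']

/-- The number of caesuras is fixed on the left because it determines the sign of a caesura `y`. -/
theorem rawCompMap_consMap_consMap_of_mem (h : n + 1 = r + s) {k : Fin r} {y : Fin s} {d : ℕ}
    {U : List (Fin r) →₀ F} {V : List (Fin s) →₀ F}
    (hU : U ∈ Finsupp.supported F F {u : List (Fin r) | caesuraCount (k :: u) = d})
    (hV : V ∈ Finsupp.supported F F {v : List (Fin s) | y ∈ v}) :
    rawCompMap h k (consMap k U) (consMap y V) =
      consMap (innerIndex h k y) (rawCompMap h k U (consMap y V)) +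
        (-1 : ℤ) ^ d • consMap (innerIndex h k y) (rawCompMap h k (consMap k U) V) := by
  refine eqOn_supported₂ (f := (rawCompMap h k).compl₁₂ (consMap k) (consMap y))
    (g := ((rawCompMap h k).compl₁₂ LinearMap.id (consMap y)).compr₂ (consMap (innerIndex h k y)) +
      (-1 : ℤ) ^ d •
        ((rawCompMap h k).compl₁₂ (consMap k) LinearMap.id).compr₂ (consMap (innerIndex h k y)))
    (fun u hu v hv => ?_) hU hV
  have hv' : y ∈ v := hv
  have hu' : caesuraCount (k :: u) = d := hu
  simp [rawComp_cons_cons, hv', hu']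

theorem rawCompMap_of_notMem (h : n + 1 = r + s) {k : Fin r} {U : List (Fin r) →₀ F}
    (hU : U ∈ Finsupp.supported F F {u : List (Fin r) | k ∉ u}) (V : List (Fin s) →₀ F) :
    rawCompMap h k U V = 0 := by
  refine eqOn_supported₂ (f := rawCompMap h k) (g := 0) (fun u hu v _ => ?_) hU
    (mem_supported_univ V)
  have hu' : k ∉ u := hu
  simp [hu']

theorem rawCompMap_consMap_nil_of_mem (h : n + 1 = r + s) {k : Fin r} {U : List (Fin r) →₀ F}
    (hU : U ∈ Finsupp.supported F F {u : List (Fin r) | k ∈ u}) :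
    rawCompMap h k (consMap k U) (Finsupp.single ([] : List (Fin s)) 1) = 0 := by
  refine eqOn_supported (f := (rawCompMap h k).flip (Finsupp.single [] 1) ∘ₗ consMap k) (g := 0)
    (fun u hu => ?_) hU
  have hu' : k ∈ u := hu
  simp [rawComp_cons_nil, hu']

theorem rawCompMap_consMap_nil_of_notMem (h : n + 1 = r + s) {k : Fin r} {U : List (Fin r) →₀ F}
    (hU : U ∈ Finsupp.supported F F {u : List (Fin r) | k ∉ u}) :
    rawCompMap h k (consMap k U) (Finsupp.single ([] : List (Fin s)) 1) =
      Finsupp.lmapDomain F F (List.flatMap (expandTerm h k [])) U := by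
  refine eqOn_supported (f := (rawCompMap h k).flip (Finsupp.single [] 1) ∘ₗ consMap k)
    (g := Finsupp.lmapDomain F F (List.flatMap (expandTerm h k []))) (fun u hu => ?_) hU
  have hu' : k ∉ u := hu
  simp [rawComp_cons_nil, hu', substitute_nil]

end Composition

/-! ### Table reduction and composition products -/

section TablesComposition

variable {F : Type u} [CommRing F] {r s n : ℕ}

theorem consMap_smodEq {α : Type} (a : α) {z z' : List α →₀ F}
    (h : z ≡ z' [SMOD degenerate F α]) : consMap a z ≡ consMap a z' [SMOD degenerate F α] := by
  rw [SModEq.sub_mem] at h ⊢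
  rw [← map_sub]
  exact consMap_mem_degenerate a h

/-- Combines the recursions of tables and of paths: the row goes on after `x`, or it ends and the
path makes a horizontal or a vertical step. The single-vertex path contributes nothing to the second
part, since the empty simplex has no tables. -/
theorem rawTablesMap_shuffle_cons {α β : Type} {f : α → β → Equiv.Perm (Fin n)} {a : α} {b : β}
    {Z l : List (Fin n)} {x : Fin n} (hZ : (word (f a b)).filter (· ∉ Z) = x :: l) (A : List α)
    (B : List β) : rawTablesMap Z (shuffle F f (a :: A) (b :: B)) =
      consMap x (rawTablesMap (Z ++ [x]) (shuffle F f (a :: A) (b :: B))) +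
      consMap x (rawTablesMap Z (shuffle F f A (b :: B)) +
        (-1 : ℤ) ^ A.length • rawTablesMap Z (shuffle F f (a :: A) B)) := by
  rw [shuffle_cons, rawTablesMap_consMap_of_filter_eq_cons hZ]
  simp only [map_add, map_zsmul, rawTablesMap_single_nil, add_zero]

/-- The point is that the right-hand side does not involve `b`: the terms that are left do not
change along vertical segments. -/
theorem filter_word_permComp_of_exhausted (h : n + 1 = r + s) (k : Fin r)
    (a : Equiv.Perm (Fin r)) (b : Equiv.Perm (Fin s)) {Z : List (Fin n)}
    (hZ : ∀ j : Fin s, innerIndex h k j ∈ Z) :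
    (word (permComp h k a b)).filter (· ∉ Z) =
      ((word a).flatMap (expandTerm h k ([] : List (Fin s)))).filter (· ∉ Z) := by
  rw [word_permComp, List.filter_flatMap, List.filter_flatMap]
  refine List.flatMap_congr fun x _ => ?_
  by_cases hx : x = k
  · subst hx
    rw [expandTerm_self, expandTerm_self, List.filter_map, List.map_nil, List.filter_nil,
      List.map_eq_nil_iff, List.filter_eq_nil_iff]
    intro j _
    simp [hZ j]
  · rw [expandTerm_ne h hx, expandTerm_ne h hx]

/-- If all the values of the second factor are omitted, then a path with vertical segments yields
no non-degenerate table. -/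
theorem rawTablesMap_shuffle_of_exhausted (h : n + 1 = r + s) (k : Fin r)
    (A : List (Equiv.Perm (Fin r))) (b : Equiv.Perm (Fin s)) {B : List (Equiv.Perm (Fin s))}
    (hB : B ≠ []) {Z : List (Fin n)} (hZ : ∀ j : Fin s, innerIndex h k j ∈ Z) :
    rawTablesMap Z (shuffle F (permComp h k) A (b :: B)) ∈ degenerate F (Fin n) := by
  induction A generalizing Z with
  | nil => simp
  | cons a A ihA =>
    generalize hl : (word (permComp h k a b)).filter (· ∉ Z) = l
    induction l generalizing Z with
    | nil =>
      rw [shuffle_cons, rawTablesMap_consMap_of_filter_eq_nil hl]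
      simp [augment_shuffle, hB]
    | cons x l ih =>
      rw [shuffle_cons, rawTablesMap_consMap_of_filter_eq_cons hl, ← shuffle_cons]
      refine Submodule.add_mem _ (consMap_mem_degenerate _
        (ih (fun j => by simp [hZ j]) (filter_append_of_filter_eq_cons hl))) ?_
      simp only [map_add, map_zsmul, rawTablesMap_single_nil, add_zero]
      refine Submodule.add_mem _ (consMap_mem_degenerate _ (ihA hZ)) (sign_smul_mem _ ?_)
      cases B with
      | nil => exact absurd rfl hB
      | cons b' B =>
        rw [shuffle_cons]
        refine consMap_rawTablesMap_mem_degenerate (l := l) ?_ _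
        -- After a vertical segment the same terms are left, so the next row starts with `x` again.
        rw [filter_word_permComp_of_exhausted h k a b' hZ,
          ← filter_word_permComp_of_exhausted h k a b hZ, hl]

/-- Once all the inner values are used up, the block at `k` contributes no terms, as if `k` itself
were used up in the outer simplex. -/
theorem rawTables_map_permComp_of_exhausted (h : n + 1 = r + s) {k : Fin r}
    (A : List (Equiv.Perm (Fin r))) (b : Equiv.Perm (Fin s)) {S : List (Fin r)} {Z : List (Fin n)}
    (hS : ∀ x hx, outerIndex h k x hx ∈ Z ↔ x ∈ S) (hZ : ∀ j : Fin s, innerIndex h k j ∈ Z) :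
    rawTables F Z (A.map (permComp h k · b)) =
      Finsupp.lmapDomain F F (List.flatMap (expandTerm h k ([] : List (Fin s))))
        (rawTables F (S ++ [k]) A) := by
  have hne : ∀ x, x ∉ S ++ [k] → x ≠ k := by
    rintro x hx rfl
    simp at hx
  refine rawTables_flatMap _ (fun x hx => ⟨_, expandTerm_ne h (hne x hx) _⟩) ?_ ?_
  · intro x hx x' hx' hxx
    rw [expandTerm_ne h (hne x hx), expandTerm_ne h (hne x' hx'), List.singleton_inj] at hxx
    exact outerIndex_injective h _ _ hxx
  · rw [List.forall₂_map_right_iff, List.forall₂_same]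
    intro σ _
    rw [filter_word_permComp_of_exhausted h k σ b hZ, List.filter_flatMap, flatMap_filter]
    refine List.flatMap_congr fun x _ => ?_
    by_cases hx : x = k
    · subst hx
      simp [expandTerm_self]
    · rw [expandTerm_ne h hx]
      by_cases hxS : x ∈ S
      · simp [hxS, (hS x hx).2 hxS]
      · simp [hxS, hx, mt (hS x hx).1 hxS]

/-- Table reduction preserves composition products, up to degenerate sequences. -/
theorem rawTablesMap_shuffle_smodEq (h : n + 1 = r + s) (k : Fin r)
    (A : List (Equiv.Perm (Fin r))) (B : List (Equiv.Perm (Fin s))) {S : List (Fin r)}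
    {S' : List (Fin s)} {Z : List (Fin n)} (hk : k ∉ S)
    (hS : ∀ x hx, outerIndex h k x hx ∈ Z ↔ x ∈ S) (hS' : ∀ j, innerIndex h k j ∈ Z ↔ j ∈ S') :
    rawTablesMap Z (shuffle F (permComp h k) A B) ≡
      rawCompMap h k (rawTables F S A) (rawTables F S' B) [SMOD degenerate F (Fin n)] := by
  -- Four nested inductions: on the two simplices, and on the terms left in the first vertex of
  -- each.
  induction A generalizing S S' Z B with
  | nil => simp
  | cons a A ihA =>
    induction B generalizing S S' Z with
    | nil => simp
    | cons b B ihB =>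
      generalize hl : (word a).filter (· ∉ S) = l
      induction l generalizing S S' Z with
      -- The value `k` is never added to `S` in the course of the induction, so the outer word
      -- cannot be exhausted.
      | nil => exact absurd (mem_of_filter_eq_nil hl k) hk
      | cons x l ih =>
        by_cases hx : x = k
        · subst hx
          -- Where `k` has been used up it does not occur any more, and there is no place for an
          -- insertion.
          have hS1 : ∀ {U : List (Fin s) →₀ F}, rawCompMap h x (rawTables F (S ++ [x]) (a :: A)) U =
              (0 : List (Fin n) →₀ F) := fun {U} => rawCompMap_of_notMem h
            (Finsupp.supported_mono (fun u hu h => (hu.1 x).1 h (by simp))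
              (rawTables_mem_supported _ _)) U
          have hU := rawTables_of_filter_eq_cons (F := F) hl A
          rw [← map_add] at hU
          generalize hl' : (word b).filter (· ∉ S') = l'
          induction l' generalizing S' Z with
          | nil =>
            have hZ : ∀ j, innerIndex h x j ∈ Z := fun j =>
              (hS' j).2 (mem_of_filter_eq_nil hl' j)
            rw [rawTables_of_filter_eq_nil hl']
            by_cases hB : B = []
            -- All paths are horizontal here. On the side of surjections, the inserted sequence is
            -- finished, which selects the tables in which `k` does not occur again.
            · subst hB
              have h0 : rawTables F (S ++ [x]) (a :: A) ∈
                  Finsupp.supported F F {u : List (Fin r) | x ∉ u} :=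
                Finsupp.supported_mono (fun u hu h => (hu.1 x).1 h (by simp))
                  (rawTables_mem_supported _ _)
              have h1 : rawTables F S A ∈ Finsupp.supported F F {u : List (Fin r) | x ∈ u} :=
                Finsupp.supported_mono (fun u hu => (hu.1 x).2 hk) (rawTables_mem_supported _ _)
              rw [shuffle_singleton_right _ _ (by simp), rawTablesMap_single,
                rawTables_map_permComp_of_exhausted h _ b hS hZ, hU, map_add, map_add,
                LinearMap.add_apply, if_pos rfl, rawCompMap_consMap_nil_of_mem h h1,
                rawCompMap_consMap_nil_of_notMem h h0, add_zero]
            · rw [if_neg hB, Finsupp.single_zero, map_zero, SModEq.zero]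
              exact rawTablesMap_shuffle_of_exhausted h x _ b hB hZ
          | cons y l' ih' =>
            have hy : y ∉ S' := notMem_of_filter_eq_cons hl'
            have hZ : (word (permComp h x a b)).filter (· ∉ Z) = innerIndex h x y ::
                (l'.map (innerIndex h x) ++
                  l.flatMap (expandTerm h x ((word b).filter (· ∉ S')))) := by
              rw [filter_word_permComp h x a b hk hS hS', hl, List.flatMap_cons, expandTerm_self,
                hl', List.map_cons, List.cons_append]
            have i1 := ih' (S' := S' ++ [y]) (Z := Z ++ [innerIndex h x y])
              (fun x' hx' => by
                simp only [List.mem_append, List.mem_singleton, hS x' hx',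
                  outerIndex_ne_innerIndex h hx' y, or_false])
              (fun j => by
                simp only [List.mem_append, List.mem_singleton, hS' j,
                  (innerIndex_injective h x).eq_iff])
              (filter_append_of_filter_eq_cons hl')
            have i2 := ihA (b :: B) hk hS hS'
            have i3 := ihB hk hS hS'
            -- The signs are matched here: the `A.length` horizontal segments that a vertical
            -- segment passes are the caesuras of the outer surjection from `k` on.
            have hdeg : rawTables F (S ++ [x]) (a :: A) + rawTables F S A ∈ Finsupp.supported F F
                {u : List (Fin r) | caesuraCount (x :: u) = A.length} := by
              refine Submodule.add_mem _
                (Finsupp.supported_mono (fun u hu => ?_) (rawTables_mem_supported _ _))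
                (Finsupp.supported_mono (fun u hu => ?_) (rawTables_mem_supported _ _))
              · obtain ⟨h1, h2⟩ := hu
                have : x ∉ u := by rw [h1]; simp
                simpa [caesuraCount, this] using h2
              · obtain ⟨h1, h2⟩ := hu
                have : x ∈ u := by rw [h1]; exact hk
                simpa [caesuraCount, this] using h2
            have hV0 : rawTables F (S' ++ [y]) (b :: B) ∈
                Finsupp.supported F F {v : List (Fin s) | y ∉ v} :=
              Finsupp.supported_mono (fun u hu h => (hu.1 y).1 h (by simp))
                (rawTables_mem_supported _ _)
            have hV1 : rawTables F S' B ∈ Finsupp.supported F F {v : List (Fin s) | y ∈ v} :=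
              Finsupp.supported_mono (fun u hu => (hu.1 y).2 hy) (rawTables_mem_supported _ _)
            have hV := rawTables_of_filter_eq_cons (F := F) hl' B
            have e1 := rawCompMap_consMap_consMap_of_notMem h (k := x)
              (rawTables F (S ++ [x]) (a :: A) + rawTables F S A) hV0
            have e2 := rawCompMap_consMap_consMap_of_mem h (k := x) hdeg hV1
            rw [← hU] at e1 e2
            -- The insertion of `b :: B` is recombined from the tables in which `y` does not occur
            -- again and those in which it does; then `hS1` leaves only the tables where `k` is a
            -- caesura.
            have e3 : rawCompMap h x (rawTables F S (a :: A)) (rawTables F S' (b :: B)) =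
                consMap (innerIndex h x y)
                  (rawCompMap h x (rawTables F S (a :: A)) (rawTables F (S' ++ [y]) (b :: B))) +
                consMap (innerIndex h x y)
                  (rawCompMap h x (rawTables F S A) (rawTables F S' (b :: B)) +
                  (-1 : ℤ) ^ A.length •
                    rawCompMap h x (rawTables F S (a :: A)) (rawTables F S' B)) := by
              conv_lhs => rw [hV, map_add, e1, e2]
              simp only [hV, map_add, LinearMap.add_apply, hS1, map_zsmul, zero_add]
              abel
            rw [e3, rawTablesMap_shuffle_cons hZ]
            exact (consMap_smodEq _ i1).add (consMap_smodEq _ (i2.add (i3.zsmul _)))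
        · have hZ : ∀ b', (word (permComp h k a b')).filter (· ∉ Z) = outerIndex h k x hx ::
              l.flatMap (expandTerm h k ((word b').filter (· ∉ S'))) := by
            intro b'
            rw [filter_word_permComp h k a b' hk hS hS', hl, List.flatMap_cons, expandTerm_ne h hx,
              List.singleton_append]
          have i1 := ih (S := S ++ [x]) (S' := S') (Z := Z ++ [outerIndex h k x hx])
            (by simp [hk, Ne.symm hx])
            (fun x' hx' => by
              simp only [List.mem_append, List.mem_singleton, hS x' hx']
              refine or_congr Iff.rfl ⟨fun e => outerIndex_injective h _ _ e, ?_⟩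
              rintro rfl; rfl)
            (fun j => by
              simp only [List.mem_append, List.mem_singleton, hS' j,
                (outerIndex_ne_innerIndex h hx j).symm, or_false])
            (filter_append_of_filter_eq_cons hl)
          have i2 := ihA (b :: B) hk hS hS'
          rw [rawTablesMap_shuffle_cons (hZ b), rawTables_of_filter_eq_cons hl, map_add, map_zsmul,
            map_add, LinearMap.add_apply, rawCompMap_consMap_of_ne h hx,
            rawCompMap_consMap_of_ne h hx]
          refine (consMap_smodEq _ i1).add ?_
          -- The vertical step has no counterpart on the other side. It yields degenerate sequences,
          -- since the next vertex offers the same outer value first.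
          rw [← add_zero (consMap (outerIndex h k x hx)
            (rawCompMap h k (rawTables F S A) (rawTables F S' (b :: B))))]
          refine (consMap_smodEq _ i2).add ?_
          rw [SModEq.zero]
          refine sign_smul_mem _ ?_
          cases B with
          | nil => simp
          | cons b' B =>
            rw [shuffle_cons]
            exact consMap_rawTablesMap_mem_degenerate (hZ b') _

end TablesComposition

/-! ### A section of table reduction -/

section Section

variable {F : Type u} [CommRing F] {r : ℕ}

/-- The permutation with the given sequence of values, if there is one. -/
noncomputable def ofWord (l : List (Fin r)) : Equiv.Perm (Fin r) :=
  open Classical in if h : ∃ σ, word σ = l then h.choose else 1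

theorem word_ofWord {l : List (Fin r)} (hl : l.Nodup) (h : ∀ x, x ∈ l) : word (ofWord l) = l := by
  have := exists_word_eq hl h
  rw [ofWord, dif_pos this]
  exact this.choose_spec

/-- The values of a sequence, in the order of their first occurrences. -/
def firstOccurrences {α : Type} [DecidableEq α] : List α → List α
  | [] => []
  | x :: u => x :: (firstOccurrences u).filter (· ∉ [x])

theorem mem_firstOccurrences {α : Type} [DecidableEq α] {u : List α} {x : α} :
    x ∈ firstOccurrences u ↔ x ∈ u := by
  induction u with
  | nil => rfl
  | cons y u ih =>
    by_cases hxy : x = y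
    · simp [firstOccurrences, hxy]
    · simp [firstOccurrences, ih, hxy]

theorem nodup_firstOccurrences {α : Type} [DecidableEq α] (u : List α) :
    (firstOccurrences u).Nodup := by
  induction u with
  | nil => exact List.nodup_nil
  | cons y u ih =>
    rw [firstOccurrences, List.nodup_cons]
    exact ⟨by simp, ih.filter _⟩

/-- The simplex of the permutations that arise from a sequence `u`, where the values in `S` come
first: each permutation orders the other values by their next occurrences. -/
noncomputable def sectionSimplex : List (Fin r) → List (Fin r) → List (Equiv.Perm (Fin r))
  | S, [] => [ofWord S]
  | S, x :: u =>
    if x ∈ u then ofWord (S ++ firstOccurrences (x :: u)) :: sectionSimplex S u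
    else sectionSimplex (S ++ [x]) u

/-- The values of `u` are those that are not in `S`. -/
structure Complementary (S u : List (Fin r)) : Prop where
  nodup : S.Nodup
  mem_iff : ∀ x, x ∈ u ↔ x ∉ S

theorem Complementary.word_ofWord {S u : List (Fin r)} (h : Complementary S u) :
    word (ofWord (S ++ firstOccurrences u)) = S ++ firstOccurrences u := by
  refine TableReduction.word_ofWord ?_ fun x => ?_
  · rw [List.nodup_append]
    refine ⟨h.nodup, nodup_firstOccurrences u, ?_⟩
    rintro a ha b hb rfl
    exact (h.mem_iff a).1 (mem_firstOccurrences.1 hb) ha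
  · rw [List.mem_append, mem_firstOccurrences, h.mem_iff]
    tauto

theorem Complementary.filter {S u : List (Fin r)} (h : Complementary S u) :
    (S ++ firstOccurrences u).filter (· ∉ S) = firstOccurrences u := by
  rw [List.filter_append, List.filter_eq_nil_iff.2 (by simp), List.nil_append,
    List.filter_eq_self]
  intro a ha
  simpa using (h.mem_iff a).1 (mem_firstOccurrences.1 ha)

theorem Complementary.tail_of_mem {S u : List (Fin r)} {x : Fin r} (h : Complementary S (x :: u))
    (hx : x ∈ u) : Complementary S u := by
  refine ⟨h.nodup, fun y => ?_⟩
  rw [← h.mem_iff, List.mem_cons]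
  constructor
  · exact Or.inr
  · rintro (rfl | hy)
    · exact hx
    · exact hy

theorem Complementary.tail_of_notMem {S u : List (Fin r)} {x : Fin r}
    (h : Complementary S (x :: u)) (hx : x ∉ u) : Complementary (S ++ [x]) u := by
  have hxS : x ∉ S := (h.mem_iff x).1 (by simp)
  refine ⟨?_, fun y => ?_⟩
  · rw [List.nodup_append]
    refine ⟨h.nodup, by simp, ?_⟩
    rintro a ha b hb rfl
    rw [List.mem_singleton] at hb
    exact hxS (hb ▸ ha)
  · have := h.mem_iff y
    by_cases hyx : y = x
    · subst hyx
      simp [hx]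
    · simpa [hyx] using this

theorem firstOccurrences_cons_of_notMem {α : Type} [DecidableEq α] {x : α} {u : List α}
    (hx : x ∉ u) : firstOccurrences (x :: u) = x :: firstOccurrences u := by
  rw [firstOccurrences, List.filter_eq_self.2]
  intro a ha
  have : a ≠ x := by
    rintro rfl
    exact hx (mem_firstOccurrences.1 ha)
  simpa using this

/-- A term that is not a caesura adds no vertex: moving it into `S` leaves the order of the first
occurrences unchanged. -/
theorem exists_sectionSimplex_eq (S u : List (Fin r)) (h : Complementary S u) :
    ∃ ws, sectionSimplex S u = ofWord (S ++ firstOccurrences u) :: ws := by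
  induction u generalizing S with
  | nil => exact ⟨[], by simp [sectionSimplex, firstOccurrences]⟩
  | cons x u ih =>
    rw [sectionSimplex]
    split_ifs with hx
    · exact ⟨_, rfl⟩
    · obtain ⟨ws, hws⟩ := ih _ (h.tail_of_notMem hx)
      refine ⟨ws, ?_⟩
      rw [hws, firstOccurrences_cons_of_notMem hx, List.append_assoc, List.singleton_append]

theorem prefix_word_of_mem_sectionSimplex {S u : List (Fin r)} (h : Complementary S u)
    {w : Equiv.Perm (Fin r)} (hw : w ∈ sectionSimplex S u) : S <+: word w := by
  induction u generalizing S with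
  | nil =>
    rw [sectionSimplex, List.mem_singleton] at hw
    have := h.word_ofWord
    rw [firstOccurrences, List.append_nil] at this
    rw [hw, this]
  | cons x u ih =>
    rw [sectionSimplex] at hw
    split_ifs at hw with hx
    · rcases List.mem_cons.1 hw with rfl | hw
      · rw [h.word_ofWord]
        exact List.prefix_append _ _
      · exact ih (h.tail_of_mem hx) hw
    · exact (List.prefix_append _ _).trans (ih (h.tail_of_notMem hx) hw)

/-- There is one vertex for each caesura and a final one, so the preimage of a surjection has the
right degree. -/
theorem length_sectionSimplex {S u : List (Fin r)} (h : Complementary S u) :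
    (sectionSimplex S u).length + r = u.length + S.length + 1 := by
  induction u generalizing S with
  | nil =>
    have := congrArg List.length h.word_ofWord
    rw [length_word, firstOccurrences, List.append_nil] at this
    simp only [sectionSimplex, List.length_cons, List.length_nil]
    omega
  | cons x u ih =>
    rw [sectionSimplex]
    split_ifs with hx
    · have := ih (h.tail_of_mem hx)
      simp only [List.length_cons]
      omega
    · have := ih (h.tail_of_notMem hx)
      simp only [List.length_append, List.length_cons, List.length_nil] at this ⊢
      omega

/-- `sectionSimplex` is a section of table reduction, up to degenerate sequences. -/
theorem rawTables_sectionSimplex {S u : List (Fin r)} (h : Complementary S u) :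
    rawTables F S (sectionSimplex S u) ≡ Finsupp.single u 1 [SMOD degenerate F (Fin r)] := by
  induction u generalizing S with
  | nil =>
    have hw := h.word_ofWord
    have hf := h.filter
    rw [← hw, firstOccurrences, List.append_nil] at hf
    rw [sectionSimplex, rawTables_of_filter_eq_nil hf, if_pos rfl]
  | cons x u ih =>
    have hxS : x ∉ S := (h.mem_iff x).1 (by simp)
    have hf := h.filter
    rw [← h.word_ofWord] at hf
    rw [← add_zero (Finsupp.single (x :: u) 1), sectionSimplex]
    split_ifs with hx
    -- If `x` is a caesura, the table that ends its row at `x` is the wanted one. If the row goes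
    -- on, then without `x` the first two vertices have the same terms left, and the result is
    -- degenerate.
    · have h' := h.tail_of_mem hx
      rw [rawTables_of_filter_eq_cons hf, add_comm, ← consMap_single x u 1]
      refine (consMap_smodEq x (ih h')).add ?_
      rw [SModEq.zero]
      obtain ⟨ws, hws⟩ := exists_sectionSimplex_eq S u h'
      rw [hws]
      refine consMap_mem_degenerate x (rawTables_mem_degenerate_of_filter_eq ?_ ws)
      have hf' := h'.filter
      rw [← h'.word_ofWord] at hf'
      rw [filter_notMem_append, filter_notMem_append, hf, hf', firstOccurrences, List.filter_cons]
      simp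
    -- If `x` does not occur again, the row has to go on. All later vertices keep `S ++ [x]` as a
    -- prefix, so ending the row at `x` makes the next row repeat it.
    · have h' := h.tail_of_notMem hx
      have hi := ih h'
      obtain ⟨ws, hws⟩ := exists_sectionSimplex_eq _ u h'
      rw [hws] at hi ⊢
      have hs : S ++ [x] ++ firstOccurrences u = S ++ firstOccurrences (x :: u) := by
        rw [firstOccurrences_cons_of_notMem hx, List.append_assoc, List.singleton_append]
      rw [hs] at hi hws ⊢
      rw [rawTables_of_filter_eq_cons hf, ← consMap_single x u 1]
      refine (consMap_smodEq x hi).add ?_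
      rw [SModEq.zero]
      cases ws with
      | nil => simp
      | cons w ws =>
        obtain ⟨l, hl⟩ := prefix_word_of_mem_sectionSimplex h' (w := w) (by simp [hws])
        refine consMap_rawTables_mem_degenerate (l := l.filter (· ∉ S)) ?_ ws
        rw [← hl, List.filter_append, List.filter_append, List.filter_eq_nil_iff.2 (by simp)]
        simp [hxS]

end Section

/-! ### Transfer of operad structures -/

section Transfer

theorem negOnePow_smul {M : Type*} [AddCommGroup M] (d : ℕ) (x : M) :
    (d : ℤ).negOnePow • x = (-1 : ℤ) ^ d • x := by
  rw [Units.smul_def, Int.negOnePow_def, zpow_natCast, Units.val_pow_eq_pow_val]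
  rfl

theorem map_negOnePow_smul {F M N : Type*} [CommRing F] [AddCommGroup M] [AddCommGroup N]
    [Module F M] [Module F N] (f : M →ₗ[F] N) (d : ℤ) (x : M) :
    f (d.negOnePow • x) = d.negOnePow • f x := by
  rw [Units.smul_def, Units.smul_def, map_zsmul]

theorem isInternal_supported (F : Type u) [CommRing F] {ι : Type} (f : ι → ℤ) :
    DirectSum.IsInternal fun d : ℤ => Finsupp.supported F F {i : ι | f i = d} := by
  rw [DirectSum.isInternal_submodule_iff_iSupIndep_and_iSup_eq_top]
  constructor
  · rw [iSupIndep_def]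
    intro d
    have : ⨆ e, ⨆ (_ : e ≠ d), Finsupp.supported F F {i : ι | f i = e} ≤
        Finsupp.supported F F {i : ι | f i ≠ d} := by
      refine iSup₂_le fun e he => Finsupp.supported_mono ?_
      rintro i rfl
      exact he
    refine Disjoint.mono_right this (Finsupp.disjoint_supported_supported ?_)
    rw [Set.disjoint_left]
    intro i h1 h2
    exact h2 h1
  · rw [← Finsupp.supported_iUnion, show (⋃ d : ℤ, {i : ι | f i = d}) = Set.univ by ext; simp]
    exact Finsupp.supported_univ

variable {F : Type u} [CommRing F] {P Q R : DGOperadData F}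

/-- The laws of a dg-operad pass to quotients. -/
theorem isDGOperad_of_surjective (hP : IsDGOperad P) {f : ∀ r, P.carrier r →ₗ[F] Q.carrier r}
    (hf : IsDGOperadHom P Q f) (hsurj : ∀ r, Function.Surjective (f r))
    (lift : ∀ r d, ∀ q ∈ Q.deg r d, ∃ p ∈ P.deg r d, f r p = q)
    (hQ : ∀ r, DirectSum.IsInternal (Q.deg r)) : IsDGOperad Q where
  isInternal := hQ
  diff_mem r d x hx := by
    obtain ⟨p, hp, rfl⟩ := lift r d x hx
    rw [← hf.map_diff]
    exact hf.map_mem _ _ _ (hP.diff_mem _ _ _ hp)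
  diff_diff r x := by
    obtain ⟨p, rfl⟩ := hsurj r x
    rw [← hf.map_diff, ← hf.map_diff, hP.diff_diff, map_zero]
  act_one r x := by
    obtain ⟨p, rfl⟩ := hsurj r x
    rw [← hf.map_act, hP.act_one]
  act_mul r σ τ x := by
    obtain ⟨p, rfl⟩ := hsurj r x
    rw [← hf.map_act, ← hf.map_act, ← hf.map_act, hP.act_mul]
  act_mem r σ d x hx := by
    obtain ⟨p, hp, rfl⟩ := lift r d x hx
    rw [← hf.map_act]
    exact hf.map_mem _ _ _ (hP.act_mem _ _ _ _ hp)
  diff_act r σ x := by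
    obtain ⟨p, rfl⟩ := hsurj r x
    rw [← hf.map_act, ← hf.map_diff, ← hf.map_diff, ← hf.map_act, hP.diff_act]
  one_mem := by
    rw [← hf.map_one]
    exact hf.map_mem _ _ _ hP.one_mem
  diff_one := by rw [← hf.map_one, ← hf.map_diff, hP.diff_one, map_zero]
  comp_mem h k d e p q hp hq := by
    obtain ⟨p', hp', rfl⟩ := lift _ _ _ hp
    obtain ⟨q', hq', rfl⟩ := lift _ _ _ hq
    rw [← hf.map_comp]
    exact hf.map_mem _ _ _ (hP.comp_mem h k d e p' q' hp' hq')
  -- Signs depend on degrees, so here a homogeneous preimage of `p` is needed and not just any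
  -- preimage.
  diff_comp h k d p q hp := by
    obtain ⟨p', hp', rfl⟩ := lift _ _ _ hp
    obtain ⟨q, rfl⟩ := hsurj _ q
    rw [← hf.map_comp, ← hf.map_diff, hP.diff_comp h k d p' q hp', ← hf.map_diff, ← hf.map_diff,
      ← hf.map_comp, ← hf.map_comp, map_add, map_negOnePow_smul]
  one_comp h q := by
    obtain ⟨q, rfl⟩ := hsurj _ q
    rw [← hf.map_one, ← hf.map_comp, hP.one_comp]
  comp_one h k p := by
    obtain ⟨p, rfl⟩ := hsurj _ p
    rw [← hf.map_one, ← hf.map_comp, hP.comp_one]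
  comp_assoc hm hl hn hl' i j p q x := by
    obtain ⟨p, rfl⟩ := hsurj _ p
    obtain ⟨q, rfl⟩ := hsurj _ q
    obtain ⟨x, rfl⟩ := hsurj _ x
    rw [← hf.map_comp, ← hf.map_comp, ← hf.map_comp, ← hf.map_comp,
      hP.comp_assoc hm hl hn hl' i j]
  comp_comm hm hl hn hl' i k hik d e p q x hq hx := by
    obtain ⟨p, rfl⟩ := hsurj _ p
    obtain ⟨q', hq', rfl⟩ := lift _ _ _ hq
    obtain ⟨x', hx', rfl⟩ := lift _ _ _ hx
    rw [← hf.map_comp, ← hf.map_comp, ← hf.map_comp, ← hf.map_comp,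
      hP.comp_comm hm hl hn hl' i k hik d e p q' x' hq' hx', map_negOnePow_smul]
  equivariant h k σ τ p q := by
    obtain ⟨p, rfl⟩ := hsurj _ p
    obtain ⟨q, rfl⟩ := hsurj _ q
    rw [← hf.map_comp, ← hf.map_act, ← hf.map_act, ← hf.map_comp, ← hf.map_act,
      hP.equivariant h k]

/-- The laws of a dg-operad pass to suboperads. -/
theorem isDGOperad_of_injective (hQ : IsDGOperad Q) {f : ∀ r, P.carrier r →ₗ[F] Q.carrier r}
    (hf : IsDGOperadHom P Q f) (hinj : ∀ r, Function.Injective (f r))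
    (hdeg : ∀ r d p, f r p ∈ Q.deg r d → p ∈ P.deg r d)
    (hP : ∀ r, DirectSum.IsInternal (P.deg r)) : IsDGOperad P where
  isInternal := hP
  diff_mem r d x hx := hdeg _ _ _ (by
    rw [hf.map_diff]; exact hQ.diff_mem _ _ _ (hf.map_mem _ _ _ hx))
  diff_diff r x := hinj _ (by rw [hf.map_diff, hf.map_diff, hQ.diff_diff, map_zero])
  act_one r x := hinj _ (by rw [hf.map_act, hQ.act_one])
  act_mul r σ τ x := hinj _ (by rw [hf.map_act, hf.map_act, hf.map_act, hQ.act_mul])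
  act_mem r σ d x hx := hdeg _ _ _ (by
    rw [hf.map_act]; exact hQ.act_mem _ _ _ _ (hf.map_mem _ _ _ hx))
  diff_act r σ x := hinj _ (by
    rw [hf.map_act, hf.map_diff, hf.map_diff, hf.map_act, hQ.diff_act])
  one_mem := hdeg _ _ _ (by rw [hf.map_one]; exact hQ.one_mem)
  diff_one := hinj _ (by rw [hf.map_diff, hf.map_one, hQ.diff_one, map_zero])
  comp_mem h k d e p q hp hq := hdeg _ _ _ (by
    rw [hf.map_comp]
    exact hQ.comp_mem h k d e _ _ (hf.map_mem _ _ _ hp) (hf.map_mem _ _ _ hq))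
  diff_comp h k d p q hp := hinj _ (by
    rw [hf.map_diff, hf.map_comp, hQ.diff_comp h k d _ _ (hf.map_mem _ _ _ hp), map_add,
      map_negOnePow_smul, hf.map_comp, hf.map_comp, hf.map_diff, hf.map_diff])
  one_comp h q := hinj _ (by rw [hf.map_comp, hf.map_one, hQ.one_comp])
  comp_one h k p := hinj _ (by rw [hf.map_comp, hf.map_one, hQ.comp_one])
  comp_assoc hm hl hn hl' i j p q x := hinj _ (by
    rw [hf.map_comp, hf.map_comp, hf.map_comp, hf.map_comp, hQ.comp_assoc hm hl hn hl' i j])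
  comp_comm hm hl hn hl' i k hik d e p q x hq hx := hinj _ (by
    rw [hf.map_comp, hf.map_comp, map_negOnePow_smul, hf.map_comp, hf.map_comp,
      hQ.comp_comm hm hl hn hl' i k hik d e _ _ _ (hf.map_mem _ _ _ hq) (hf.map_mem _ _ _ hx)])
  equivariant h k σ τ p q := hinj _ (by
    rw [hf.map_comp, hf.map_act, hf.map_act, hf.map_act, hf.map_comp, hQ.equivariant h k])

theorem isDGOperadHom_comp {f : ∀ r, P.carrier r →ₗ[F] Q.carrier r}
    {g : ∀ r, Q.carrier r →ₗ[F] R.carrier r} (hg : IsDGOperadHom Q R g)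
    (hf : IsDGOperadHom P Q f) : IsDGOperadHom P R fun r => g r ∘ₗ f r where
  map_mem r d x hx := hg.map_mem _ _ _ (hf.map_mem _ _ _ hx)
  map_diff r x := by simp only [LinearMap.comp_apply, hf.map_diff, hg.map_diff]
  map_act r σ x := by simp only [LinearMap.comp_apply, hf.map_act, hg.map_act]
  map_one := by simp only [LinearMap.comp_apply, hf.map_one, hg.map_one]
  map_comp h k p q := by simp only [LinearMap.comp_apply, hf.map_comp, hg.map_comp]

end Transfer

/-! ### The Barratt-Eccles operad -/

section BarrattEccles

variable {F : Type u} [CommRing F] {r s t n m l : ℕ}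

/-- The class of a linear combination of simplices in the normalized complex. -/
noncomputable def beClassMap : (List (Equiv.Perm (Fin r)) →₀ F) →ₗ[F] (BEGen r →₀ F) :=
  Finsupp.linearCombination F (beClass F)

@[simp] theorem beClassMap_single (w : List (Equiv.Perm (Fin r))) :
    beClassMap (Finsupp.single w (1 : F)) = beClass F w := by
  simp [beClassMap]

@[simp] theorem beClassMap_single_nil (c : F) :
    beClassMap (Finsupp.single ([] : List (Equiv.Perm (Fin r))) c) = 0 := by
  simp [beClassMap, beClass]

theorem single_eq_beClass (w : BEGen r) : Finsupp.single w (1 : F) = beClass F w.1 := by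
  rw [beClass, dif_pos w.2]

@[simp] theorem beClass_nil : beClass F ([] : List (Equiv.Perm (Fin r))) = 0 := by
  simp [beClass]

theorem beClass_of_not_isChain {w : List (Equiv.Perm (Fin r))} (hw : ¬ w.IsChain (· ≠ ·)) :
    beClass F w = 0 :=
  dif_neg fun h => hw h.2

theorem beClassMap_of_mem_degenerate {z : List (Equiv.Perm (Fin r)) →₀ F}
    (hz : z ∈ degenerate F (Equiv.Perm (Fin r))) : beClassMap z = 0 := by
  refine eqOn_supported (f := beClassMap) (g := 0) (fun w hw => ?_) hz
  rw [beClassMap_single, beClass_of_not_isChain hw]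
  rfl

theorem beClassMap_mem_supported {z : List (Equiv.Perm (Fin r)) →₀ F} {d : ℕ}
    (hz : z ∈ ofLength F (Equiv.Perm (Fin r)) d) :
    beClassMap z ∈ Finsupp.supported F F {w : BEGen r | w.1.length = d} := by
  refine map_mem_of_supported (fun w hw => ?_) hz
  rw [beClassMap_single, beClass]
  split_ifs with h
  · exact Finsupp.single_mem_supported F 1 hw
  · simp

/-- A proof principle for the homogeneous elements of the Barratt-Eccles operad. -/
theorem beGen_induction {P : (BEGen r →₀ F) → Prop} {d : ℤ}
    (zero : P 0) (add : ∀ p q, P p → P q → P (p + q)) (smul : ∀ (c : F) p, P p → P (c • p))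
    (beClass : ∀ w : List (Equiv.Perm (Fin r)), (w.length : ℤ) - 1 = d → w ≠ [] →
      P (beClass F w)) {p : BEGen r →₀ F}
    (hp : p ∈ Finsupp.supported F F {w : BEGen r | (w.1.length : ℤ) - 1 = d}) : P p :=
  supported_induction zero add smul (fun w hw => by
    rw [single_eq_beClass]; exact beClass w.1 hw w.2.1) hp

theorem beClassMap_surjective :
    Function.Surjective (beClassMap : (List (Equiv.Perm (Fin r)) →₀ F) →ₗ[F] (BEGen r →₀ F)) := by
  intro p
  refine supported_induction (P := fun p => ∃ z, beClassMap z = p) ⟨0, map_zero _⟩ ?_ ?_ ?_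
    (mem_supported_univ p)
  · rintro _ _ ⟨z, rfl⟩ ⟨z', rfl⟩
    exact ⟨z + z', map_add _ _ _⟩
  · rintro c _ ⟨z, rfl⟩
    exact ⟨c • z, map_smul _ _ _⟩
  · intro w _
    exact ⟨Finsupp.single w.1 1, by rw [beClassMap_single, single_eq_beClass]⟩

/-- The differential of the Barratt-Eccles operad. -/
noncomputable def beDiffMap : (BEGen r →₀ F) →ₗ[F] (BEGen r →₀ F) :=
  Finsupp.linearCombination F fun w => beDiff F w.1

/-- The action of the symmetric group on the Barratt-Eccles operad. -/
noncomputable def beActMap (σ : Equiv.Perm (Fin r)) : (BEGen r →₀ F) →ₗ[F] (BEGen r →₀ F) :=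
  Finsupp.linearCombination F fun w => beClass F (w.1.map (σ * ·))

/-- The composition products of the Barratt-Eccles operad. -/
noncomputable def beCompMap (h : n + 1 = r + s) (k : Fin r) :
    (BEGen r →₀ F) →ₗ[F] (BEGen s →₀ F) →ₗ[F] (BEGen n →₀ F) :=
  Finsupp.linearCombination F fun u => Finsupp.linearCombination F fun v => beComp F h k u.1 v.1

/-- For degenerate simplices both sides vanish, by `faces_mem_degenerate`. Afterwards all identities
can be checked without a choice of non-degenerate representatives. -/
theorem beDiffMap_beClass (w : List (Equiv.Perm (Fin r))) :
    beDiffMap (beClass F w) = beClassMap (faces w) := by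
  by_cases hw : w ≠ [] ∧ w.IsChain (· ≠ ·)
  · rw [beClass, dif_pos hw, beDiffMap, linearCombination_one, faces_eq_sum, beDiff, map_sum]
    refine Finset.sum_congr rfl fun i _ => ?_
    rw [map_zsmul, beClassMap_single]
  · rw [beClass, dif_neg hw, map_zero]
    rw [not_and_or, not_not] at hw
    rcases hw with rfl | hw
    · simp [faces]
    · rw [beClassMap_of_mem_degenerate (faces_mem_degenerate hw)]

theorem beDiffMap_beClassMap (z : List (Equiv.Perm (Fin r)) →₀ F) :
    beDiffMap (beClassMap z) = beClassMap (facesMap z) := by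
  refine eqOn_supported (f := beDiffMap ∘ₗ beClassMap) (g := beClassMap ∘ₗ facesMap)
    (fun w _ => ?_) (mem_supported_univ z)
  simp [beDiffMap_beClass]

theorem isChain_map_iff {α β : Type} {f : α → β} (hf : Function.Injective f) (l : List α) :
    (l.map f).IsChain (· ≠ ·) ↔ l.IsChain (· ≠ ·) := by
  simp only [List.isChain_map, ne_eq, hf.eq_iff]

theorem beActMap_beClass (σ : Equiv.Perm (Fin r)) (w : List (Equiv.Perm (Fin r))) :
    beActMap σ (beClass F w) = beClass F (w.map (σ * ·)) := by
  by_cases hw : w ≠ [] ∧ w.IsChain (· ≠ ·)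
  · rw [beClass, dif_pos hw, beActMap, linearCombination_one]
  · rw [beClass, dif_neg hw, map_zero, beClass, dif_neg]
    rwa [isChain_map_iff (mul_right_injective σ), ne_eq, List.map_eq_nil_iff]

theorem beComp_eq (h : n + 1 = r + s) (k : Fin r) (u : List (Equiv.Perm (Fin r)))
    (v : List (Equiv.Perm (Fin s))) :
    beComp F h k u v = beClassMap (shuffle F (permComp h k) u v) := by
  rw [beComp, shuffle, map_list_sum, List.map_map]
  congr 1
  refine List.map_congr_left fun t _ => ?_
  rw [Function.comp_apply, map_zsmul, beClassMap_single]

/-- The shuffle product of a degenerate simplex with any other is degenerate, on either side, so the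
formula extends to all simplices. -/
theorem beCompMap_beClass (h : n + 1 = r + s) (k : Fin r) (u : List (Equiv.Perm (Fin r)))
    (v : List (Equiv.Perm (Fin s))) : beCompMap h k (beClass F u) (beClass F v) =
      beClassMap (shuffle F (permComp h k) u v) := by
  by_cases hu : u ≠ [] ∧ u.IsChain (· ≠ ·)
  · by_cases hv : v ≠ [] ∧ v.IsChain (· ≠ ·)
    · rw [beClass, dif_pos hu, beClass, dif_pos hv, ← beComp_eq]
      simp [beCompMap]
    · rw [beClass.eq_def F v, dif_neg hv, map_zero]
      rw [not_and_or, not_not] at hv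
      rcases hv with rfl | hv
      · simp
      · rw [beClassMap_of_mem_degenerate (shuffle_mem_degenerate_right _ _ hv)]
  · rw [beClass.eq_def F u, dif_neg hu, map_zero, LinearMap.zero_apply]
    rw [not_and_or, not_not] at hu
    rcases hu with rfl | hu
    · simp
    · rw [beClassMap_of_mem_degenerate (shuffle_mem_degenerate_left _ hu _)]

theorem beCompMap_beClassMap (h : n + 1 = r + s) (k : Fin r)
    (z : List (Equiv.Perm (Fin r)) →₀ F) (z' : List (Equiv.Perm (Fin s)) →₀ F) :
    beCompMap h k (beClassMap z) (beClassMap z') =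
      beClassMap (shuffleMap (permComp h k) z z') := by
  refine eqOn_supported₂ (f := (beCompMap h k).compl₁₂ beClassMap beClassMap)
    (g := (shuffleMap (permComp h k)).compr₂ beClassMap)
    (fun u _ v _ => ?_) (mem_supported_univ z) (mem_supported_univ z')
  simp [beCompMap_beClass]

/-- A proof principle for the elements of the Barratt-Eccles operad. -/
theorem beClass_induction {P : (BEGen r →₀ F) → Prop}
    (zero : P 0) (add : ∀ p q, P p → P q → P (p + q)) (smul : ∀ (c : F) p, P p → P (c • p))
    (beClass : ∀ w : List (Equiv.Perm (Fin r)), w ≠ [] → P (beClass F w)) (p : BEGen r →₀ F) :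
    P p :=
  supported_induction zero add smul (fun w _ => by
    rw [single_eq_beClass]; exact beClass w.1 w.2.1) (mem_supported_univ p)

theorem beDiffMap_mem {d : ℤ} {p : BEGen r →₀ F}
    (hp : p ∈ Finsupp.supported F F {w : BEGen r | (w.1.length : ℤ) - 1 = d}) :
    beDiffMap p ∈ Finsupp.supported F F {w : BEGen r | (w.1.length : ℤ) - 1 = d - 1} := by
  refine beGen_induction (P := fun p => beDiffMap p ∈ _) (by simp) (fun p q hp hq => ?_)
    (fun c p hp => ?_) (fun w hw hne => ?_) hp
  · rw [map_add]; exact Submodule.add_mem _ hp hq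
  · rw [map_smul]; exact Submodule.smul_mem _ c hp
  · rw [beDiffMap_beClass]
    refine Finsupp.supported_mono ?_ (beClassMap_mem_supported (faces_mem_ofLength w))
    intro w' hw'
    have := List.length_pos_iff.2 hne
    simp only [Set.mem_ofPred_eq] at hw' ⊢
    omega

theorem beDiffMap_beDiffMap (p : BEGen r →₀ F) : beDiffMap (beDiffMap p) = 0 := by
  refine beClass_induction (P := fun p => beDiffMap (beDiffMap p) = 0) (by simp)
    (fun p q hp hq => by simp [hp, hq]) (fun c p hp => by simp [hp]) (fun w _ => ?_) p
  rw [beDiffMap_beClass, beDiffMap_beClassMap, facesMap_faces, map_zero]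

theorem beActMap_one (p : BEGen r →₀ F) : beActMap 1 p = p := by
  refine beClass_induction (P := fun p => beActMap 1 p = p) (by simp)
    (fun p q hp hq => by simp [hp, hq]) (fun c p hp => by simp [hp]) (fun w _ => ?_) p
  simp [beActMap_beClass]

theorem beActMap_mul (σ τ : Equiv.Perm (Fin r)) (p : BEGen r →₀ F) :
    beActMap (σ * τ) p = beActMap σ (beActMap τ p) := by
  refine beClass_induction (P := fun p => beActMap (σ * τ) p = beActMap σ (beActMap τ p)) (by simp)
    (fun p q hp hq => by simp [hp, hq]) (fun c p hp => by simp [hp]) (fun w _ => ?_) p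
  simp [beActMap_beClass, Function.comp_def, mul_assoc]

theorem beActMap_mem (σ : Equiv.Perm (Fin r)) {d : ℤ} {p : BEGen r →₀ F}
    (hp : p ∈ Finsupp.supported F F {w : BEGen r | (w.1.length : ℤ) - 1 = d}) :
    beActMap σ p ∈ Finsupp.supported F F {w : BEGen r | (w.1.length : ℤ) - 1 = d} := by
  refine beGen_induction (P := fun p => beActMap σ p ∈ _) (by simp) (fun p q hp hq => ?_)
    (fun c p hp => ?_) (fun w hw hne => ?_) hp
  · rw [map_add]; exact Submodule.add_mem _ hp hq
  · rw [map_smul]; exact Submodule.smul_mem _ c hp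
  · rw [beActMap_beClass, beClass]
    split_ifs
    · exact Finsupp.single_mem_supported F 1 (by simpa using hw)
    · simp

theorem faces_map {α β : Type} (f : α → β) (w : List α) :
    (faces (w.map f) : List β →₀ F) = Finsupp.lmapDomain F F (List.map f) (faces w) := by
  rw [faces_eq_sum, faces_eq_sum, map_sum, List.length_map]
  refine Finset.sum_congr rfl fun i _ => ?_
  rw [map_zsmul, List.eraseIdx_map]
  simp

theorem beActMap_beClassMap (σ : Equiv.Perm (Fin r)) (z : List (Equiv.Perm (Fin r)) →₀ F) :
    beActMap σ (beClassMap z) = beClassMap (Finsupp.lmapDomain F F (List.map (σ * ·)) z) := by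
  refine eqOn_supported (f := beActMap σ ∘ₗ beClassMap)
    (g := beClassMap ∘ₗ Finsupp.lmapDomain F F (List.map (σ * ·)))
    (fun w _ => ?_) (mem_supported_univ z)
  simp [beActMap_beClass]

theorem beDiffMap_beActMap (σ : Equiv.Perm (Fin r)) (p : BEGen r →₀ F) :
    beDiffMap (beActMap σ p) = beActMap σ (beDiffMap p) := by
  refine beClass_induction (P := fun p => beDiffMap (beActMap σ p) = beActMap σ (beDiffMap p))
    (by simp) (fun p q hp hq => by simp [hp, hq]) (fun c p hp => by simp [hp]) (fun w _ => ?_) p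
  rw [beActMap_beClass, beDiffMap_beClass, beDiffMap_beClass, beActMap_beClassMap, faces_map]

theorem beCompMap_mem (h : n + 1 = r + s) (k : Fin r) {d e : ℤ} {p : BEGen r →₀ F}
    {q : BEGen s →₀ F}
    (hp : p ∈ Finsupp.supported F F {w : BEGen r | (w.1.length : ℤ) - 1 = d})
    (hq : q ∈ Finsupp.supported F F {w : BEGen s | (w.1.length : ℤ) - 1 = e}) :
    beCompMap h k p q ∈
      Finsupp.supported F F {w : BEGen n | (w.1.length : ℤ) - 1 = d + e} := by
  refine beGen_induction (P := fun p => beCompMap h k p q ∈ _) (by simp) (fun p q hp hq => ?_)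
    (fun c p hp => ?_) (fun u hu hune => ?_) hp
  · rw [map_add]; exact Submodule.add_mem _ hp hq
  · rw [map_smul]; exact Submodule.smul_mem _ c hp
  refine beGen_induction (P := fun q => beCompMap h k _ q ∈ _) (by simp) (fun p q hp hq => ?_)
    (fun c p hp => ?_) (fun v hv hvne => ?_) hq
  · rw [map_add]; exact Submodule.add_mem _ hp hq
  · rw [map_smul]; exact Submodule.smul_mem _ c hp
  rw [beCompMap_beClass]
  refine Finsupp.supported_mono ?_ (beClassMap_mem_supported (shuffle_mem_ofLength _ u v))
  intro w hw
  have h1 := List.length_pos_iff.2 hune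
  have h2 := List.length_pos_iff.2 hvne
  simp only [Set.mem_ofPred_eq] at hw ⊢
  omega

/-- This is `facesMap_shuffle`; its extra multiple of the empty simplex vanishes in the normalized
complex. -/
theorem beDiffMap_beCompMap (h : n + 1 = r + s) (k : Fin r) {d : ℤ} {p : BEGen r →₀ F}
    (q : BEGen s →₀ F)
    (hp : p ∈ Finsupp.supported F F {w : BEGen r | (w.1.length : ℤ) - 1 = d}) :
    beDiffMap (beCompMap h k p q) =
      beCompMap h k (beDiffMap p) q + d.negOnePow • beCompMap h k p (beDiffMap q) := by
  refine beGen_induction (P := fun p => beDiffMap (beCompMap h k p q) =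
      beCompMap h k (beDiffMap p) q + d.negOnePow • beCompMap h k p (beDiffMap q)) (by simp)
    (fun p p' hp hp' => ?_) (fun c p hp => ?_) (fun u hu hune => ?_) hp
  · simp only [map_add, LinearMap.add_apply, hp, hp', smul_add]; abel
  · simp only [map_smul, LinearMap.smul_apply, hp, smul_add, smul_comm c]
  refine beClass_induction (P := fun q => beDiffMap (beCompMap h k (beClass F u) q) =
      beCompMap h k (beDiffMap (beClass F u)) q +
        d.negOnePow • beCompMap h k (beClass F u) (beDiffMap q)) (by simp)
    (fun p p' hp hp' => ?_) (fun c p hp => ?_) (fun v _ => ?_) q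
  · simp only [map_add, hp, hp', smul_add]; abel
  · simp only [map_smul, hp, smul_add, smul_comm c]
  have hd : d = ((u.length - 1 : ℕ) : ℤ) := by
    have h1 := List.length_pos_iff.2 hune
    omega
  rw [hd, negOnePow_smul, beCompMap_beClass, beDiffMap_beClassMap, facesMap_shuffle,
    beDiffMap_beClass, beDiffMap_beClass, ← beClassMap_single u, ← beClassMap_single v,
    beCompMap_beClassMap, beCompMap_beClassMap, map_add, map_add, map_zsmul, beClassMap_single_nil,
    add_zero]

theorem beCompMap_one_left (h : s + 1 = 1 + s) (q : BEGen s →₀ F) :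
    beCompMap h 0 (beClass F [1]) q = q := by
  refine beClass_induction (P := fun q => beCompMap h 0 (beClass F [1]) q = q) (by simp)
    (fun p q hp hq => by simp [hp, hq]) (fun c p hp => by simp [hp]) (fun w hw => ?_) q
  rw [beCompMap_beClass, shuffle_singleton_left _ _ hw, beClassMap_single,
    show permComp h 0 1 = id from funext fun q => permComp_one_left h q, List.map_id]

theorem beCompMap_one_right (h : r + 1 = r + 1) (k : Fin r) (p : BEGen r →₀ F) :
    beCompMap h k p (beClass F [1]) = p := by
  refine beClass_induction (P := fun p => beCompMap h k p (beClass F [1]) = p) (by simp)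
    (fun p q hp hq => by simp [hp, hq]) (fun c p hp => by simp [hp]) (fun w hw => ?_) p
  rw [beCompMap_beClass, shuffle_singleton_right _ _ hw, beClassMap_single,
    show (permComp h k · 1) = id from funext fun p => permComp_one_right h k p, List.map_id]

theorem beCompMap_assoc (hm : m + 1 = r + s) (hl : l + 1 = m + t) (hn : n + 1 = s + t)
    (hl' : l + 1 = r + n) (i : Fin r) (j : Fin s) (p : BEGen r →₀ F) (q : BEGen s →₀ F)
    (x : BEGen t →₀ F) :
    beCompMap hl (innerIndex hm i j) (beCompMap hm i p q) x =
      beCompMap hl' i p (beCompMap hn j q x) := by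
  refine beClass_induction (P := fun p =>
    beCompMap hl (innerIndex hm i j) (beCompMap hm i p q) x =
      beCompMap hl' i p (beCompMap hn j q x)) (by simp)
    (fun p q hp hq => by simp [hp, hq]) (fun c p hp => by simp [hp]) (fun u _ => ?_) p
  refine beClass_induction (P := fun q =>
    beCompMap hl (innerIndex hm i j) (beCompMap hm i (beClass F u) q) x =
      beCompMap hl' i (beClass F u) (beCompMap hn j q x)) (by simp)
    (fun p q hp hq => by simp [hp, hq]) (fun c p hp => by simp [hp]) (fun v _ => ?_) q
  refine beClass_induction (P := fun x =>
    beCompMap hl (innerIndex hm i j) (beCompMap hm i (beClass F u) (beClass F v)) x =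
      beCompMap hl' i (beClass F u) (beCompMap hn j (beClass F v) x)) (by simp)
    (fun p q hp hq => by simp [hp, hq]) (fun c p hp => by simp [hp]) (fun w _ => ?_) x
  rw [beCompMap_beClass, beCompMap_beClass, ← beClassMap_single u, ← beClassMap_single w,
    beCompMap_beClassMap, beCompMap_beClassMap,
    shuffle_assoc _ _ _ _ (fun a b c => permComp_assoc hm hl hn hl' i j a b c)]

theorem beCompMap_comm (hm : m + 1 = r + s) (hl : l + 1 = m + t) (hn : n + 1 = r + t)
    (hl' : l + 1 = n + s) (i k : Fin r) (hik : i ≠ k) {d e : ℤ}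
    (p : BEGen r →₀ F) {q : BEGen s →₀ F} {x : BEGen t →₀ F}
    (hq : q ∈ Finsupp.supported F F {w : BEGen s | (w.1.length : ℤ) - 1 = d})
    (hx : x ∈ Finsupp.supported F F {w : BEGen t | (w.1.length : ℤ) - 1 = e}) :
    beCompMap hl (outerIndex hm i k hik.symm) (beCompMap hm i p q) x =
      (d * e).negOnePow • beCompMap hl' (outerIndex hn k i hik) (beCompMap hn k p x) q := by
  refine beClass_induction (P := fun p =>
    beCompMap hl (outerIndex hm i k hik.symm) (beCompMap hm i p q) x =
      (d * e).negOnePow • beCompMap hl' (outerIndex hn k i hik) (beCompMap hn k p x) q) (by simp)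
    (fun p q hp hq => by simp [hp, hq]) (fun c p hp => by simp [hp, smul_comm c]) (fun u _ => ?_) p
  refine beGen_induction (P := fun q =>
    beCompMap hl (outerIndex hm i k hik.symm) (beCompMap hm i (beClass F u) q) x =
      (d * e).negOnePow • beCompMap hl' (outerIndex hn k i hik)
        (beCompMap hn k (beClass F u) x) q) (by simp)
    (fun p q hp hq => by simp [hp, hq]) (fun c p hp => by simp [hp, smul_comm c])
    (fun v hv hvne => ?_) hq
  refine beGen_induction (P := fun x =>
    beCompMap hl (outerIndex hm i k hik.symm) (beCompMap hm i (beClass F u) (beClass F v)) x =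
      (d * e).negOnePow • beCompMap hl' (outerIndex hn k i hik)
        (beCompMap hn k (beClass F u) x) (beClass F v)) (by simp)
    (fun p q hp hq => by simp [hp, hq]) (fun c p hp => by simp [hp, smul_comm c])
    (fun w hw hwne => ?_) hx
  have hde : d * e = (((v.length - 1) * (w.length - 1) : ℕ) : ℤ) := by
    have h1 := List.length_pos_iff.2 hvne
    have h2 := List.length_pos_iff.2 hwne
    rw [← hv, ← hw]
    push_cast [Nat.cast_sub h1, Nat.cast_sub h2]
    rfl
  -- Both sides become a product of `u` with the shuffle product of `v` and `w` formed of pairs. The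
  -- sign arises when `v` and `w` are exchanged.
  rw [hde, negOnePow_smul, beCompMap_beClass, beCompMap_beClass, ← beClassMap_single v,
    ← beClassMap_single w, beCompMap_beClassMap, beCompMap_beClassMap,
    shuffle_assoc (permComp hm i) (permComp hl (outerIndex hm i k hik.symm))
      (fun a (b : Equiv.Perm (Fin s) × Equiv.Perm (Fin t)) =>
        permComp hl (outerIndex hm i k hik.symm) (permComp hm i a b.1) b.2)
      (fun b c => (b, c)) (fun _ _ _ => rfl),
    shuffle_assoc (permComp hn k) (permComp hl' (outerIndex hn k i hik))
      (fun a (b : Equiv.Perm (Fin s) × Equiv.Perm (Fin t)) =>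
        permComp hl (outerIndex hm i k hik.symm) (permComp hm i a b.1) b.2)
      (fun c b => (b, c)) (fun a b c => (permComp_comm hm hl hn hl' i k hik a c b).symm),
    shuffle_comm _ v w, map_zsmul, map_zsmul]

theorem beCompMap_equivariant (h : n + 1 = r + s) (k : Fin r) (σ : Equiv.Perm (Fin r))
    (τ : Equiv.Perm (Fin s)) (p : BEGen r →₀ F) (q : BEGen s →₀ F) :
    beCompMap h (σ k) (beActMap σ p) (beActMap τ q) =
      beActMap (permComp h (σ k) σ τ) (beCompMap h k p q) := by
  refine beClass_induction (P := fun p => beCompMap h (σ k) (beActMap σ p) (beActMap τ q) =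
      beActMap (permComp h (σ k) σ τ) (beCompMap h k p q)) (by simp)
    (fun p q hp hq => by simp [hp, hq]) (fun c p hp => by simp [hp]) (fun u _ => ?_) p
  refine beClass_induction (P := fun q =>
    beCompMap h (σ k) (beActMap σ (beClass F u)) (beActMap τ q) =
      beActMap (permComp h (σ k) σ τ) (beCompMap h k (beClass F u) q)) (by simp)
    (fun p q hp hq => by simp [hp, hq]) (fun c p hp => by simp [hp]) (fun v _ => ?_) q
  rw [beActMap_beClass, beActMap_beClass, beCompMap_beClass, beCompMap_beClass,
    beActMap_beClassMap, lmapDomain_shuffle, shuffle_map]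
  simp only [permComp_mul]

theorem isDGOperad_barrattEccles : IsDGOperad (barrattEccles F) where
  isInternal r := isInternal_supported F fun w : BEGen r => (w.1.length : ℤ) - 1
  diff_mem _ _ _ hx := beDiffMap_mem hx
  diff_diff _ x := beDiffMap_beDiffMap x
  act_one _ x := beActMap_one x
  act_mul _ σ τ x := beActMap_mul σ τ x
  act_mem _ σ _ _ hx := beActMap_mem σ hx
  diff_act _ σ x := beDiffMap_beActMap σ x
  one_mem := by
    change beClass F [1] ∈ Finsupp.supported F F {w : BEGen 1 | (w.1.length : ℤ) - 1 = 0}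
    rw [beClass, dif_pos (by simp)]
    exact Finsupp.single_mem_supported F 1 (by simp)
  diff_one := by
    change beDiffMap (beClass F [1]) = 0
    rw [beDiffMap_beClass]
    simp [faces]
  comp_mem h k _ _ _ _ hp hq := beCompMap_mem h k hp hq
  diff_comp h k _ _ q hp := beDiffMap_beCompMap h k q hp
  one_comp h q := beCompMap_one_left h q
  comp_one h k p := beCompMap_one_right h k p
  comp_assoc hm hl hn hl' i j p q x := beCompMap_assoc hm hl hn hl' i j p q x
  comp_comm hm hl hn hl' i k hik _ _ p _ _ hq hx := beCompMap_comm hm hl hn hl' i k hik p hq hx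
  equivariant h k σ τ p q := beCompMap_equivariant h k σ τ p q

end BarrattEccles

/-! ### The surjection operad -/

section Surjections

variable {F : Type u} [CommRing F] {r s n : ℕ}

/-- The class of a linear combination of sequences in the module of surjections. -/
noncomputable def surjClassMap : (List (Fin r) →₀ F) →ₗ[F] (SurjGen r →₀ F) :=
  Finsupp.linearCombination F (surjClass F)

@[simp] theorem surjClassMap_single (u : List (Fin r)) :
    surjClassMap (Finsupp.single u (1 : F)) = surjClass F u := by
  simp [surjClassMap]

theorem single_eq_surjClass (u : SurjGen r) : Finsupp.single u (1 : F) = surjClass F u.1 := by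
  rw [surjClass, dif_pos u.2]

theorem surjClassMap_of_mem_degenerate {z : List (Fin r) →₀ F}
    (hz : z ∈ degenerate F (Fin r)) : surjClassMap z = 0 := by
  refine eqOn_supported (f := surjClassMap) (g := 0) (fun u hu => ?_) hz
  rw [surjClassMap_single, surjClass, dif_neg fun h => hu h.2]
  rfl

theorem surjClassMap_of_notMem (x : Fin r) {z : List (Fin r) →₀ F}
    (hz : z ∈ Finsupp.supported F F {u : List (Fin r) | x ∉ u}) : surjClassMap z = 0 := by
  refine eqOn_supported (f := surjClassMap) (g := 0) (fun u hu => ?_) hz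
  rw [surjClassMap_single, surjClass, dif_neg fun h => hu (h.1 x)]
  rfl

theorem surjClassMap_eq_of_smodEq {z z' : List (Fin r) →₀ F}
    (h : z ≡ z' [SMOD degenerate F (Fin r)]) : surjClassMap z = surjClassMap z' := by
  rw [SModEq.sub_mem] at h
  rw [← sub_eq_zero, ← map_sub, surjClassMap_of_mem_degenerate h]

theorem surjDiff_eq (u : List (Fin r)) : surjDiff F u = surjClassMap (rawDiff F u) := by
  rw [surjDiff, rawDiff, map_sum]
  refine Finset.sum_congr rfl fun i _ => ?_
  rw [map_zsmul, surjClassMap_single]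

theorem surjComp_eq (h : n + 1 = r + s) (k : Fin r) (u : List (Fin r)) (v : List (Fin s)) :
    surjComp F h k u v = surjClassMap (rawComp F h k u v) := by
  rw [surjComp, rawComp, map_list_sum, List.map_map]
  congr 1
  refine List.map_congr_left fun t _ => ?_
  rw [Function.comp_apply, map_zsmul, surjClassMap_single]

theorem tableSum_eq (w : List (Equiv.Perm (Fin r))) :
    tableSum F w = surjClassMap (rawTables F [] w) := by
  rw [tableSum, rawTables, map_list_sum, List.map_map]
  congr 1
  refine List.map_congr_left fun t _ => ?_
  rw [Function.comp_apply, surjClassMap_single]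

/-- The differential of the surjection operad. -/
noncomputable def surjDiffMap : (SurjGen r →₀ F) →ₗ[F] (SurjGen r →₀ F) :=
  Finsupp.linearCombination F fun u => surjDiff F u.1

/-- The action of the symmetric group on the surjection operad. -/
noncomputable def surjActMap (σ : Equiv.Perm (Fin r)) : (SurjGen r →₀ F) →ₗ[F] (SurjGen r →₀ F) :=
  Finsupp.linearCombination F fun u => surjClass F (u.1.map σ)

/-- The composition products of the surjection operad. -/
noncomputable def surjCompMap (h : n + 1 = r + s) (k : Fin r) :
    (SurjGen r →₀ F) →ₗ[F] (SurjGen s →₀ F) →ₗ[F] (SurjGen n →₀ F) :=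
  Finsupp.linearCombination F fun u => Finsupp.linearCombination F fun v =>
    surjComp F h k u.1 v.1

theorem surjClass_cases (u : List (Fin r)) :
    ((∀ x, x ∈ u) ∧ u.IsChain (· ≠ ·)) ∨ (surjClass F u = 0 ∧
      ((∃ x, x ∉ u) ∨ ¬ u.IsChain (· ≠ ·))) := by
  by_cases hu : (∀ x, x ∈ u) ∧ u.IsChain (· ≠ ·)
  · exact Or.inl hu
  · refine Or.inr ⟨dif_neg hu, ?_⟩
    rwa [not_and_or, not_forall] at hu

/-- A deletion does not restore a missing value, and the differential of a degenerate sequence is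
degenerate, so the formula holds for all sequences. -/
theorem surjDiffMap_surjClass (u : List (Fin r)) :
    surjDiffMap (surjClass F u) = surjDiff F u := by
  rcases surjClass_cases (F := F) u with hu | ⟨h0, ⟨x, hx⟩ | hu⟩
  · rw [surjClass, dif_pos hu, surjDiffMap, linearCombination_one]
  · rw [h0, map_zero, surjDiff_eq, surjClassMap_of_notMem x (rawDiff_mem_supported_of_notMem hx)]
  · rw [h0, map_zero, surjDiff_eq, surjClassMap_of_mem_degenerate (rawDiff_mem_degenerate hu)]

theorem surjActMap_surjClass (σ : Equiv.Perm (Fin r)) (u : List (Fin r)) :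
    surjActMap σ (surjClass F u) = surjClass F (u.map σ) := by
  rcases surjClass_cases (F := F) u with hu | ⟨h0, ⟨x, hx⟩ | hu⟩
  · rw [surjClass, dif_pos hu, surjActMap, linearCombination_one]
  · rw [h0, map_zero, surjClass, dif_neg]
    rintro ⟨h, -⟩
    obtain ⟨y, hy, e⟩ := List.mem_map.1 (h (σ x))
    exact hx (σ.injective e ▸ hy)
  · rw [h0, map_zero, surjClass, dif_neg]
    rintro ⟨-, h⟩
    exact hu ((isChain_map_iff σ.injective u).1 h)

/-- A missing value of `v`, or one of `u` other than `k`, is still missing in the composites; if `k`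
is missing there is no composite at all. Degenerate factors give degenerate composites. -/
theorem surjCompMap_surjClass (h : n + 1 = r + s) (k : Fin r) (u : List (Fin r))
    (v : List (Fin s)) :
    surjCompMap h k (surjClass F u) (surjClass F v) = surjComp F h k u v := by
  rcases surjClass_cases (F := F) u with hu | ⟨h0, ⟨x, hx⟩ | hu⟩
  · rcases surjClass_cases (F := F) v with hv | ⟨h0, ⟨y, hy⟩ | hv⟩
    · rw [surjClass, dif_pos hu, surjClass, dif_pos hv]
      simp [surjCompMap]
    · have hy' : rawComp F h k u v ∈
          Finsupp.supported F F {z : List (Fin n) | innerIndex h k y ∉ z} :=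
        Finsupp.supported_mono (fun z hz (hyz : _ ∈ z) => hy (hz.2 y hyz)) (rawComp_mem_supported h k u v)
      rw [h0, map_zero, surjComp_eq, surjClassMap_of_notMem _ hy']
    · rw [h0, map_zero, surjComp_eq,
        surjClassMap_of_mem_degenerate (rawComp_mem_degenerate_right h k u hv)]
  · rw [h0, map_zero, LinearMap.zero_apply, surjComp_eq]
    by_cases hxk : x = k
    · subst hxk
      rw [rawComp_of_notMem h hx, map_zero]
    · have hx' : rawComp F h k u v ∈
          Finsupp.supported F F {z : List (Fin n) | outerIndex h k x hxk ∉ z} :=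
        Finsupp.supported_mono (fun z hz (hxz : _ ∈ z) => hx (hz.1 x hxk hxz))
          (rawComp_mem_supported h k u v)
      rw [surjClassMap_of_notMem _ hx']
  · rw [h0, map_zero, LinearMap.zero_apply, surjComp_eq,
      surjClassMap_of_mem_degenerate (rawComp_mem_degenerate_left h k hu v)]

theorem surjDiffMap_surjClassMap (z : List (Fin r) →₀ F) :
    surjDiffMap (surjClassMap z) = surjClassMap (rawDiffMap z) := by
  refine eqOn_supported (f := surjDiffMap ∘ₗ surjClassMap) (g := surjClassMap ∘ₗ rawDiffMap)
    (fun w _ => ?_) (mem_supported_univ z)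
  simp [surjDiffMap_surjClass, surjDiff_eq]

theorem surjActMap_surjClassMap (σ : Equiv.Perm (Fin r)) (z : List (Fin r) →₀ F) :
    surjActMap σ (surjClassMap z) = surjClassMap (Finsupp.lmapDomain F F (List.map σ) z) := by
  refine eqOn_supported (f := surjActMap σ ∘ₗ surjClassMap)
    (g := surjClassMap ∘ₗ Finsupp.lmapDomain F F (List.map σ))
    (fun w _ => ?_) (mem_supported_univ z)
  simp [surjActMap_surjClass]

theorem surjCompMap_surjClassMap (h : n + 1 = r + s) (k : Fin r) (z : List (Fin r) →₀ F)
    (z' : List (Fin s) →₀ F) :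
    surjCompMap h k (surjClassMap z) (surjClassMap z') = surjClassMap (rawCompMap h k z z') := by
  refine eqOn_supported₂ (f := (surjCompMap h k).compl₁₂ surjClassMap surjClassMap)
    (g := (rawCompMap h k).compr₂ surjClassMap)
    (fun u _ v _ => ?_) (mem_supported_univ z) (mem_supported_univ z')
  simp [surjCompMap_surjClass, surjComp_eq]

/-! ### The table reduction morphism -/

/-- The table reduction morphism. -/
noncomputable def tableMap : (BEGen r →₀ F) →ₗ[F] (SurjGen r →₀ F) :=
  Finsupp.linearCombination F fun w => tableSum F w.1

theorem tableMap_beClass (w : List (Equiv.Perm (Fin r))) :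
    tableMap (beClass F w) = tableSum F w := by
  by_cases hw : w ≠ [] ∧ w.IsChain (· ≠ ·)
  · rw [beClass, dif_pos hw, tableMap, linearCombination_one]
  · rw [beClass, dif_neg hw, map_zero, tableSum_eq]
    rw [not_and_or, not_not] at hw
    rcases hw with rfl | hw
    · simp
    · rw [surjClassMap_of_mem_degenerate (rawTables_mem_degenerate [] w hw)]

theorem tableMap_beClassMap (z : List (Equiv.Perm (Fin r)) →₀ F) :
    tableMap (beClassMap z) = surjClassMap (rawTablesMap [] z) := by
  refine eqOn_supported (f := tableMap ∘ₗ beClassMap) (g := surjClassMap ∘ₗ rawTablesMap [])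
    (fun w _ => ?_) (mem_supported_univ z)
  simp [tableMap_beClass, tableSum_eq]

/-- Each term is a caesura or the last occurrence of its value. This converts the number of rows of
a table into the degree of a surjection. -/
theorem length_eq_card_add_caesuraCount {α : Type} [DecidableEq α] (u : List α) :
    u.length = u.toFinset.card + caesuraCount u := by
  induction u with
  | nil => rfl
  | cons x u ih =>
    rw [List.length_cons, ih, List.toFinset_cons, caesuraCount]
    by_cases hx : x ∈ u
    · rw [Finset.insert_eq_of_mem (List.mem_toFinset.2 hx), if_pos hx, add_assoc]
    · rw [Finset.card_insert_of_notMem (mt List.mem_toFinset.1 hx), if_neg hx]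
      omega

theorem tableMap_mem {d : ℤ} {p : BEGen r →₀ F}
    (hp : p ∈ Finsupp.supported F F {w : BEGen r | (w.1.length : ℤ) - 1 = d}) :
    tableMap p ∈ Finsupp.supported F F {u : SurjGen r | (u.1.length : ℤ) - r = d} := by
  refine beGen_induction (P := fun p => tableMap p ∈ _) (by simp) (fun p q hp hq => ?_)
    (fun c p hp => ?_) (fun w hw hne => ?_) hp
  · rw [map_add]; exact Submodule.add_mem _ hp hq
  · rw [map_smul]; exact Submodule.smul_mem _ c hp
  · rw [tableMap_beClass, tableSum_eq]
    refine map_mem_of_supported (fun u hu => ?_) (rawTables_mem_supported [] w)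
    rw [surjClassMap_single, surjClass]
    split_ifs with h
    · refine Finsupp.single_mem_supported F 1 ?_
      have h1 := length_eq_card_add_caesuraCount u
      rw [show u.toFinset = Finset.univ by ext x; simp [h.1 x], Finset.card_univ,
        Fintype.card_fin] at h1
      have h2 := hu.2
      simp only [Set.mem_ofPred_eq]
      omega
    · simp

theorem tableMap_beDiffMap (p : BEGen r →₀ F) :
    tableMap (beDiffMap p) = surjDiffMap (tableMap p) := by
  obtain ⟨z, rfl⟩ := beClassMap_surjective p
  rw [beDiffMap_beClassMap, tableMap_beClassMap, tableMap_beClassMap, surjDiffMap_surjClassMap]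
  congr 1
  refine eqOn_supported (f := rawTablesMap [] ∘ₗ facesMap) (g := rawDiffMap ∘ₗ rawTablesMap [])
    (fun w _ => ?_) (mem_supported_univ z)
  simp [rawDiffMap_rawTables]

theorem tableMap_beActMap (σ : Equiv.Perm (Fin r)) (p : BEGen r →₀ F) :
    tableMap (beActMap σ p) = surjActMap σ (tableMap p) := by
  obtain ⟨z, rfl⟩ := beClassMap_surjective p
  rw [beActMap_beClassMap, tableMap_beClassMap, tableMap_beClassMap, surjActMap_surjClassMap]
  congr 1
  refine eqOn_supported (f := rawTablesMap [] ∘ₗ Finsupp.lmapDomain F F (List.map (σ * ·)))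
    (g := Finsupp.lmapDomain F F (List.map σ) ∘ₗ rawTablesMap [])
    (fun w _ => ?_) (mem_supported_univ z)
  simp only [LinearMap.comp_apply, rawTablesMap_single]
  rw [← rawTables_map_mul]
  simp

theorem tableMap_beCompMap (h : n + 1 = r + s) (k : Fin r) (p : BEGen r →₀ F)
    (q : BEGen s →₀ F) :
    tableMap (beCompMap h k p q) = surjCompMap h k (tableMap p) (tableMap q) := by
  obtain ⟨z, rfl⟩ := beClassMap_surjective p
  obtain ⟨z', rfl⟩ := beClassMap_surjective q
  rw [beCompMap_beClassMap, tableMap_beClassMap, tableMap_beClassMap, tableMap_beClassMap,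
    surjCompMap_surjClassMap]
  refine eqOn_supported₂
    (f := (shuffleMap (permComp h k)).compr₂ (surjClassMap ∘ₗ rawTablesMap []))
    (g := ((rawCompMap h k).compl₁₂ (rawTablesMap []) (rawTablesMap [])).compr₂ surjClassMap)
    (fun u _ v _ => ?_) (mem_supported_univ z) (mem_supported_univ z')
  simp only [LinearMap.compr₂_apply, LinearMap.compl₁₂_apply, LinearMap.comp_apply,
    shuffleMap_single, rawTablesMap_single]
  exact surjClassMap_eq_of_smodEq
    (rawTablesMap_shuffle_smodEq h k u v (by simp) (by simp) (by simp))

theorem tableSum_singleton (σ : Equiv.Perm (Fin r)) :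
    tableSum F [σ] = surjClass F (word σ) := by
  simp [tableSum, tables]

theorem isDGOperadHom_tableReduction :
    IsDGOperadHom (barrattEccles F) (surjOperad F) (tableReduction F) where
  map_mem _ _ _ hx := tableMap_mem hx
  map_diff _ x := tableMap_beDiffMap x
  map_act _ σ x := tableMap_beActMap σ x
  map_one := by
    change tableMap (beClass F [1]) = surjClass F [0]
    rw [tableMap_beClass, tableSum_singleton]
    simp [word]
  map_comp h k p q := tableMap_beCompMap h k p q

theorem complementary_nil (u : SurjGen r) : Complementary [] u.1 :=
  ⟨List.nodup_nil, fun x => by simp [u.2.1 x]⟩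

theorem tableMap_sectionSimplex (u : SurjGen r) :
    tableMap (beClass F (sectionSimplex [] u.1)) = Finsupp.single u 1 := by
  rw [tableMap_beClass, tableSum_eq,
    surjClassMap_eq_of_smodEq (rawTables_sectionSimplex (complementary_nil u)),
    surjClassMap_single, single_eq_surjClass]

/-- Homogeneous preimages are what the transfer of the graded laws to the surjections requires. -/
theorem exists_tableMap_eq {d : ℤ} {q : SurjGen r →₀ F}
    (hq : q ∈ Finsupp.supported F F {u : SurjGen r | (u.1.length : ℤ) - r = d}) :
    ∃ p ∈ Finsupp.supported F F {w : BEGen r | (w.1.length : ℤ) - 1 = d}, tableMap p = q := by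
  refine supported_induction (P := fun q => ∃ p ∈ Finsupp.supported F F
    {w : BEGen r | (w.1.length : ℤ) - 1 = d}, tableMap p = q) ⟨0, by simp, map_zero _⟩ ?_ ?_ ?_ hq
  · rintro _ _ ⟨p, hp, rfl⟩ ⟨q, hq, rfl⟩
    exact ⟨p + q, Submodule.add_mem _ hp hq, map_add _ _ _⟩
  · rintro c _ ⟨p, hp, rfl⟩
    exact ⟨c • p, Submodule.smul_mem _ c hp, map_smul _ _ _⟩
  · intro u hu
    refine ⟨_, ?_, tableMap_sectionSimplex u⟩
    have h1 := length_sectionSimplex (complementary_nil u)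
    rw [beClass]
    split_ifs
    · refine Finsupp.single_mem_supported F 1 ?_
      simp only [Set.mem_ofPred_eq, List.length_nil] at hu h1 ⊢
      omega
    · simp

theorem tableMap_surjective :
    Function.Surjective (tableMap : (BEGen r →₀ F) →ₗ[F] (SurjGen r →₀ F)) := by
  intro q
  refine supported_induction (P := fun q => ∃ p, tableMap p = q) ⟨0, map_zero _⟩ ?_ ?_ ?_
    (mem_supported_univ q)
  · rintro _ _ ⟨p, rfl⟩ ⟨q, rfl⟩
    exact ⟨p + q, map_add _ _ _⟩
  · rintro c _ ⟨p, rfl⟩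
    exact ⟨c • p, map_smul _ _ _⟩
  · intro u _
    exact ⟨_, tableMap_sectionSimplex u⟩

/-- Associativity, signs and equivariance are inherited from the Barratt-Eccles operad, where they
are identities of shuffles; none is verified on surjections. -/
theorem isDGOperad_surjOperad : IsDGOperad (surjOperad F) :=
  isDGOperad_of_surjective isDGOperad_barrattEccles isDGOperadHom_tableReduction
    (fun _ => tableMap_surjective) (fun _ _ _ hq => exists_tableMap_eq hq)
    (fun r => isInternal_supported F fun u : SurjGen r => (u.1.length : ℤ) - r)

end Surjections

/-! ### The associative operad -/

section Associative

variable {F : Type u} [CommRing F] {r s n : ℕ}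

/-- A permutation as a non-degenerate simplex of dimension `0`. -/
def permBEGen (σ : Equiv.Perm (Fin r)) : BEGen r := ⟨[σ], by simp⟩

/-- A permutation as a non-degenerate surjection of degree `0`. -/
def permSurjGen (σ : Equiv.Perm (Fin r)) : SurjGen r :=
  ⟨word σ, mem_word σ, (nodup_word σ).isChain⟩

theorem permBEGen_injective : Function.Injective (permBEGen : Equiv.Perm (Fin r) → BEGen r) := by
  intro σ τ h
  simpa [permBEGen] using h

theorem permSurjGen_injective :
    Function.Injective (permSurjGen : Equiv.Perm (Fin r) → SurjGen r) := by
  intro σ τ h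
  exact word_injective (congrArg Subtype.val h)

theorem single_permBEGen (σ : Equiv.Perm (Fin r)) :
    Finsupp.single (permBEGen σ) (1 : F) = beClass F [σ] := by
  simp [beClass, permBEGen]

theorem single_permSurjGen (σ : Equiv.Perm (Fin r)) :
    Finsupp.single (permSurjGen σ) (1 : F) = surjClass F (word σ) :=
  single_eq_surjClass _

/-- The inclusion of the permutations into the Barratt-Eccles operad. -/
noncomputable def permBEMap : (Equiv.Perm (Fin r) →₀ F) →ₗ[F] (BEGen r →₀ F) :=
  Finsupp.linearCombination F fun σ => beClass F [σ]

/-- The inclusion of the permutations into the surjection operad. -/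
noncomputable def permSurjMap : (Equiv.Perm (Fin r) →₀ F) →ₗ[F] (SurjGen r →₀ F) :=
  Finsupp.linearCombination F fun σ => surjClass F (word σ)

/-- The action of the symmetric group on the associative operad. -/
noncomputable def permActMap (σ : Equiv.Perm (Fin r)) :
    (Equiv.Perm (Fin r) →₀ F) →ₗ[F] (Equiv.Perm (Fin r) →₀ F) :=
  Finsupp.linearCombination F fun w => Finsupp.single (σ * w) 1

/-- The composition products of the associative operad. -/
noncomputable def permCompMap (h : n + 1 = r + s) (k : Fin r) :
    (Equiv.Perm (Fin r) →₀ F) →ₗ[F] (Equiv.Perm (Fin s) →₀ F) →ₗ[F] (Equiv.Perm (Fin n) →₀ F) :=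
  Finsupp.linearCombination F fun u => Finsupp.linearCombination F fun v =>
    Finsupp.single (permComp h k u v) 1

@[simp] theorem permBEMap_single (σ : Equiv.Perm (Fin r)) :
    permBEMap (Finsupp.single σ (1 : F)) = beClass F [σ] := by
  simp [permBEMap]

@[simp] theorem permSurjMap_single (σ : Equiv.Perm (Fin r)) :
    permSurjMap (Finsupp.single σ (1 : F)) = surjClass F (word σ) := by
  simp [permSurjMap]

@[simp] theorem permActMap_single (σ τ : Equiv.Perm (Fin r)) :
    permActMap σ (Finsupp.single τ (1 : F)) = Finsupp.single (σ * τ) 1 := by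
  simp [permActMap]

@[simp] theorem permCompMap_single (h : n + 1 = r + s) (k : Fin r) (u : Equiv.Perm (Fin r))
    (v : Equiv.Perm (Fin s)) :
    permCompMap h k (Finsupp.single u (1 : F)) (Finsupp.single v 1) =
      Finsupp.single (permComp h k u v) 1 := by
  simp [permCompMap]

/-- As a map induced by an injection of generators, its kernel and its range can be read off. -/
theorem permBEMap_eq : (permBEMap : (Equiv.Perm (Fin r) →₀ F) →ₗ[F] _) =
    Finsupp.lmapDomain F F permBEGen := by
  refine LinearMap.ext fun p => eqOn_supported (fun σ _ => ?_) (mem_supported_univ p)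
  rw [permBEMap_single, Finsupp.lmapDomain_apply, Finsupp.mapDomain_single, single_permBEGen]

theorem permSurjMap_eq : (permSurjMap : (Equiv.Perm (Fin r) →₀ F) →ₗ[F] _) =
    Finsupp.lmapDomain F F permSurjGen := by
  refine LinearMap.ext fun p => eqOn_supported (fun σ _ => ?_) (mem_supported_univ p)
  rw [permSurjMap_single, Finsupp.lmapDomain_apply, Finsupp.mapDomain_single, single_permSurjGen]

theorem permBEMap_injective :
    Function.Injective (permBEMap : (Equiv.Perm (Fin r) →₀ F) →ₗ[F] _) := by
  rw [permBEMap_eq]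
  exact Finsupp.mapDomain_injective permBEGen_injective

theorem permSurjMap_injective :
    Function.Injective (permSurjMap : (Equiv.Perm (Fin r) →₀ F) →ₗ[F] _) := by
  rw [permSurjMap_eq]
  exact Finsupp.mapDomain_injective permSurjGen_injective

theorem range_lmapDomain {ι κ : Type} (f : ι → κ) :
    LinearMap.range (Finsupp.lmapDomain F F f) = Finsupp.supported F F (Set.range f) := by
  rw [LinearMap.range_eq_map, ← Finsupp.supported_univ, Finsupp.lmapDomain_supported,
    Set.image_univ]

theorem tableMap_permBEMap (p : Equiv.Perm (Fin r) →₀ F) :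
    tableMap (permBEMap p) = permSurjMap p := by
  refine eqOn_supported (f := tableMap ∘ₗ permBEMap) (g := permSurjMap) (fun σ _ => ?_)
    (mem_supported_univ p)
  rw [LinearMap.comp_apply, permBEMap_single, permSurjMap_single, tableMap_beClass,
    tableSum_singleton]

theorem permBEMap_mem (p : Equiv.Perm (Fin r) →₀ F) :
    permBEMap p ∈ Finsupp.supported F F {w : BEGen r | (w.1.length : ℤ) - 1 = 0} := by
  refine map_mem_of_supported (fun σ _ => ?_) (mem_supported_univ p)
  rw [permBEMap_single, ← single_permBEGen]
  exact Finsupp.single_mem_supported F 1 (by simp [permBEGen])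

theorem permBEMap_mem_of_mem {d : ℤ} {p : Equiv.Perm (Fin r) →₀ F}
    (hp : p ∈ (if d = 0 then ⊤ else ⊥ : Submodule F (Equiv.Perm (Fin r) →₀ F))) :
    permBEMap p ∈ Finsupp.supported F F {w : BEGen r | (w.1.length : ℤ) - 1 = d} := by
  split_ifs at hp with h
  · subst h
    exact permBEMap_mem p
  · rw [(Submodule.mem_bot F).1 hp, map_zero]
    exact Submodule.zero_mem _

/-- The image is concentrated in degree 0, which meets any other degree only in 0. -/
theorem mem_of_permBEMap_mem {d : ℤ} {p : Equiv.Perm (Fin r) →₀ F}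
    (hp : permBEMap p ∈ Finsupp.supported F F {w : BEGen r | (w.1.length : ℤ) - 1 = d}) :
    p ∈ (if d = 0 then ⊤ else ⊥ : Submodule F (Equiv.Perm (Fin r) →₀ F)) := by
  split_ifs with h
  · exact Submodule.mem_top
  · have hd : Disjoint {w : BEGen r | (w.1.length : ℤ) - 1 = 0}
        {w : BEGen r | (w.1.length : ℤ) - 1 = d} := by
      rw [Set.disjoint_left]
      intro w h1 h2
      simp only [Set.mem_ofPred_eq] at h1 h2
      omega
    have h0 : permBEMap p = 0 := (Submodule.disjoint_def.1
      (Finsupp.disjoint_supported_supported (M := F) (R := F) hd)) _ (permBEMap_mem p) hp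
    exact (Submodule.mem_bot F).2 (permBEMap_injective (h0.trans (map_zero _).symm))

theorem isInternal_permDeg : DirectSum.IsInternal fun d : ℤ =>
    (if d = 0 then ⊤ else ⊥ : Submodule F (Equiv.Perm (Fin r) →₀ F)) := by
  have := isInternal_supported F fun _ : Equiv.Perm (Fin r) => (0 : ℤ)
  convert this using 2 with d
  split_ifs with h
  · subst h
    simp
  · simp [Ne.symm h]

theorem beDiffMap_permBEMap (p : Equiv.Perm (Fin r) →₀ F) : beDiffMap (permBEMap p) = 0 := by
  refine eqOn_supported (f := beDiffMap ∘ₗ permBEMap) (g := 0) (fun σ _ => ?_)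
    (mem_supported_univ p)
  rw [LinearMap.comp_apply, permBEMap_single, beDiffMap_beClass]
  simp [faces]

theorem permBEMap_permActMap (σ : Equiv.Perm (Fin r)) (p : Equiv.Perm (Fin r) →₀ F) :
    permBEMap (permActMap σ p) = beActMap σ (permBEMap p) := by
  refine eqOn_supported (f := permBEMap ∘ₗ permActMap σ) (g := beActMap σ ∘ₗ permBEMap)
    (fun τ _ => ?_) (mem_supported_univ p)
  simp [beActMap_beClass]

theorem permBEMap_permCompMap (h : n + 1 = r + s) (k : Fin r) (p : Equiv.Perm (Fin r) →₀ F)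
    (q : Equiv.Perm (Fin s) →₀ F) :
    permBEMap (permCompMap h k p q) = beCompMap h k (permBEMap p) (permBEMap q) := by
  refine eqOn_supported₂ (f := (permCompMap h k).compr₂ permBEMap)
    (g := (beCompMap h k).compl₁₂ permBEMap permBEMap) (fun u _ v _ => ?_)
    (mem_supported_univ p) (mem_supported_univ q)
  rw [LinearMap.compr₂_apply, LinearMap.compl₁₂_apply, permCompMap_single, permBEMap_single,
    permBEMap_single, permBEMap_single, beCompMap_beClass,
    shuffle_singleton_left _ _ (by simp)]
  simp

theorem assocToBE_injective : Function.Injective (assocToBE F r) := permBEMap_injective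

theorem assocToSurj_injective : Function.Injective (assocToSurj F r) := permSurjMap_injective

theorem tableReduction_comp_assocToBE :
    tableReduction F r ∘ₗ assocToBE F r = assocToSurj F r :=
  LinearMap.ext fun p => tableMap_permBEMap p

theorem isDGOperadHom_assocToBE :
    IsDGOperadHom (assocOperad F) (barrattEccles F) (assocToBE F) where
  map_mem _ _ _ hx := permBEMap_mem_of_mem hx
  map_diff _ x := (map_zero permBEMap).trans (beDiffMap_permBEMap x).symm
  map_act _ σ x := permBEMap_permActMap σ x
  map_one := permBEMap_single 1
  map_comp h k p q := permBEMap_permCompMap h k p q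

theorem isDGOperad_assocOperad : IsDGOperad (assocOperad F) :=
  isDGOperad_of_injective isDGOperad_barrattEccles isDGOperadHom_assocToBE
    (fun _ => assocToBE_injective) (fun _ _ _ hp => mem_of_permBEMap_mem hp)
    (fun _ => isInternal_permDeg)

theorem isDGOperadHom_assocToSurj :
    IsDGOperadHom (assocOperad F) (surjOperad F) (assocToSurj F) := by
  have := isDGOperadHom_comp (isDGOperadHom_tableReduction (F := F)) isDGOperadHom_assocToBE
  simp only [tableReduction_comp_assocToBE] at this
  exact this

/-! ### The first terms of the filtrations -/

theorem variations_cons_cons {α : Type} [DecidableEq α] (a b : α) (l : List α) :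
    variations (a :: b :: l) = variations (b :: l) + if a ≠ b then 1 else 0 := by
  simp [variations, List.countP_cons]

theorem variations_le_length {α : Type} [DecidableEq α] (l : List α) :
    variations l ≤ l.length - 1 := by
  refine List.countP_le_length.trans ?_
  simp

theorem variations_le_append {α : Type} [DecidableEq α] (l l' : List α) :
    variations l' ≤ variations (l ++ l') := by
  induction l with
  | nil => simp
  | cons a l ih =>
    refine ih.trans ?_
    rw [List.cons_append]
    cases l ++ l' with
    | nil => simp [variations]
    | cons b m => rw [variations_cons_cons]; exact Nat.le_add_right _ _

theorem variations_pos {α : Type} [DecidableEq α] {a b : α} {l : List α} (hb : b ∈ l)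
    (hab : a ≠ b) : 0 < variations (a :: l) := by
  induction l generalizing a with
  | nil => simp at hb
  | cons c l ih =>
    rw [variations_cons_cons]
    by_cases hac : a = c
    · subst hac
      rcases List.mem_cons.1 hb with rfl | hb
      · exact absurd rfl hab
      · exact Nat.add_pos_left (ih hb hab) _
    · simp [hac]

/-- If all pairs have the same order, then τ⁻¹σ is a strictly increasing bijection of a finite
chain, hence the identity. -/
theorem eq_of_order_eq {σ τ : Equiv.Perm (Fin r)}
    (h : ∀ i j : Fin r, i < j → decide (σ.symm i < σ.symm j) = decide (τ.symm i < τ.symm j)) :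
    σ = τ := by
  have hmono : StrictMono (τ.symm ∘ σ) := by
    intro x y hxy
    rcases lt_trichotomy (σ x) (σ y) with hlt | heq | hlt
    · have := h _ _ hlt
      simp only [Equiv.symm_apply_apply, hxy, decide_true] at this
      simpa using this.symm
    · exact absurd (σ.injective heq) (ne_of_lt hxy)
    -- The hypothesis only compares values in increasing order, so this case uses the reversed pair.
    · have := h _ _ hlt
      simp only [Equiv.symm_apply_apply, hxy.asymm, decide_false] at this
      have h1 : ¬ τ.symm (σ y) < τ.symm (σ x) := by simpa using this.symm
      refine lt_of_le_of_ne (not_lt.1 h1) fun e => ?_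
      exact ne_of_lt hxy (σ.injective (τ.symm.injective e))
  have hid : τ.symm ∘ σ = id := by
    refine (hmono.range_inj strictMono_id).1 ?_
    rw [(τ.symm.surjective.comp σ.surjective).range_eq, Set.range_id]
  ext1 x
  have := congrFun hid x
  rwa [Function.comp_apply, Equiv.symm_apply_eq, id] at this

/-- Without variations, consecutive vertices order all pairs alike and coincide by `eq_of_order_eq`;
a non-degenerate simplex of this kind has only one vertex. -/
theorem range_permBEGen : Set.range (permBEGen : Equiv.Perm (Fin r) → BEGen r) =
    {w : BEGen r | ∀ i j : Fin r, i < j →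
      variations (w.1.map fun σ => decide (σ.symm i < σ.symm j)) < 1} := by
  ext w
  constructor
  · rintro ⟨σ, rfl⟩ i j _
    simp [permBEGen, variations]
  · intro hw
    obtain ⟨w, hne, hc⟩ := w
    match w, hne, hc, hw with
    | [σ], _, _, _ => exact ⟨σ, rfl⟩
    | σ :: τ :: w, _, hc, hw =>
      refine absurd (eq_of_order_eq fun i j hij => ?_) (List.isChain_cons_cons.1 hc).1
      have := hw i j hij
      rw [List.map_cons, List.map_cons, variations_cons_cons] at this
      by_contra hne
      rw [if_pos hne] at this
      omega

/-- If `x` occurs again later, it is followed by some y ≠ x because the sequence is non-degenerate;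
then x, y, …, x has two variations in the subsequence of `x` and `y`. -/
theorem nodup_of_variations_le {u : List (Fin r)} (hc : u.IsChain (· ≠ ·))
    (h : ∀ i j : Fin r, i < j → variations (u.filter fun x => x = i ∨ x = j) ≤ 1) : u.Nodup := by
  by_contra hn
  obtain ⟨x, hx⟩ := List.exists_duplicate_iff_not_nodup.2 hn
  obtain ⟨l₁, l₂, rfl, hx₂⟩ : ∃ l₁ l₂, u = l₁ ++ x :: l₂ ∧ x ∈ l₂ := by
    clear h hc hn
    induction hx with
    | cons_mem hx => exact ⟨[], _, rfl, hx⟩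
    | cons_duplicate _ ih =>
      obtain ⟨l₁, l₂, rfl, hx⟩ := ih
      exact ⟨_ :: l₁, l₂, rfl, hx⟩
  cases l₂ with
  | nil => simp at hx₂
  | cons y l₂ =>
    have hxy : x ≠ y := (List.isChain_cons_cons.1 hc.right_of_append).1
    have hx₃ : x ∈ l₂ := (List.mem_cons.1 hx₂).resolve_left hxy
    have key : ∀ p : Fin r → Bool, p x → p y →
        1 < variations ((l₁ ++ x :: y :: l₂).filter p) := by
      intro p hpx hpy
      rw [List.filter_append, List.filter_cons_of_pos hpx, List.filter_cons_of_pos hpy]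
      refine lt_of_lt_of_le ?_ (variations_le_append _ _)
      rw [variations_cons_cons, if_pos hxy]
      have := variations_pos (List.mem_filter.2 ⟨hx₃, hpx⟩) hxy.symm
      omega
    rcases lt_or_gt_of_ne hxy with hlt | hlt
    · exact absurd (h x y hlt) (not_le.2 (key _ (by simp) (by simp)))
    · exact absurd (h y x hlt) (not_le.2 (key _ (by simp) (by simp)))

/-- For a permutation, the subsequence of two values has at most two terms. Conversely, a surjective
sequence without repeated values is the word of a permutation. -/
theorem range_permSurjGen : Set.range (permSurjGen : Equiv.Perm (Fin r) → SurjGen r) =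
    {u : SurjGen r | ∀ i j : Fin r, i < j →
      variations (u.1.filter fun x => x = i ∨ x = j) ≤ 1} := by
  ext u
  constructor
  · rintro ⟨σ, rfl⟩ i j _
    refine (variations_le_length _).trans ?_
    have hn : ((word σ).filter fun x => x = i ∨ x = j).Nodup := (nodup_word σ).filter _
    have hs : ((word σ).filter fun x => x = i ∨ x = j) ⊆ [i, j] := by
      intro x hx
      simpa using (List.mem_filter.1 hx).2
    have := (List.subperm_of_subset hn hs).length_le
    simp only [List.length_cons, List.length_nil] at this
    change ((word σ).filter fun x => x = i ∨ x = j).length - 1 ≤ 1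
    omega
  · intro hu
    obtain ⟨σ, hσ⟩ := exists_word_eq (nodup_of_variations_le u.2.2 hu) u.2.1
    exact ⟨σ, Subtype.ext hσ⟩

theorem range_assocToBE : LinearMap.range (assocToBE F r) = beFiltration F 1 r := by
  have h := range_lmapDomain (F := F) (permBEGen (r := r))
  rw [← permBEMap_eq, range_permBEGen] at h
  exact h

theorem range_assocToSurj : LinearMap.range (assocToSurj F r) = surjFiltration F 1 r := by
  have h := range_lmapDomain (F := F) (permSurjGen (r := r))
  rw [← permSurjMap_eq, range_permSurjGen] at h
  exact h

end Associative

end TableReduction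

theorem theorem1p3p2 (F : Type u) [CommRing F] :
    -- the surjection complexes form a dg-operad, and the formulas that define its differential
    -- and its composition product hold for all sequences, the degenerate ones included
    IsDGOperad (surjOperad F) ∧
    (∀ (r : ℕ) (u : List (Fin r)), (surjOperad F).diff r (surjClass F u) = surjDiff F u) ∧
    (∀ {r s n : ℕ} (h : n + 1 = r + s) (k : Fin r) (u : List (Fin r)) (v : List (Fin s)),
      (surjOperad F).comp h k (surjClass F u) (surjClass F v) = surjComp F h k u v) ∧
    -- the table reduction map is a surjective morphism of dg-operads
    IsDGOperad (barrattEccles F) ∧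
    IsDGOperadHom (barrattEccles F) (surjOperad F) (tableReduction F) ∧
    (∀ r : ℕ, Function.Surjective (tableReduction F r)) ∧
    -- its value on any simplex, the degenerate ones included
    (∀ (r : ℕ) (w : List (Equiv.Perm (Fin r))),
      tableReduction F r (beClass F w) = tableSum F w) ∧
    -- both first filtration terms are the associative operad, and the table reduction map
    -- restricts to its identity
    IsDGOperad (assocOperad F) ∧
    IsDGOperadHom (assocOperad F) (barrattEccles F) (assocToBE F) ∧
    IsDGOperadHom (assocOperad F) (surjOperad F) (assocToSurj F) ∧
    (∀ r : ℕ, Function.Injective (assocToBE F r) ∧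
      LinearMap.range (assocToBE F r) = beFiltration F 1 r ∧
      Function.Injective (assocToSurj F r) ∧
      LinearMap.range (assocToSurj F r) = surjFiltration F 1 r ∧
      tableReduction F r ∘ₗ assocToBE F r = assocToSurj F r) := by
  exact ⟨TableReduction.isDGOperad_surjOperad,
    fun _ u => TableReduction.surjDiffMap_surjClass u,
    fun h k u v => TableReduction.surjCompMap_surjClass h k u v,
    TableReduction.isDGOperad_barrattEccles,
    TableReduction.isDGOperadHom_tableReduction,
    fun _ => TableReduction.tableMap_surjective,
    fun _ w => TableReduction.tableMap_beClass w,
    TableReduction.isDGOperad_assocOperad,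
    TableReduction.isDGOperadHom_assocToBE,
    TableReduction.isDGOperadHom_assocToSurj,
    fun _ => ⟨TableReduction.assocToBE_injective, TableReduction.range_assocToBE,
      TableReduction.assocToSurj_injective, TableReduction.range_assocToSurj,
      TableReduction.tableReduction_comp_assocToBE⟩⟩
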